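/- Let $\mathcal K=\{C_1,\dots,C_H\}$, $H\ge 4$, be a finite family of closed disks with disjoint interiors on the Riemann sphere $\mathbb C\cup\{\infty\}$ (bounded by circles or lines) such that every gap, i.e. every component of the complement of the disks, is a curvilinear triangle bounded by three mutually tangent circles of $\mathcal K$. For each gap let the dual circle be the circle through its three vertices, let $\mathfrak S$ be the group generated by the reflections in the dual circles, and let $\mathcal P=\mathfrak S\,\mathcal K$ be the resulting circle packing. Fix $C_0\in\mathcal P$; replacing $\mathcal K$ by $g\mathcal K$ with $g\in\mathfrak S$ (which generates the same packing) we may take $C_0\in\mathcal K$. Let $h$ be the number of circles $C_i$ of $\mathcal K$ tangent to $C_0$, and for each of them, with point of tangency $\alpha_i$, let $D_i$ be the hyperbolic area (in the complement of the disk of $C_0$, with curvature $-1$) of the part of the disk $C_i$ lying between the two geodesics joining $\alpha_i$ to the two neighbouring points of tangency. Put $$c_{\mathcal P,C_0}=\frac{\sum_i D_i}{2\pi^2(h-2)} .$$ For $T\ge 0$ let $\mathcal A_T\subset C_0$ be the set of the (finite) points of tangency of $C_0$ with those circles of $\mathcal P$ tangent to $C_0$ whose curvature ($1/\text{radius}$,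 and $0$ for a line) is at most $T$. For an arc $\mathcal I\subseteq C_0$ (a bounded interval if $C_0$ is a line) let $\mathcal A_{T,\mathcal I}=\mathcal A_T\cap\mathcal I$, let $l(\mathcal I)$ be the arc length of $\mathcal I$, and let $$F_{T,\mathcal I}(s)=\frac1{\#\mathcal A_{T,\mathcal I}}\,\#\Big\{x^i_{T,\mathcal I}:\ \frac{d(x^i_{T,\mathcal I},x^{i+1}_{T,\mathcal I})}{l(\mathcal I)/\#\mathcal A_{T,\mathcal I}}\le s\Big\},$$ where $x^i_{T,\mathcal I}$, $x^{i+1}_{T,\mathcal I}$ are consecutive elements of $\mathcal A_{T,\mathcal I}$ along $\mathcal I$ (cyclically if $\mathcal I$ is the full circle) and $d$ is the length of the arc from the first to the second. Then there is $\delta=\delta(\mathcal P,C_0)>0$ such that: (i) for every $T>0$ if $\mathcal A_0=\emptyset$ (no line of $\mathcal P$ touches $C_0$ at a finite point), and for every $T\ge 1$ otherwise, any two consecutive elements $x_T^i,x_T^{i+1}$ of $\mathcal A_T$ on $C_0$ satisfy $$d(x_T^i,x_T^{i+1})\,c_{\mathcal P,C_0}\,T\ \ge\ \delta ;$$ (ii)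 for every arc $\mathcal I$ and every $s\in[0,\delta]$, $\lim_{T\to\infty}F_{T,\mathcal I}(s)=0$; that is, the limiting gap distribution $F(s)=\lim_{T\to\infty}F_{T,\mathcal I}(s)$ vanishes on $[0,\delta]$. -/

import Mathlib

open Set Filter Topology MeasureTheory

noncomputable section

/-- A (closed) generalized disk in the Riemann sphere `OnePoint ℂ`, that is, a circle or line of the
plane together with one of its two sides, in inversive coordinates: the disk consists of the points
`z` with `a |z|² - 2 Re (conj b * z) + c ≤ 0`, where `|b|² - a c = 1`.
If `a > 0` this is the disk of centre `b / a` and radius `1 / a`, if `a < 0` it is the closed exterior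
of the circle of centre `b / a` and radius `1 / |a|`, together with `∞`, and if `a = 0` it is a closed
half plane, together with `∞`.  Each generalized disk has exactly one such triple of coordinates. -/
@[ext]
structure GDisk where
  a : ℝ
  b : ℂ
  c : ℝ
  norm_eq : Complex.normSq b - a * c = 1

namespace GDisk

/-- The defining function of a generalized disk at a finite point. -/
def val (D : GDisk) (z : ℂ) : ℝ :=
  D.a * Complex.normSq z - 2 * ((starRingEnd ℂ) D.b * z).re + D.c

/-- The defining function on the Riemann sphere; only its sign matters, which at `∞` is that of
the leading coefficient `a`. -/
def sval (D : GDisk) : OnePoint ℂ → ℝ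
  | none => D.a
  | some z => D.val z

/-- The closed disk, as a subset of the Riemann sphere. -/
def closedDisk (D : GDisk) : Set (OnePoint ℂ) := {p | D.sval p ≤ 0}

/-- The open disk, as a subset of the Riemann sphere. -/
def openDisk (D : GDisk) : Set (OnePoint ℂ) := {p | D.sval p < 0}

/-- The bounding circle or line (a line contains `∞`), as a subset of the Riemann sphere. -/
def circle (D : GDisk) : Set (OnePoint ℂ) := {p | D.sval p = 0}

theorem mem_circle_iff (D : GDisk) (hD : D.a ≠ 0) (z : ℂ) :
    (z : OnePoint ℂ) ∈ D.circle ↔ ‖z - D.b / D.a‖ = 1 / |D.a| := by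
  have h := D.norm_eq
  have hd : D.b / (D.a : ℂ) = ((1 / D.a : ℝ) : ℂ) * D.b := by push_cast; ring
  have key : D.val z * D.a = (‖z - D.b / D.a‖ * |D.a|) ^ 2 - 1 := by
    rw [mul_pow, sq_abs, ← Complex.normSq_eq_norm_sq, hd]
    simp only [val, Complex.normSq_apply, Complex.sub_re, Complex.sub_im, Complex.mul_re,
      Complex.mul_im, Complex.conj_re, Complex.conj_im, Complex.ofReal_re, Complex.ofReal_im] at *
    field_simp
    linear_combination (-1 : ℝ) * h
  have ha : 0 < |D.a| := abs_pos.mpr hD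
  rw [eq_div_iff ha.ne']
  change D.val z = 0 ↔ _
  constructor
  · intro hz
    rw [hz, zero_mul] at key
    nlinarith [mul_nonneg (norm_nonneg (z - D.b / D.a)) ha.le]
  · intro hz
    rw [hz] at key
    exact (mul_eq_zero.mp (key.trans (by norm_num))).resolve_right hD

/-- The curvature of the bounding circle: the reciprocal of its radius, and `0` for a line. -/
def curvature (D : GDisk) : ℝ := |D.a|

/-- Two circles of the Riemann sphere are tangent if they have exactly one common point.
(Parallel lines are tangent at `∞`.) -/
def Tangent (C D : GDisk) : Prop := ∃! p : OnePoint ℂ, p ∈ C.circle ∧ p ∈ D.circle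

/-- The inversive product of two generalized disks. -/
def inv (C D : GDisk) : ℝ :=
  ((starRingEnd ℂ) C.b * D.b).re - (C.a * D.c + D.a * C.c) / 2

/-- The image of the generalized disk `D` under the reflection (inversion) in the bounding circle
of `U`; see `mem_closedDisk_reflect` and `mem_closedDisk_reflect_line`. -/
def reflect (U D : GDisk) : GDisk where
  a := D.a - 2 * U.inv D * U.a
  b := D.b - ((2 * U.inv D : ℝ) : ℂ) * U.b
  c := D.c - 2 * U.inv D * U.c
  norm_eq := by
    have hU := U.norm_eq
    have hD := D.norm_eq
    simp only [inv, Complex.normSq_apply, Complex.sub_re, Complex.sub_im, Complex.mul_re,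
      Complex.mul_im, Complex.conj_re, Complex.conj_im, Complex.ofReal_re, Complex.ofReal_im] at *
    linear_combination hD + 4 * (U.b.re * D.b.re + U.b.im * D.b.im
      - (U.a * D.c + D.a * U.c) / 2) ^ 2 * hU

theorem reflect_reflect (U D : GDisk) : U.reflect (U.reflect D) = D := by
  have hU := U.norm_eq
  have key : U.inv (U.reflect D) = - U.inv D := by
    simp only [reflect, inv, Complex.normSq_apply, Complex.sub_re, Complex.sub_im, Complex.mul_re,
      Complex.mul_im, Complex.conj_re, Complex.conj_im, Complex.ofReal_re, Complex.ofReal_im] at *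
    linear_combination (-2) * (U.b.re * D.b.re + U.b.im * D.b.im
      - (U.a * D.c + D.a * U.c) / 2) * hU
  ext1
  · change (U.reflect D).a - 2 * U.inv (U.reflect D) * U.a = D.a
    rw [key]; simp only [reflect]; ring
  · change (U.reflect D).b - ((2 * U.inv (U.reflect D) : ℝ) : ℂ) * U.b = D.b
    rw [key]; simp only [reflect]; push_cast; ring
  · change (U.reflect D).c - 2 * U.inv (U.reflect D) * U.c = D.c
    rw [key]; simp only [reflect]; ring

/-- The reflection in the bounding circle of `U`, acting on generalized disks. -/
def reflection (U : GDisk) : Equiv.Perm GDisk where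
  toFun := U.reflect
  invFun := U.reflect
  left_inv := U.reflect_reflect
  right_inv := U.reflect_reflect

/-- The bounding curve, parametrized by arc length: counterclockwise if it is a circle. -/
def param (D : GDisk) (t : ℝ) : ℂ :=
  if D.a = 0 then ((D.c / 2 : ℝ) : ℂ) * D.b + (t : ℂ) * (Complex.I * D.b)
  else D.b / (D.a : ℂ) + ((1 / |D.a| : ℝ) : ℂ) * Complex.exp (((|D.a| * t : ℝ) : ℂ) * Complex.I)

/-- If the bounding curve of `U` is a circle of centre `m` and radius `r`, then reflecting a disk in it is the
same as applying the inversion `z ↦ m + r² / conj (z - m)` to its points. -/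
theorem mem_closedDisk_reflect (U D : GDisk) (hU : U.a ≠ 0) (z : ℂ) (hz : z ≠ U.b / U.a) :
    ((z : OnePoint ℂ) ∈ (U.reflect D).closedDisk) ↔
      ((U.b / U.a + ((1 / U.a : ℝ) : ℂ) ^ 2 / (starRingEnd ℂ) (z - U.b / U.a) : ℂ) : OnePoint ℂ)
        ∈ D.closedDisk := by
  set w : ℂ := z - U.b / U.a with hw
  have hw0 : w ≠ 0 := sub_ne_zero.mpr hz
  have hpos : 0 < U.a ^ 2 * Complex.normSq w :=
    mul_pos (by positivity) (Complex.normSq_pos.mpr hw0)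
  have hzw : z = U.b / U.a + w := by rw [hw]; ring
  have hn : Complex.normSq w ≠ 0 := (Complex.normSq_pos.mpr hw0).ne'
  have key : (U.reflect D).val z = D.val (U.b / U.a + ((1 / U.a : ℝ) : ℂ) ^ 2 /
      (starRingEnd ℂ) w) * (U.a ^ 2 * Complex.normSq w) := by
    have hc : U.c = (Complex.normSq U.b - 1) / U.a := by
      have := U.norm_eq
      field_simp
      linarith
    have hq : ((1 / U.a : ℝ) : ℂ) ^ 2 / (starRingEnd ℂ) w
        = ((1 / (U.a ^ 2 * Complex.normSq w) : ℝ) : ℂ) * w := by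
      have h1 : (starRingEnd ℂ) w ≠ 0 := by simpa using hw0
      have h2 : (U.a : ℂ) ≠ 0 := by exact_mod_cast hU
      rw [div_eq_iff h1, mul_assoc, Complex.mul_conj]
      have h3 : (Complex.normSq w : ℂ) ≠ 0 := by exact_mod_cast hn
      push_cast
      field_simp
    have hd : U.b / (U.a : ℂ) = ((1 / U.a : ℝ) : ℂ) * U.b := by push_cast; ring
    rw [hq, hzw, hd]
    simp only [reflect, inv, val, hc]
    simp only [Complex.normSq_apply, Complex.add_re, Complex.add_im, Complex.sub_re,
      Complex.sub_im, Complex.mul_re, Complex.mul_im, Complex.conj_re, Complex.conj_im,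
      Complex.ofReal_re, Complex.ofReal_im] at *
    have hn2 : w.re ^ 2 + w.im ^ 2 ≠ 0 := by simpa only [sq] using hn
    field_simp
    ring
  change (U.reflect D).val z ≤ 0 ↔ D.val _ ≤ 0
  rw [key]
  exact ⟨fun h => by nlinarith, fun h => mul_nonpos_of_nonpos_of_nonneg h hpos.le⟩

/-- If the bounding curve of `U` is a line, then reflecting a disk in it is the same as applying
the Euclidean reflection in this line to its points. -/
theorem mem_closedDisk_reflect_line (U D : GDisk) (hU : U.a = 0) (z : ℂ) :
    ((z : OnePoint ℂ) ∈ (U.reflect D).closedDisk) ↔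
      ((z + ((U.val z : ℝ) : ℂ) * U.b : ℂ) : OnePoint ℂ)
        ∈ D.closedDisk := by
  have hb := U.norm_eq
  have key : (U.reflect D).val z = D.val (z + ((U.val z : ℝ) : ℂ) * U.b) := by
    simp only [reflect, inv, val, hU]
    simp only [Complex.normSq_apply, Complex.add_re, Complex.add_im, Complex.sub_re,
      Complex.sub_im, Complex.mul_re, Complex.mul_im, Complex.conj_re, Complex.conj_im,
      Complex.ofReal_re, Complex.ofReal_im, hU] at *
    linear_combination (-D.a * (-2 * (U.b.re * z.re + U.b.im * z.im) + U.c) ^ 2) * hb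
  change (U.reflect D).val z ≤ 0 ↔ D.val _ ≤ 0
  rw [key]

/-- The points `param t` lie on the bounding circle. -/
theorem param_mem_circle (D : GDisk) (t : ℝ) : (D.param t : OnePoint ℂ) ∈ D.circle := by
  change D.val (D.param t) = 0
  have h := D.norm_eq
  unfold param
  split_ifs with ha
  · simp only [val, ha, Complex.normSq_apply, Complex.add_re, Complex.add_im, Complex.mul_re,
      Complex.mul_im, Complex.conj_re, Complex.conj_im, Complex.ofReal_re, Complex.ofReal_im,
      Complex.I_re, Complex.I_im] at *
    linear_combination (-D.c) * h
  · have hc : D.c = (Complex.normSq D.b - 1) / D.a := by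
      field_simp
      linarith
    have hd : D.b / (D.a : ℂ) = ((1 / D.a : ℝ) : ℂ) * D.b := by push_cast; ring
    have hs := Real.sin_sq_add_cos_sq (|D.a| * t)
    have hab : |D.a| ^ 2 = D.a ^ 2 := sq_abs _
    have hab0 : |D.a| ≠ 0 := abs_ne_zero.mpr ha
    rw [hd]
    simp only [val, hc, Complex.normSq_apply, Complex.add_re, Complex.add_im, Complex.mul_re,
      Complex.mul_im, Complex.conj_re, Complex.conj_im, Complex.ofReal_re, Complex.ofReal_im,
      Complex.exp_ofReal_mul_I_re, Complex.exp_ofReal_mul_I_im]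
    set S := Real.sin (|D.a| * t)
    set C := Real.cos (|D.a| * t)
    field_simp
    linear_combination (D.a ^ 2) * hs - hab

/-- The hyperbolic area of a set in the complement of the generalized disk `D`, for the hyperbolic
metric `2 |dz| / val D z` of curvature `-1` on this complement (the usual metric `|dz| / Im z`
if the complement is the upper half plane, and `2 R |dz| / (R² - |z|²)` if it is the
disk of centre `0` and radius `R`). -/
def hypArea (D : GDisk) (S : Set ℂ) : ENNReal :=
  ∫⁻ z in S, ENNReal.ofReal (4 / D.val z ^ 2)

end GDisk

open GDisk

variable {ι : Type*}

/-- `U` is bounded by the dual circle of a triangular gap of the configuration `K`: the circles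
`K i`, `K j`, `K k` are mutually tangent, the bounding circle of `U` passes through the three
points of tangency, and no other disk of `K` meets the side `U` of it. The gap is then the
curvilinear triangle that is cut out of `U` by the three disks. -/
structure IsDualDisk (K : ι → GDisk) (i j k : ι) (U : GDisk) : Prop where
  tangent_ij : Tangent (K i) (K j)
  tangent_jk : Tangent (K j) (K k)
  tangent_ki : Tangent (K k) (K i)
  vertex_ij : (K i).circle ∩ (K j).circle ⊆ U.circle
  vertex_jk : (K j).circle ∩ (K k).circle ⊆ U.circle
  vertex_ki : (K k).circle ∩ (K i).circle ⊆ U.circle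
  disjoint : ∀ l, l ≠ i → l ≠ j → l ≠ k → Disjoint U.openDisk (K l).openDisk

/-- An initial configuration: at least four disks in the Riemann sphere with disjoint interiors,
such that all gaps are triangular, that is, each point outside of the disks lies in a triangular gap. -/
structure IsInitialConfiguration [Fintype ι] (K : ι → GDisk) : Prop where
  four_le_card : 4 ≤ Fintype.card ι
  disjoint : ∀ i j, i ≠ j → Disjoint (K i).openDisk (K j).openDisk
  triangular : ∀ p : OnePoint ℂ, (∀ l, p ∉ (K l).closedDisk) →
    ∃ i j k U, IsDualDisk K i j k U ∧ p ∈ U.openDisk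

/-- The group generated by the reflections in the dual circles of the triangular gaps. -/
def reflectionGroup (K : ι → GDisk) : Subgroup (Equiv.Perm GDisk) :=
  Subgroup.closure {σ | ∃ i j k U, IsDualDisk K i j k U ∧ σ = U.reflection}

/-- The circle packing generated by the configuration `K`. -/
def packing (K : ι → GDisk) : Set GDisk :=
  {C | ∃ g ∈ reflectionGroup K, ∃ i, C = g (K i)}

/-- The part of the disk `K i` (tangent to `K i₀`) between the two geodesics that join its point of
tangency with the base circle `K i₀` to the next ones. These geodesics are the dual
circles of the two gaps which are adjacent to both `K i₀` and `K i`. -/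
def cuspRegion (K : ι → GDisk) (i₀ i : ι) : Set ℂ :=
  {z | (z : OnePoint ℂ) ∈ (K i).closedDisk ∧
    ∀ j U, IsDualDisk K i₀ i j U → (z : OnePoint ℂ) ∉ U.closedDisk}

/-- The constant `D / (2 π² (h - 2))` of the base circle `K i₀`, where `h` is the number of
circles of `K` which are tangent to `K i₀` and `D` is the sum of the hyperbolic areas of
the corresponding regions. -/
def tangencyDensity (K : ι → GDisk) (i₀ : ι) : ℝ :=
  (∑ᶠ i ∈ {i | Tangent (K i) (K i₀)}, ((K i₀).hypArea (cuspRegion K i₀ i)).toReal) /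
    (2 * Real.pi ^ 2 * (({i | Tangent (K i) (K i₀)}.ncard : ℝ) - 2))

/-- The set `A_T` of the points of tangency (in the finite plane) of `C₀` with the circles in `P` that
are tangent to `C₀` and have curvature at most `T`. -/
def tangencies (P : Set GDisk) (C₀ : GDisk) (T : ℝ) : Set ℂ :=
  {x | ∃ C ∈ P, Tangent C C₀ ∧ C.curvature ≤ T ∧
    (x : OnePoint ℂ) ∈ C.circle ∧ (x : OnePoint ℂ) ∈ C₀.circle}

/-- The arc of `C₀` from the parameter `t` to the parameter `t'` is a gap of `A_T`: its
end points are consecutive elements of `A_T`. Its length is `t' - t`. -/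
def IsGap (P : Set GDisk) (C₀ : GDisk) (T t t' : ℝ) : Prop :=
  t < t' ∧ C₀.param t ∈ tangencies P C₀ T ∧ C₀.param t' ∈ tangencies P C₀ T ∧
    ∀ r ∈ Ioo t t', C₀.param r ∉ tangencies P C₀ T

/-- `J` is an interval of arc length parameters for an arc of `C₀` (a bounded interval
if `C₀` is a line); the arc may contain its end points or not, and may be the full circle. -/
structure IsArc (C₀ : GDisk) (J : Set ℝ) : Prop where
  ordConnected : J.OrdConnected
  bounded : Bornology.IsBounded J
  nontrivial : (interior J).Nonempty
  injOn : InjOn C₀.param J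

/-- The mean spacing in the arc of `C₀` with parameter interval `J`: its length, divided by the number of
elements of `A_T` in it. -/
def meanSpacing (P : Set GDisk) (C₀ : GDisk) (J : Set ℝ) (T : ℝ) : ℝ :=
  (volume J).toReal / ((tangencies P C₀ T ∩ C₀.param '' J).ncard : ℝ)

/-- The gap distribution function of `A_T` in the arc of `C₀` with parameter interval `J`: the proportion
of the elements of `A_T` in the arc for which the gap to the next element in
the arc is at most `s` times the mean spacing. -/
def gapDistribution (P : Set GDisk) (C₀ : GDisk) (J : Set ℝ) (T s : ℝ) : ℝ :=
  ({x | x ∈ tangencies P C₀ T ∩ C₀.param '' J ∧ ∃ t t', C₀.param t = x ∧ IsGap P C₀ T t t' ∧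
      C₀.param '' Icc t t' ⊆ C₀.param '' J ∧ (t' - t) / meanSpacing P C₀ J T ≤ s}.ncard : ℝ) /
    ((tangencies P C₀ T ∩ C₀.param '' J).ncard : ℝ)

end

/-!
A generalized disk is a unit vector for a Lorentz form `lor` of signature `(3, 1)` on its coordinates
`(a, b, c)`. The points of the sphere are the rays of the future light cone, represented by the vectors
`null p`. Reflections are Lorentz reflections, and the inversive product is the value of the form.

*Separation.* Disjoint open disks have inversive product at most `-1` (`GDisk.inv_le_of_disjoint`). The dual
disks of the initial configuration also have this property, among each other (`lor_dualDisks`) and with the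
disks to which they are not orthogonal, so that a ping-pong argument for reduced words of reflections extends it
to all different disks of the packing (`packing_inv_le`). If `C` and `D` touch the base circle `C₀`
at `x` and `y`, then `C + C₀` and `D + C₀` are multiples of `null x` and `null y`, so that
`(a_C + a₀) (a_D + a₀) |x - y|² = 2 (1 - ⟨C, D⟩) ≥ 4`. Points of tangency with circles of curvature
at most `T` therefore have distance at least `2 / (T + |a₀|)` (`IsGap.two_le`), which is the first assertion for
`T` bounded away from `0`. If no line touches the circle `C₀` at a finite point, then the curvatures of the
tangent circles are bounded away from `0`, since three points of a circle of radius `r` cannot have distances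
close to `2 r` (`exists_curvature_ge`).

*Counting.* For the second assertion the number of points of tangency in an arc has to grow at least
linearly in `T`, since the separation then exceeds a fixed multiple of the mean spacing. The
reflections in the dual disks of the gaps along `C₀` generate a tessellation of the hyperbolic
plane in the complement of `C₀` by translates of an ideal polygon whose cusps are points of
tangency. Thus every point of the plane has bounded distance from the horocycle of such a cusp
(`exists_tangent_near`). At height `1 / T` above a point of `C₀` this is a Dirichlet
approximation theorem (`exists_tangentAt_near`). The intervals that it provides cover the arc. By the separation,
those of circles of small curvature cover only a small part of it, and the others have length
`O(1 / T)`, so that there are at least `const * T` of them (`length_mul_le_card`, `exists_le_ncard`).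

*The constant.* The two assertions are about `c T` for the constant `c` of the density, and `c` must be
positive, that is, the hyperbolic areas must be finite and not zero and there must be at least three tangent circles
(`tangencyDensity_pos`). In a coordinate that sends the cusp to infinity, a cusp region lies in a half strip
and contains an open set. Finally the configuration may be replaced by its image under an element of the
reflection group, as it generates the same packing (`packing_map`).
-/

noncomputable section

open GDisk

variable {ι : Type*}

/-! ### The Lorentz form -/

/-- The space of coordinates `(a, b, c)` of generalized disks, with the Lorentz form `lor`. -/
abbrev LSpace : Type := ℝ × ℂ × ℝ

/-- The Lorentz form of signature `(3, 1)` whose unit vectors are the generalized disks. -/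
def lor (v w : LSpace) : ℝ :=
  v.2.1.re * w.2.1.re + v.2.1.im * w.2.1.im - (v.1 * w.2.2 + w.1 * v.2.2) / 2

theorem lor_comm (v w : LSpace) : lor v w = lor w v := by simp only [lor]; ring

theorem lor_add_left (u v w : LSpace) : lor (u + v) w = lor u w + lor v w := by
  simp only [lor, Prod.fst_add, Prod.snd_add, Complex.add_re, Complex.add_im]; ring

theorem lor_add_right (u v w : LSpace) : lor u (v + w) = lor u v + lor u w := by
  rw [lor_comm, lor_add_left, lor_comm v, lor_comm w]

theorem lor_smul_left (r : ℝ) (v w : LSpace) : lor (r • v) w = r * lor v w := by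
  simp [lor]; ring

theorem lor_smul_right (r : ℝ) (v w : LSpace) : lor v (r • w) = r * lor v w := by
  rw [lor_comm, lor_smul_left, lor_comm]

theorem lor_neg_left (v w : LSpace) : lor (-v) w = -lor v w := by
  simp [lor]; ring

theorem lor_sub_left (u v w : LSpace) : lor (u - v) w = lor u w - lor v w := by
  simp [lor]; ring

theorem lor_sub_right (u v w : LSpace) : lor u (v - w) = lor u v - lor u w := by
  simp [lor]; ring

theorem lor_zero_left (v : LSpace) : lor 0 v = 0 := by simp [lor]

theorem lor_sum_right {α : Type*} (s : Finset α) (u : LSpace) (f : α → LSpace) :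
    lor u (∑ i ∈ s, f i) = ∑ i ∈ s, lor u (f i) := by
  classical
  induction s using Finset.induction_on with
  | empty => simp [lor]
  | insert a s ha ih => rw [Finset.sum_insert ha, Finset.sum_insert ha, lor_add_right, ih]

/-- The vector on the light cone that represents a point of the Riemann sphere. -/
def null : OnePoint ℂ → LSpace
  | none => (0, 0, 1)
  | some z => (1, z, Complex.normSq z)

theorem null_coe (z : ℂ) : null (z : OnePoint ℂ) = (1, z, Complex.normSq z) := rfl

theorem null_infty : null OnePoint.infty = (0, 0, 1) := rfl

namespace GDisk

/-- A generalized disk as a unit vector. -/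
def vec (D : GDisk) : LSpace := (D.a, D.b, D.c)

theorem vec_injective : Function.Injective vec := by
  intro C D h
  simp only [vec, Prod.mk.injEq] at h
  ext1
  exacts [h.1, h.2.1, h.2.2]

theorem lor_vec (C D : GDisk) : lor C.vec D.vec = C.inv D := by
  simp [lor, vec, inv]

theorem lor_vec_self (C : GDisk) : lor C.vec C.vec = 1 := by
  have := C.norm_eq
  simp only [lor, vec, Complex.normSq_apply] at *
  linarith

/-- Unit vectors are generalized disks. -/
def ofVec (v : LSpace) (hv : lor v v = 1) : GDisk where
  a := v.1
  b := v.2.1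
  c := v.2.2
  norm_eq := by
    simp only [lor, Complex.normSq_apply] at *
    linarith

/-- The generalized disk complementary to `D`. -/
def compl (D : GDisk) : GDisk := ofVec (-D.vec) (by
  rw [lor_neg_left, lor_comm, lor_neg_left, lor_vec_self]; norm_num)

theorem vec_compl (D : GDisk) : D.compl.vec = -D.vec := rfl

theorem sval_eq (D : GDisk) (p : OnePoint ℂ) : D.sval p = -2 * lor D.vec (null p) := by
  cases p with
  | infty =>
    rw [null_infty]
    simp only [lor, vec]
    change D.a = _
    simp
    ring
  | coe z =>
    rw [null_coe]
    simp only [lor, vec]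
    change D.val z = _
    simp only [val, Complex.mul_re, Complex.conj_re, Complex.conj_im]
    ring

theorem mem_openDisk_iff (D : GDisk) (p : OnePoint ℂ) :
    p ∈ D.openDisk ↔ 0 < lor D.vec (null p) := by
  change D.sval p < 0 ↔ _
  rw [sval_eq]; constructor <;> intro h <;> linarith

theorem mem_closedDisk_iff (D : GDisk) (p : OnePoint ℂ) :
    p ∈ D.closedDisk ↔ 0 ≤ lor D.vec (null p) := by
  change D.sval p ≤ 0 ↔ _
  rw [sval_eq]; constructor <;> intro h <;> linarith

theorem mem_circle_iff_lor (D : GDisk) (p : OnePoint ℂ) :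
    p ∈ D.circle ↔ lor D.vec (null p) = 0 := by
  change D.sval p = 0 ↔ _
  rw [sval_eq]; constructor <;> intro h <;> linarith

end GDisk

/-! ### The light cone -/

theorem lor_null_null (p : OnePoint ℂ) : lor (null p) (null p) = 0 := by
  cases p with
  | infty => simp [null_infty, lor]
  | coe z => rw [null_coe]; simp only [lor, Complex.normSq_apply]; ring

theorem lor_null_coe_coe (z w : ℂ) :
    lor (null (z : OnePoint ℂ)) (null (w : OnePoint ℂ)) = -(‖z - w‖ ^ 2 / 2) := by
  rw [null_coe, null_coe, ← Complex.normSq_eq_norm_sq]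
  simp only [lor, Complex.normSq_apply, Complex.sub_re, Complex.sub_im]; ring

theorem lor_null_neg {p q : OnePoint ℂ} (h : p ≠ q) : lor (null p) (null q) < 0 := by
  cases p with
  | infty =>
    cases q with
    | infty => exact absurd rfl h
    | coe w => rw [null_coe, null_infty]; simp [lor]
  | coe z =>
    cases q with
    | infty => rw [null_coe, null_infty]; simp [lor]
    | coe w =>
      rw [lor_null_coe_coe]
      have : z - w ≠ 0 := fun h' => h (by rw [sub_eq_zero.mp h'])
      have := norm_pos_iff.mpr this
      have : 0 < ‖z - w‖ ^ 2 := by positivity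
      linarith

theorem lor_null_nonpos (p q : OnePoint ℂ) : lor (null p) (null q) ≤ 0 := by
  rcases eq_or_ne p q with rfl | h
  · exact (lor_null_null p).le
  · exact (lor_null_neg h).le

theorem eq_of_lor_null_eq_zero {p q : OnePoint ℂ} (h : lor (null p) (null q) = 0) : p = q := by
  by_contra h'
  exact (lor_null_neg h').ne h

theorem null_ne_zero (p : OnePoint ℂ) : null p ≠ 0 := by
  cases p with
  | infty => rw [null_infty]; simp
  | coe z => rw [null_coe]; simp

/-- A nonzero isotropic vector lies on the ray, or on the opposite of the ray, of a point of the
sphere. -/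
theorem exists_eq_smul_null {v : LSpace} (hv : lor v v = 0) (h0 : v ≠ 0) :
    ∃ p, ∃ r : ℝ, r ≠ 0 ∧ v = r • null p := by
  obtain ⟨a, b, c⟩ := v
  simp only [lor] at hv
  by_cases ha : a = 0
  · subst ha
    have hb : b = 0 := by
      apply Complex.ext <;> simp <;> nlinarith [sq_nonneg b.re, sq_nonneg b.im]
    subst hb
    refine ⟨OnePoint.infty, c, ?_, by simp [null_infty]⟩
    rintro rfl
    exact h0 rfl
  · refine ⟨((b / a : ℂ) : OnePoint ℂ), a, ha, ?_⟩
    have ha' : (a : ℂ) ≠ 0 := by exact_mod_cast ha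
    rw [null_coe]
    ext1
    · simp
    · ext1
      · simp [mul_div_cancel₀ _ ha']
      · simp
        field_simp
        rw [Complex.normSq_apply]
        linarith

/-- The Lorentz form is positive semidefinite on the orthogonal complement of an isotropic vector,
with this vector spanning the kernel. -/
theorem eq_smul_null_of_lor_eq_zero {v : LSpace} {p : OnePoint ℂ} (h : lor v (null p) = 0)
    (hv : lor v v ≤ 0) : ∃ r : ℝ, v = r • null p := by
  obtain ⟨a, b, c⟩ := v
  cases p with
  | infty =>
    rw [null_infty] at h
    simp [lor] at h hv
    subst h
    have hb : b = 0 := by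
      apply Complex.ext <;> simp <;> nlinarith [sq_nonneg b.re, sq_nonneg b.im]
    subst hb
    exact ⟨c, by simp [null_infty]⟩
  | coe z =>
    rw [null_coe] at h
    simp only [lor, Complex.normSq_apply] at h hv
    have key : (b.re - a * z.re) ^ 2 + (b.im - a * z.im) ^ 2 ≤ 0 := by
      linear_combination hv - 2 * a * h
    have h1 : b.re - a * z.re = 0 := by
      nlinarith [sq_nonneg (b.re - a * z.re), sq_nonneg (b.im - a * z.im)]
    have h2 : b.im - a * z.im = 0 := by
      nlinarith [sq_nonneg (b.re - a * z.re), sq_nonneg (b.im - a * z.im)]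
    have h1' : b.re = a * z.re := by linarith
    have h2' : b.im = a * z.im := by linarith
    refine ⟨a, ?_⟩
    rw [null_coe]
    ext1
    · simp
    · ext1
      · apply Complex.ext <;> simp [h1', h2']
      · simp only [h1', h2'] at h
        simp [Complex.normSq_apply]
        linarith

/-- A causal vector or its opposite lies in the closed future cone. -/
theorem lor_null_nonpos_or_nonneg {v : LSpace} (hv : lor v v ≤ 0) :
    (∀ p, lor v (null p) ≤ 0) ∨ (∀ p, 0 ≤ lor v (null p)) := by
  have main : ∀ w : LSpace, lor w w ≤ 0 → 0 ≤ w.1 → 0 ≤ w.2.2 → ∀ p, lor w (null p) ≤ 0 := by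
    rintro ⟨a, b, c⟩ hw ha hc p
    simp only at ha hc
    cases p with
    | infty => rw [null_infty]; simp [lor]; linarith
    | coe z =>
      rw [null_coe]
      simp only [lor, Complex.normSq_apply] at *
      rcases ha.eq_or_lt with rfl | ha
      · have h1 : b.re = 0 := by nlinarith [sq_nonneg b.re, sq_nonneg b.im]
        have h2 : b.im = 0 := by nlinarith [sq_nonneg b.re, sq_nonneg b.im]
        rw [h1, h2]; linarith
      · have : 0 ≤ a * ((a * (z.re * z.re + z.im * z.im) + 1 * c) / 2
            - (b.re * z.re + b.im * z.im)) := by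
          nlinarith [sq_nonneg (b.re - a * z.re), sq_nonneg (b.im - a * z.im)]
        nlinarith [nonneg_of_mul_nonneg_right this ha]
  have hac : 0 ≤ v.1 * v.2.2 := by
    simp only [lor] at hv
    nlinarith [sq_nonneg v.2.1.re, sq_nonneg v.2.1.im]
  rcases mul_nonneg_iff.mp hac with ⟨h1, h2⟩ | ⟨h1, h2⟩
  · exact Or.inl (main v hv h1 h2)
  · refine Or.inr fun p => ?_
    have := main (-v) (by rw [lor_neg_left, lor_comm, lor_neg_left]; linarith)
      (by simpa using h1) (by simpa using h2) p
    rw [lor_neg_left] at this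
    linarith

/-! ### Lorentz transformations and reflections -/

/-- A linear automorphism which preserves the Lorentz form and the future light cone, that is, a
Möbius or anti-Möbius transformation of the sphere. -/
structure IsMoebius (L : LSpace ≃ₗ[ℝ] LSpace) : Prop where
  lor_map : ∀ v w, lor (L v) (L w) = lor v w
  map_null : ∀ p, ∃ q, ∃ r : ℝ, 0 < r ∧ L (null p) = r • null q

theorem IsMoebius.one : IsMoebius 1 :=
  ⟨fun _ _ => rfl, fun p => ⟨p, 1, one_pos, by simp⟩⟩

theorem IsMoebius.mul {L M : LSpace ≃ₗ[ℝ] LSpace} (hL : IsMoebius L) (hM : IsMoebius M) :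
    IsMoebius (L * M) := by
  refine ⟨fun v w => by rw [LinearEquiv.mul_apply, LinearEquiv.mul_apply, hL.lor_map, hM.lor_map],
    fun p => ?_⟩
  obtain ⟨q, r, hr, h⟩ := hM.map_null p
  obtain ⟨q', r', hr', h'⟩ := hL.map_null q
  exact ⟨q', r * r', mul_pos hr hr', by rw [LinearEquiv.mul_apply, h, map_smul, h', mul_smul]⟩

theorem smul_null_inj {p q : OnePoint ℂ} {r s : ℝ} (hr : r ≠ 0) (h : r • null p = s • null q) :
    p = q ∧ r = s := by
  have hpq : p = q := by
    apply eq_of_lor_null_eq_zero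
    have : lor (r • null p) (null q) = 0 := by rw [h, lor_smul_left, lor_null_null, mul_zero]
    rw [lor_smul_left] at this
    exact (mul_eq_zero.mp this).resolve_left hr
  subst hpq
  exact ⟨rfl, smul_left_injective ℝ (null_ne_zero p) h⟩

theorem IsMoebius.inv {L : LSpace ≃ₗ[ℝ] LSpace} (hL : IsMoebius L) : IsMoebius L⁻¹ := by
  have hinv : ∀ v, L (L⁻¹ v) = v := fun v => LinearEquiv.apply_symm_apply L v
  refine ⟨fun v w => by rw [← hL.lor_map, hinv, hinv], fun p => ?_⟩
  obtain ⟨q, r, hr, h⟩ := exists_eq_smul_null (v := L⁻¹ (null p))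
    (by rw [← hL.lor_map, hinv, lor_null_null])
    (fun h => null_ne_zero p (by rw [← hinv (null p), h, map_zero]))
  obtain ⟨q', r', hr', h'⟩ := hL.map_null q
  have h2 : (1 : ℝ) • null p = (r * r') • null q' := by
    rw [one_smul, ← hinv (null p), h, map_smul, h', mul_smul]
  have h3 := (smul_null_inj one_ne_zero h2).2
  refine ⟨q, r, ?_, h⟩
  by_contra hneg
  nlinarith

/-- The linear reflection in a generalized disk. -/
def lrefl (U : GDisk) : LSpace ≃ₗ[ℝ] LSpace :=
  LinearEquiv.ofInvolutive
    { toFun := fun v => v - (2 * lor U.vec v) • U.vec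
      map_add' := fun v w => by rw [lor_add_right]; module
      map_smul' := fun r v => by rw [lor_smul_right]; simp only [RingHom.id_apply]; module }
    (fun v => by
      have : lor U.vec (v - (2 * lor U.vec v) • U.vec) = - lor U.vec v := by
        rw [lor_sub_right, lor_smul_right, lor_vec_self]; ring
      simp only [LinearMap.coe_mk, AddHom.coe_mk, this]
      module)

theorem lrefl_apply (U : GDisk) (v : LSpace) : lrefl U v = v - (2 * lor U.vec v) • U.vec := rfl

theorem lrefl_lrefl (U : GDisk) (v : LSpace) : lrefl U (lrefl U v) = v :=
  (lrefl U).left_inv v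

theorem lor_lrefl (U : GDisk) (v w : LSpace) : lor (lrefl U v) (lrefl U w) = lor v w := by
  simp only [lrefl_apply, lor_sub_left, lor_sub_right, lor_smul_left, lor_smul_right,
    lor_vec_self]
  rw [lor_comm v U.vec]; ring

theorem vec_reflect (U D : GDisk) : (U.reflect D).vec = lrefl U D.vec := by
  rw [lrefl_apply, lor_vec]
  ext <;> simp [vec, reflect]

theorem isMoebius_lrefl (U : GDisk) : IsMoebius (lrefl U) := by
  refine ⟨lor_lrefl U, fun p => ?_⟩
  have h0 : lrefl U (null p) ≠ 0 := by
    intro h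
    exact null_ne_zero p (by rw [← lrefl_lrefl U (null p), h, map_zero])
  obtain ⟨q, r, hr, h⟩ := exists_eq_smul_null (by rw [lor_lrefl, lor_null_null]) h0
  refine ⟨q, r, lt_of_le_of_ne ?_ hr.symm, h⟩
  have hU := U.norm_eq
  -- the reflected vector has nonnegative outer coordinates
  have key : 0 ≤ (lrefl U (null p)).1 ∧ 0 ≤ (lrefl U (null p)).2.2 := by
    rw [lrefl_apply]
    cases p with
    | infty =>
      rw [null_infty]
      simp only [lor, vec, Complex.normSq_apply] at *
      simp
      constructor
      · nlinarith [sq_nonneg U.a]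
      · nlinarith [sq_nonneg U.b.re, sq_nonneg U.b.im]
    | coe z =>
      rw [null_coe]
      simp only [lor, vec, Complex.normSq_apply] at *
      simp only [Prod.fst_sub, Prod.snd_sub, Prod.smul_fst, Prod.smul_snd, smul_eq_mul]
      constructor
      · nlinarith [sq_nonneg (U.a * z.re - U.b.re), sq_nonneg (U.a * z.im - U.b.im)]
      · nlinarith [sq_nonneg (U.b.re * z.re + U.b.im * z.im - U.c),
          sq_nonneg (U.b.re * z.im - U.b.im * z.re)]
  rw [h] at key
  by_contra hneg
  push Not at hneg
  cases q with
  | infty =>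
    rw [null_infty] at key
    simp at key
    linarith
  | coe z =>
    rw [null_coe] at key
    simp at key
    linarith

/-! ### Disjoint and tangent disks -/

theorem GDisk.continuous_val (D : GDisk) : Continuous D.val := by
  unfold GDisk.val
  fun_prop

theorem GDisk.sval_coe (D : GDisk) (z : ℂ) : D.sval (z : OnePoint ℂ) = D.val z := rfl

theorem GDisk.sval_infty (D : GDisk) : D.sval OnePoint.infty = D.a := rfl

theorem GDisk.sval_compl (D : GDisk) (p : OnePoint ℂ) : D.compl.sval p = -D.sval p := by
  rw [sval_eq, sval_eq, vec_compl, lor_neg_left]; ring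

/-- Every point of the boundary of a disk is a limit of finite points of the complement. -/
theorem GDisk.exists_approach (D : GDisk) {p : OnePoint ℂ} (hp : p ∈ D.circle) :
    ∃ γ : ℕ → ℂ, (∀ᶠ n in atTop, 0 < D.val (γ n)) ∧
      ∀ E : GDisk, 0 < E.sval p → ∀ᶠ n in atTop, 0 < E.val (γ n) := by
  have hD := D.norm_eq
  rw [Complex.normSq_apply] at hD
  cases p with
  | infty =>
    have ha : D.a = 0 := hp
    rw [ha] at hD
    refine ⟨fun n => -((n : ℝ) : ℂ) * D.b, ?_, fun E hE => ?_⟩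
    · have h1 : Tendsto (fun n : ℕ => (n : ℝ)) atTop atTop := tendsto_natCast_atTop_atTop
      filter_upwards [h1.eventually_gt_atTop (-D.c / 2)] with n hn
      simp only [val, ha, Complex.mul_re, Complex.mul_im, Complex.neg_re, Complex.neg_im,
        Complex.ofReal_re, Complex.ofReal_im, Complex.conj_re, Complex.conj_im]
      nlinarith
    · rw [sval_infty] at hE
      set k := E.b.re * D.b.re + E.b.im * D.b.im with hk
      have h1 : Tendsto (fun n : ℕ => (n : ℝ)) atTop atTop := tendsto_natCast_atTop_atTop
      have h2 : Tendsto (fun n : ℕ => (n : ℝ) * (E.a * n + 2 * k) + E.c) atTop atTop := by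
        refine tendsto_atTop_add_const_right _ _ (h1.atTop_mul_atTop₀ ?_)
        exact tendsto_atTop_add_const_right _ _ (h1.const_mul_atTop hE)
      filter_upwards [h2.eventually_gt_atTop 0] with n hn
      simp only [val, Complex.normSq_apply, Complex.mul_re, Complex.mul_im, Complex.neg_re,
        Complex.neg_im, Complex.ofReal_re, Complex.ofReal_im, Complex.conj_re, Complex.conj_im]
      rw [hk] at hn
      have : E.a * (n : ℝ) ^ 2 * (D.b.re * D.b.re + D.b.im * D.b.im) = E.a * (n : ℝ) ^ 2 := by
        rw [show D.b.re * D.b.re + D.b.im * D.b.im = 1 by linarith, mul_one]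
      nlinarith
  | coe z =>
    have hz : D.val z = 0 := hp
    have h0 : Tendsto (fun n : ℕ => 1 / ((n : ℝ) + 1)) atTop (𝓝 0) :=
      tendsto_one_div_add_atTop_nhds_zero_nat
    refine ⟨fun n => z - ((1 / ((n : ℝ) + 1) : ℝ) : ℂ) * (D.b - D.a * z), ?_, fun E hE => ?_⟩
    · have h1 : Tendsto (fun n : ℕ => 2 + D.a * (1 / ((n : ℝ) + 1))) atTop (𝓝 (2 + D.a * 0)) :=
        (h0.const_mul _).const_add _
      rw [mul_zero, add_zero] at h1
      filter_upwards [h1.eventually (lt_mem_nhds (show (0 : ℝ) < 2 by norm_num))] with n hn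
      have he : 0 < 1 / ((n : ℝ) + 1) := by positivity
      set e := 1 / ((n : ℝ) + 1)
      have hpos := mul_pos he hn
      simp only [val, Complex.normSq_apply, Complex.mul_re, Complex.mul_im, Complex.sub_re,
        Complex.sub_im, Complex.ofReal_re, Complex.ofReal_im, Complex.conj_re,
        Complex.conj_im] at hz ⊢
      have : D.val z = 0 := hz
      linear_combination hpos - (2 * e + D.a * e ^ 2) * hD - (1 + 2 * e * D.a + D.a ^ 2 * e ^ 2) * hz
    · have h1 : Tendsto (fun n : ℕ => z - ((1 / ((n : ℝ) + 1) : ℝ) : ℂ) * (D.b - D.a * z)) atTop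
          (𝓝 (z - ((0 : ℝ) : ℂ) * (D.b - D.a * z))) :=
        (((Complex.continuous_ofReal.tendsto 0).comp h0).mul_const _).const_sub _
      rw [Complex.ofReal_zero, zero_mul, sub_zero] at h1
      exact ((E.continuous_val.tendsto z).comp h1).eventually (lt_mem_nhds hE)

/-- An open disk which meets the closure of another one meets the open disk. -/
theorem GDisk.lor_neg_of_disjoint {C D : GDisk} (h : Disjoint C.openDisk D.openDisk)
    {p : OnePoint ℂ} (hp : p ∈ C.openDisk) : lor D.vec (null p) < 0 := by
  by_contra hneg
  push Not at hneg
  rcases hneg.eq_or_lt with h0 | h0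
  · obtain ⟨γ, h1, h2⟩ := D.compl.exists_approach (p := p)
      (by rw [mem_circle_iff_lor, vec_compl, lor_neg_left, ← h0, neg_zero])
    obtain ⟨n, h3, h4⟩ := (h1.and (h2 C.compl (by
      rw [sval_compl]; exact neg_pos.mpr hp))).exists
    rw [← sval_coe, sval_compl] at h3 h4
    have h5 : (γ n : OnePoint ℂ) ∈ C.openDisk := neg_pos.mp h4
    exact Set.disjoint_left.mp h h5 (neg_pos.mp h3)
  · exact Set.disjoint_left.mp h hp ((D.mem_openDisk_iff p).mpr h0)

theorem GDisk.exists_lor_ne_zero (D : GDisk) : ∃ p, lor D.vec (null p) ≠ 0 := by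
  by_contra h
  push Not at h
  have h1 := h OnePoint.infty
  have h2 := h ((0 : ℂ) : OnePoint ℂ)
  have h3 := h ((1 : ℂ) : OnePoint ℂ)
  have h4 := h (Complex.I : OnePoint ℂ)
  have hD := D.norm_eq
  rw [null_infty] at h1
  rw [null_coe] at h2 h3 h4
  simp [lor, vec] at h1 h2 h3 h4
  rw [h1, h2] at h3 h4
  rw [Complex.normSq_apply, h1, h2] at hD
  nlinarith

theorem GDisk.openDisk_nonempty (D : GDisk) : D.openDisk.Nonempty := by
  obtain ⟨p, hp⟩ := D.exists_lor_ne_zero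
  rcases hp.lt_or_gt with h | h
  · obtain ⟨q, r, hr, hq⟩ := (isMoebius_lrefl D).map_null p
    refine ⟨q, (D.mem_openDisk_iff q).mpr ?_⟩
    have h1 : lor D.vec (lrefl D (null p)) = - lor D.vec (null p) := by
      rw [lrefl_apply, lor_sub_right, lor_smul_right, lor_vec_self]; ring
    rw [hq, lor_smul_right] at h1
    by_contra hneg
    nlinarith
  · exact ⟨p, (D.mem_openDisk_iff p).mpr h⟩

/-- Disjoint open disks have inversive product at most `-1`, and in the case of equality the sum
of their vectors lies on the future light cone.

The point `p` of `C` is reflected in `D`, then the result in `C`, and so on; the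
ratios `r = - lor D p / lor C p` are positive and change according to `r ↦ 2 s - 1 / r`, where `s` is
the negative of the inversive product, so that their infimum `m` satisfies `m² - 2 s m + 1 ≤ 0`. -/
theorem GDisk.inv_le_of_disjoint {C D : GDisk} (h : Disjoint C.openDisk D.openDisk) :
    C.inv D ≤ -1 ∧ (C.inv D = -1 → ∀ p ∈ C.openDisk, lor (C.vec + D.vec) (null p) ≤ 0) := by
  set s := - C.inv D with hs
  let R : Set ℝ := {r | ∃ (C' D' : GDisk) (p : OnePoint ℂ), Disjoint C'.openDisk D'.openDisk ∧
    C'.inv D' = -s ∧ 0 < lor C'.vec (null p) ∧ -lor D'.vec (null p) = r * lor C'.vec (null p)}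
  have hmem : ∀ p ∈ C.openDisk, -lor D.vec (null p) / lor C.vec (null p) ∈ R := by
    intro p hp
    have hp' := (C.mem_openDisk_iff p).mp hp
    exact ⟨C, D, p, h, by rw [hs, neg_neg], hp', by field_simp⟩
  have hpos : ∀ r ∈ R, 0 < r := by
    rintro r ⟨C', D', p, h1, -, h3, h4⟩
    have := lor_neg_of_disjoint h1 ((C'.mem_openDisk_iff p).mpr h3)
    by_contra hneg
    nlinarith
  have hstep : ∀ r ∈ R, 2 * s - 1 / r ∈ R := by
    intro r hr
    have hr0 := hpos r hr
    obtain ⟨C', D', p, h1, h2, h3, h4⟩ := hr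
    obtain ⟨q, l, hl, hq⟩ := (isMoebius_lrefl D').map_null p
    have e1 : l * lor D'.vec (null q) = - lor D'.vec (null p) := by
      rw [← lor_smul_right, ← hq, lrefl_apply, lor_sub_right, lor_smul_right, lor_vec_self]; ring
    have e2 : l * lor C'.vec (null q) =
        lor C'.vec (null p) + 2 * s * lor D'.vec (null p) := by
      rw [← lor_smul_right, ← hq, lrefl_apply, lor_sub_right, lor_smul_right, lor_vec, h2]; ring
    refine ⟨D', C', q, h1.symm, ?_, ?_, ?_⟩
    · rw [← lor_vec, lor_comm, lor_vec, h2]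
    · have : 0 < l * lor D'.vec (null q) := by rw [e1, h4]; positivity
      exact pos_of_mul_pos_right this hl.le
    · apply mul_left_cancel₀ hl.ne'
      rw [mul_neg, e2, mul_left_comm, e1, h4]
      have : lor D'.vec (null p) = - (r * lor C'.vec (null p)) := by linarith
      rw [this]
      field_simp
      ring
  obtain ⟨p₀, hp₀⟩ := C.openDisk_nonempty
  have hne : R.Nonempty := ⟨_, hmem p₀ hp₀⟩
  have hbdd : BddBelow R := ⟨0, fun r hr => (hpos r hr).le⟩
  set m := sInf R with hm
  have hle : ∀ r ∈ R, m ≤ r := fun r hr => csInf_le hbdd hr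
  have h1 : ∀ r ∈ R, 1 ≤ (2 * s - m) * r := by
    intro r hr
    have h2 := hle _ (hstep r hr)
    have hr0 := hpos r hr
    have h3 : 1 / r ≤ 2 * s - m := by linarith
    rwa [div_le_iff₀ hr0] at h3
  have hpos' : 0 < 2 * s - m := by
    obtain ⟨r, hr⟩ := hne
    have := h1 r hr
    have := hpos r hr
    by_contra hneg
    nlinarith
  have h2 : 1 / (2 * s - m) ≤ m := by
    refine le_csInf hne fun r hr => ?_
    rw [div_le_iff₀ hpos']
    linarith [h1 r hr]
  rw [div_le_iff₀ hpos'] at h2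
  have hm0 : 0 < m := by
    by_contra hneg
    nlinarith
  have hs1 : 1 ≤ s := by nlinarith [sq_nonneg (m - 1)]
  refine ⟨by linarith, fun heq p hp => ?_⟩
  have hs' : s = 1 := by rw [hs, heq]; norm_num
  rw [hs'] at h2
  have hm1 : m = 1 := by nlinarith [sq_nonneg (m - 1)]
  have h3 := hle _ (hmem p hp)
  rw [hm1, le_div_iff₀ ((C.mem_openDisk_iff p).mp hp)] at h3
  rw [lor_add_left]
  linarith

/-- Two disks whose inversive product is at most `-1` and whose boundaries have a common
point have inversive product `-1`, and their sum represents this point. -/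
theorem GDisk.add_eq_of_mem_circle {C D : GDisk} (h : C.inv D ≤ -1) {p : OnePoint ℂ}
    (hC : p ∈ C.circle) (hD : p ∈ D.circle) :
    C.inv D = -1 ∧ ∃ r : ℝ, C.vec + D.vec = r • null p := by
  rw [mem_circle_iff_lor] at hC hD
  have h0 : lor (C.vec + D.vec) (C.vec + D.vec) = 2 + 2 * C.inv D := by
    rw [lor_add_left, lor_add_right, lor_add_right, lor_vec_self, lor_vec_self,
      lor_comm D.vec C.vec, lor_vec]
    ring
  obtain ⟨r, hr⟩ := eq_smul_null_of_lor_eq_zero (v := C.vec + D.vec) (p := p)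
    (by rw [lor_add_left, hC, hD, add_zero]) (by linarith)
  refine ⟨?_, r, hr⟩
  rw [hr, lor_smul_left, lor_smul_right, lor_null_null] at h0
  linarith

theorem GDisk.tangent_comm {C D : GDisk} : Tangent C D ↔ Tangent D C := by
  unfold Tangent
  simp only [and_comm]

/-- Disks with isotropic nonzero sum are tangent. -/
theorem GDisk.tangent_of_add_eq {C D : GDisk} (h : C.inv D = -1) {p : OnePoint ℂ} {r : ℝ}
    (hr : r ≠ 0) (hp : C.vec + D.vec = r • null p) : Tangent C D ∧ p ∈ C.circle ∧ p ∈ D.circle := by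
  have hC : p ∈ C.circle := by
    rw [mem_circle_iff_lor]
    have : lor C.vec (C.vec + D.vec) = 0 := by
      rw [lor_add_right, lor_vec_self, lor_vec, h]; norm_num
    rw [hp, lor_smul_right] at this
    exact (mul_eq_zero.mp this).resolve_left hr
  have hD : p ∈ D.circle := by
    rw [mem_circle_iff_lor]
    have : lor D.vec (C.vec + D.vec) = 0 := by
      rw [lor_add_right, lor_vec_self, lor_comm, lor_vec, h]; norm_num
    rw [hp, lor_smul_right] at this
    exact (mul_eq_zero.mp this).resolve_left hr
  refine ⟨⟨p, ⟨hC, hD⟩, ?_⟩, hC, hD⟩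
  rintro q ⟨h1, h2⟩
  rw [mem_circle_iff_lor] at h1 h2
  apply Eq.symm
  apply eq_of_lor_null_eq_zero
  have : lor (C.vec + D.vec) (null q) = 0 := by rw [lor_add_left, h1, h2, add_zero]
  rw [hp, lor_smul_left] at this
  exact (mul_eq_zero.mp this).resolve_left hr

/-- The boundary of a disk has more than one point. -/
theorem GDisk.not_existsUnique_mem_circle (D : GDisk) : ¬ ∃! p, p ∈ D.circle := by
  rintro ⟨p, hp, hu⟩
  have hinf : ∀ t, (D.param t : OnePoint ℂ) = p := fun t => hu _ (D.param_mem_circle t)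
  have h01 : D.param 0 = D.param (if D.a = 0 then 1 else Real.pi / |D.a|) :=
    OnePoint.coe_injective ((hinf _).trans (hinf _).symm)
  have hD := D.norm_eq
  unfold param at h01
  split_ifs at h01 with ha
  · have hb : D.b = 0 := by simpa using h01
    rw [hb, ha] at hD
    simp at hD
  · have ha' : |D.a| ≠ 0 := abs_ne_zero.mpr ha
    rw [mul_div_cancel₀ _ ha', Complex.exp_pi_mul_I] at h01
    have h2 : ((1 / |D.a| : ℝ) : ℂ) * 2 = 0 := by
      simp only [mul_zero, Complex.ofReal_zero, zero_mul, Complex.exp_zero] at h01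
      linear_combination h01
    have h3 : (1 / |D.a| : ℝ) = 0 := by
      have := (mul_eq_zero.mp h2).resolve_right two_ne_zero
      exact_mod_cast this
    exact ha' (by simpa using h3)

theorem GDisk.Tangent.ne {C D : GDisk} (h : Tangent C D) : C ≠ D := by
  rintro rfl
  apply C.not_existsUnique_mem_circle
  simpa [Tangent] using h

/-- Tangent disks whose inversive product is at most `-1` touch from outside. -/
theorem GDisk.Tangent.add_eq {C D : GDisk} (ht : Tangent C D) (h : C.inv D ≤ -1) :
    C.inv D = -1 ∧ ∃ p, p ∈ C.circle ∧ p ∈ D.circle ∧ ∃ r : ℝ, r ≠ 0 ∧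
      C.vec + D.vec = r • null p := by
  have ht' := ht
  obtain ⟨p, ⟨hC, hD⟩, hu⟩ := ht
  obtain ⟨h1, r, hr⟩ := add_eq_of_mem_circle h hC hD
  refine ⟨h1, p, hC, hD, r, ?_, hr⟩
  rintro rfl
  rw [zero_smul] at hr
  apply C.not_existsUnique_mem_circle
  refine ⟨p, hC, fun q hq => hu q ⟨hq, ?_⟩⟩
  have hq' := (C.mem_circle_iff_lor q).mp hq
  rw [mem_circle_iff_lor]
  have h2 : D.vec = -C.vec := by rw [eq_neg_iff_add_eq_zero, add_comm, hr]
  rw [h2, lor_neg_left, hq', neg_zero]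

/-- For tangent disks with disjoint interiors, the sum lies on the future light cone. -/
theorem GDisk.Tangent.add_eq_of_disjoint {C D : GDisk} (ht : Tangent C D)
    (h : Disjoint C.openDisk D.openDisk) :
    C.inv D = -1 ∧ ∃ p, p ∈ C.circle ∧ p ∈ D.circle ∧ ∃ r : ℝ, 0 < r ∧
      C.vec + D.vec = r • null p := by
  obtain ⟨h1, p, hC, hD, r, hr, hp⟩ := ht.add_eq (inv_le_of_disjoint h).1
  refine ⟨h1, p, hC, hD, r, lt_of_le_of_ne ?_ hr.symm, hp⟩
  obtain ⟨q, hq⟩ := C.openDisk_nonempty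
  have h2 := (inv_le_of_disjoint h).2 h1 q hq
  rw [hp, lor_smul_left] at h2
  have hpq : p ≠ q := by
    rintro rfl
    rw [mem_circle_iff_lor] at hC
    exact ((C.mem_openDisk_iff p).mp hq).ne' hC
  nlinarith [lor_null_neg hpq]

/-! ### Dual disks -/

theorem IsInitialConfiguration.inv_le [Fintype ι] {K : ι → GDisk} (hK : IsInitialConfiguration K)
    {i j : ι} (h : i ≠ j) : (K i).inv (K j) ≤ -1 :=
  (inv_le_of_disjoint (hK.disjoint i j h)).1

theorem IsInitialConfiguration.exists_ne [Fintype ι] {K : ι → GDisk}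
    (hK : IsInitialConfiguration K) (i j k : ι) : ∃ l, l ≠ i ∧ l ≠ j ∧ l ≠ k := by
  classical
  by_contra h
  push Not at h
  have h1 : (Finset.univ : Finset ι) ⊆ {i, j, k} := by
    intro l _
    by_cases h1 : l = i
    · simp [h1]
    · by_cases h2 : l = j
      · simp [h2]
      · simp [h l h1 h2]
  have h2 := Finset.card_le_card h1
  have h3 := Finset.card_le_three (a := i) (b := j) (c := k)
  have h4 := hK.four_le_card
  rw [Finset.card_univ] at h2
  omega

theorem IsInitialConfiguration.vec_add_ne_zero [Fintype ι] {K : ι → GDisk}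
    (hK : IsInitialConfiguration K) {i j : ι} : (K i).vec + (K j).vec ≠ 0 := by
  intro h
  obtain ⟨l, h1, h2, -⟩ := hK.exists_ne i j j
  have h3 : lor ((K i).vec + (K j).vec) (K l).vec = 0 := by rw [h, lor_zero_left]
  rw [lor_add_left, lor_vec, lor_vec] at h3
  linarith [hK.inv_le h1.symm, hK.inv_le h2.symm]

namespace IsDualDisk

variable {K : ι → GDisk} {i j k : ι} {U : GDisk}

theorem rotate (d : IsDualDisk K i j k U) : IsDualDisk K j k i U :=
  ⟨d.tangent_jk, d.tangent_ki, d.tangent_ij, d.vertex_jk, d.vertex_ki, d.vertex_ij,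
    fun l h1 h2 h3 => d.disjoint l h3 h1 h2⟩

theorem swap (d : IsDualDisk K i j k U) : IsDualDisk K i k j U :=
  ⟨tangent_comm.mp d.tangent_ki, tangent_comm.mp d.tangent_jk, tangent_comm.mp d.tangent_ij,
    inter_comm _ _ ▸ d.vertex_ki, inter_comm _ _ ▸ d.vertex_jk, inter_comm _ _ ▸ d.vertex_ij,
    fun l h1 h2 h3 => d.disjoint l h1 h3 h2⟩

theorem ne (d : IsDualDisk K i j k U) : i ≠ j := fun h => d.tangent_ij.ne (by rw [h])

theorem lor_le (d : IsDualDisk K i j k U) {l : ι} (h1 : l ≠ i) (h2 : l ≠ j) (h3 : l ≠ k) :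
    lor U.vec (K l).vec ≤ -1 := by
  rw [lor_vec]
  exact (inv_le_of_disjoint (d.disjoint l h1 h2 h3)).1

theorem eq_or_of_lor (d : IsDualDisk K i j k U) {l : ι} (h : -1 < lor U.vec (K l).vec) :
    l = i ∨ l = j ∨ l = k := by
  by_contra hne
  push Not at hne
  linarith [d.lor_le hne.1 hne.2.1 hne.2.2]

variable [Fintype ι]

theorem exists_vertex (d : IsDualDisk K i j k U) (hK : IsInitialConfiguration K) :
    ∃ p, ∃ r : ℝ, 0 < r ∧ (K i).vec + (K j).vec = r • null p ∧ lor U.vec (null p) = 0 := by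
  obtain ⟨-, p, h1, h2, r, hr, hp⟩ := d.tangent_ij.add_eq_of_disjoint (hK.disjoint i j d.ne)
  exact ⟨p, r, hr, hp, (U.mem_circle_iff_lor p).mp (d.vertex_ij ⟨h1, h2⟩)⟩

theorem inv_eq (d : IsDualDisk K i j k U) (hK : IsInitialConfiguration K) :
    (K i).inv (K j) = -1 :=
  (d.tangent_ij.add_eq (hK.inv_le d.ne)).1

theorem lor_add_eq (d : IsDualDisk K i j k U) (hK : IsInitialConfiguration K) :
    lor U.vec (K i).vec + lor U.vec (K j).vec = 0 := by
  obtain ⟨p, r, -, hp, h⟩ := d.exists_vertex hK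
  rw [← lor_add_right, hp, lor_smul_right, h, mul_zero]

theorem lor_eq_zero (d : IsDualDisk K i j k U) (hK : IsInitialConfiguration K) :
    lor U.vec (K i).vec = 0 := by
  linarith [d.lor_add_eq hK, d.rotate.lor_add_eq hK, d.rotate.rotate.lor_add_eq hK]

theorem lor_eq_zero_or_le (d : IsDualDisk K i j k U) (hK : IsInitialConfiguration K) (l : ι) :
    lor U.vec (K l).vec = 0 ∨ lor U.vec (K l).vec ≤ -1 := by
  by_cases h : -1 < lor U.vec (K l).vec
  · left
    rcases d.eq_or_of_lor h with rfl | rfl | rfl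
    exacts [d.lor_eq_zero hK, d.rotate.lor_eq_zero hK, d.rotate.rotate.lor_eq_zero hK]
  · exact Or.inr (not_lt.mp h)

theorem lor_nonpos (d : IsDualDisk K i j k U) (hK : IsInitialConfiguration K) (l : ι) :
    lor U.vec (K l).vec ≤ 0 := by
  rcases d.lor_eq_zero_or_le hK l with h | h <;> linarith

end IsDualDisk

/-- The Lorentz form in the coordinates given by a unit vector `u` and three
mutually tangent disks orthogonal to it. -/
theorem lor_self_eq {u a b c : LSpace} (huu : lor u u = 1) (hua : lor u a = 0) (hub : lor u b = 0)
    (huc : lor u c = 0) (haa : lor a a = 1) (hbb : lor b b = 1) (hcc : lor c c = 1)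
    (hab : lor a b = -1) (hbc : lor b c = -1) (hca : lor c a = -1) (v : LSpace) :
    lor v v = lor v u ^ 2 - (lor v a * lor v b + lor v b * lor v c + lor v c * lor v a) := by
  have hau := lor_comm u a ▸ hua
  have hbu := lor_comm u b ▸ hub
  have hcu := lor_comm u c ▸ huc
  have hba := lor_comm a b ▸ hab
  have hcb := lor_comm b c ▸ hbc
  have hac := lor_comm c a ▸ hca
  have hli : LinearIndependent ℝ ![u, a, b, c] := by
    rw [Fintype.linearIndependent_iff]
    intro g hg
    simp only [Fin.sum_univ_four, Matrix.cons_val_zero, Matrix.cons_val_one, Matrix.cons_val] at hg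
    have e : ∀ w, lor (g 0 • u + g 1 • a + g 2 • b + g 3 • c) w = 0 := by
      intro w; rw [hg, lor_zero_left]
    have e0 := e u
    have e1 := e a
    have e2 := e b
    have e3 := e c
    simp only [lor_add_left, lor_smul_left, huu, hua, hub, huc, haa, hbb, hcc, hab, hbc, hca, hau,
      hbu, hcu, hba, hcb, hac] at e0 e1 e2 e3
    intro n
    fin_cases n <;> simp <;> linarith
  have hspan := hli.span_eq_top_of_card_eq_finrank' (by simp [Module.finrank_prod])
  have hv : v ∈ Submodule.span ℝ (Set.range ![u, a, b, c]) := by rw [hspan]; trivial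
  rw [Submodule.mem_span_range_iff_exists_fun] at hv
  obtain ⟨g, rfl⟩ := hv
  simp only [Fin.sum_univ_four, Matrix.cons_val_zero, Matrix.cons_val_one, Matrix.cons_val]
  simp only [lor_add_left, lor_add_right, lor_smul_left, lor_smul_right, huu, hua, hub, huc, haa,
    hbb, hcc, hab, hbc, hca, hau, hbu, hcu, hba, hcb, hac]
  ring

theorem IsDualDisk.lor_self_eq [Fintype ι] {K : ι → GDisk} {i j k : ι} {U : GDisk}
    (d : IsDualDisk K i j k U) (hK : IsInitialConfiguration K) (v : LSpace) :
    lor v v = lor v U.vec ^ 2 - (lor v (K i).vec * lor v (K j).vec +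
      lor v (K j).vec * lor v (K k).vec + lor v (K k).vec * lor v (K i).vec) :=
  _root_.lor_self_eq (lor_vec_self U) (d.lor_eq_zero hK) (d.rotate.lor_eq_zero hK)
    (d.rotate.rotate.lor_eq_zero hK) (lor_vec_self _) (lor_vec_self _) (lor_vec_self _)
    (by rw [lor_vec, d.inv_eq hK]) (by rw [lor_vec, d.rotate.inv_eq hK])
    (by rw [lor_vec, d.rotate.rotate.inv_eq hK]) v

/-- A causal vector orthogonal to two points of the light cone vanishes. -/
theorem eq_zero_of_lor_null_eq_zero {v : LSpace} {p q : OnePoint ℂ} (hpq : p ≠ q)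
    (hv : lor v v ≤ 0) (hp : lor v (null p) = 0) (hq : lor v (null q) = 0) : v = 0 := by
  obtain ⟨r, rfl⟩ := eq_smul_null_of_lor_eq_zero hp hv
  rw [lor_smul_left] at hq
  rcases mul_eq_zero.mp hq with h | h
  · rw [h, zero_smul]
  · exact absurd (eq_of_lor_null_eq_zero h) hpq

/-- The set of the dual disks of all gaps. -/
def dualDisks (K : ι → GDisk) : Set GDisk := {U | ∃ i j k, IsDualDisk K i j k U}

section

variable [Fintype ι] {K : ι → GDisk}

theorem IsDualDisk.vertex_ne {i j k : ι} {U : GDisk} (d : IsDualDisk K i j k U)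
    (hK : IsInitialConfiguration K) {p q : OnePoint ℂ} {r s : ℝ}
    (hp : (K i).vec + (K j).vec = r • null p) (hq : (K j).vec + (K k).vec = s • null q) :
    p ≠ q := by
  rintro rfl
  have h1 : lor ((K i).vec + (K j).vec) ((K j).vec + (K k).vec) = 0 := by
    rw [hp, hq, lor_smul_left, lor_smul_right, lor_null_null, mul_zero, mul_zero]
  rw [lor_add_left, lor_add_right, lor_add_right, lor_vec_self, lor_vec, lor_vec, lor_vec,
    d.inv_eq hK, d.rotate.inv_eq hK, d.swap.inv_eq hK] at h1
  norm_num at h1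

/-- Two of the vertices of a gap. -/
theorem IsDualDisk.exists_vertices {i j k : ι} {U : GDisk} (d : IsDualDisk K i j k U)
    (hK : IsInitialConfiguration K) : ∃ p q, p ≠ q ∧ lor U.vec (null p) = 0 ∧
      lor U.vec (null q) = 0 ∧ ∀ V : LSpace, (∀ l, lor V (K l).vec ≤ 0) →
        lor V (null p) ≤ 0 ∧ lor V (null q) ≤ 0 := by
  obtain ⟨p, r, hr, hp, hp'⟩ := d.exists_vertex hK
  obtain ⟨q, s, hs, hq, hq'⟩ := d.rotate.exists_vertex hK
  refine ⟨p, q, d.vertex_ne hK hp hq, hp', hq', fun V hV => ⟨?_, ?_⟩⟩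
  · have h1 : lor V ((K i).vec + (K j).vec) ≤ 0 := by
      rw [lor_add_right]; linarith [hV i, hV j]
    rw [hp, lor_smul_right] at h1
    by_contra hneg
    nlinarith
  · have h1 : lor V ((K j).vec + (K k).vec) ≤ 0 := by
      rw [lor_add_right]; linarith [hV j, hV k]
    rw [hq, lor_smul_right] at h1
    by_contra hneg
    nlinarith

/-- Different dual disks have inversive product at most `-1`. -/
theorem lor_dualDisks (hK : IsInitialConfiguration K) {U V : GDisk} (hU : U ∈ dualDisks K)
    (hV : V ∈ dualDisks K) : U = V ∨ lor U.vec V.vec ≤ -1 := by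
  obtain ⟨i, j, k, d⟩ := hU
  obtain ⟨i', j', k', d'⟩ := hV
  by_contra hne
  push Not at hne
  obtain ⟨hne, hlt⟩ := hne
  have h1 := d.lor_self_eq hK V.vec
  rw [lor_vec_self, lor_comm V.vec U.vec] at h1
  have hi := d'.lor_nonpos hK i
  have hj := d'.lor_nonpos hK j
  have hk := d'.lor_nonpos hK k
  have hge : 1 ≤ lor U.vec V.vec := by
    nlinarith [mul_nonneg_of_nonpos_of_nonpos hi hj, mul_nonneg_of_nonpos_of_nonpos hj hk,
      mul_nonneg_of_nonpos_of_nonpos hk hi]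
  have hcausal : lor (V.vec - U.vec) (V.vec - U.vec) ≤ 0 := by
    rw [lor_sub_left, lor_sub_right, lor_sub_right, lor_vec_self, lor_vec_self,
      lor_comm V.vec U.vec]
    linarith
  obtain ⟨p, q, hpq, hp, hq, h2⟩ := d.exists_vertices hK
  obtain ⟨p', q', hpq', hp', hq', h2'⟩ := d'.exists_vertices hK
  have h3 := h2 V.vec (d'.lor_nonpos hK)
  have h3' := h2' U.vec (d.lor_nonpos hK)
  have hzero : V.vec - U.vec = 0 := by
    rcases lor_null_nonpos_or_nonneg hcausal with h | h
    · have e1 := h p'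
      have e2 := h q'
      rw [lor_sub_left] at e1 e2
      refine eq_zero_of_lor_null_eq_zero hpq' hcausal ?_ ?_ <;> rw [lor_sub_left] <;>
        linarith [h3'.1, h3'.2]
    · have e1 := h p
      have e2 := h q
      rw [lor_sub_left] at e1 e2
      refine eq_zero_of_lor_null_eq_zero hpq hcausal ?_ ?_ <;> rw [lor_sub_left] <;>
        linarith [h3.1, h3.2]
  exact hne (vec_injective (sub_eq_zero.mp hzero).symm)

/-- A triangular gap is determined by the three circles that bound it. -/
theorem IsDualDisk.unique (hK : IsInitialConfiguration K) {i j k : ι} {U V : GDisk}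
    (d : IsDualDisk K i j k U) (d' : IsDualDisk K i j k V) : U = V := by
  rcases lor_dualDisks hK ⟨i, j, k, d⟩ ⟨i, j, k, d'⟩ with h | h
  · exact h
  exfalso
  have h1 := d.lor_self_eq hK V.vec
  rw [d'.lor_eq_zero hK, d'.rotate.lor_eq_zero hK, d'.rotate.rotate.lor_eq_zero hK, lor_vec_self,
    lor_comm] at h1
  have h2 : lor U.vec V.vec = -1 := by nlinarith
  obtain ⟨l, hl1, hl2, hl3⟩ := hK.exists_ne i j k
  have hl := d.lor_le hl1 hl2 hl3
  have hl' := d'.lor_le hl1 hl2 hl3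
  obtain ⟨x, r, hr, hx, hxU⟩ := d.exists_vertex hK
  obtain ⟨y, s, hs, hy, hyU⟩ := d.rotate.exists_vertex hK
  have hxV : lor V.vec (null x) = 0 := by
    have := d'.lor_add_eq hK
    rw [← lor_add_right, hx, lor_smul_right] at this
    exact (mul_eq_zero.mp this).resolve_left hr.ne'
  have hyV : lor V.vec (null y) = 0 := by
    have := d'.rotate.lor_add_eq hK
    rw [← lor_add_right, hy, lor_smul_right] at this
    exact (mul_eq_zero.mp this).resolve_left hs.ne'
  have hxy := d.vertex_ne hK hx hy
  have hzero : U.vec + V.vec = 0 := by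
    refine eq_zero_of_lor_null_eq_zero hxy ?_ ?_ ?_
    · rw [lor_add_left, lor_add_right, lor_add_right, lor_vec_self, lor_vec_self,
        lor_comm V.vec U.vec, h2]
      norm_num
    · rw [lor_add_left, hxU, hxV, add_zero]
    · rw [lor_add_left, hyU, hyV, add_zero]
  have h3 : lor (U.vec + V.vec) (K l).vec = 0 := by rw [hzero, lor_zero_left]
  rw [lor_add_left] at h3
  linarith

theorem finite_dualDisks (hK : IsInitialConfiguration K) : (dualDisks K).Finite := by
  have : dualDisks K = ⋃ (i) (j) (k), {U | IsDualDisk K i j k U} := by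
    ext U; simp [dualDisks]
  rw [this]
  refine Set.finite_iUnion fun i => Set.finite_iUnion fun j => Set.finite_iUnion fun k => ?_
  exact Set.Subsingleton.finite fun U hU V hV => IsDualDisk.unique hK hU hV

/-! ### Disjointness of the packing -/

/-- `GapWord K i v U` says that `v` arises from `K i` by a nonempty reduced word in the reflections in the
dual disks whose last letter is `U` and whose first letter moves `K i`. -/
inductive GapWord (K : ι → GDisk) (i : ι) : GDisk → GDisk → Prop
  | base (U : GDisk) (hU : U ∈ dualDisks K) (h : lor U.vec (K i).vec ≤ -1) :
      GapWord K i (U.reflect (K i)) U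
  | step (v U V : GDisk) (h : GapWord K i v U) (hV : V ∈ dualDisks K) (hne : V ≠ U) :
      GapWord K i (V.reflect v) V

/-- The image of `K i` under a reduced word lies deep inside the dual disk of the last letter, compared with
all other dual disks. -/
theorem GapWord.lor_dual (hK : IsInitialConfiguration K) {i : ι} {v U : GDisk}
    (h : GapWord K i v U) : U ∈ dualDisks K ∧ 1 ≤ lor v.vec U.vec ∧
      ∀ V ∈ dualDisks K, V ≠ U → lor v.vec V.vec ≤ -lor v.vec U.vec := by
  induction h with
  | base U hU h =>
    have e : ∀ w, lor (U.reflect (K i)).vec w =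
        lor (K i).vec w - 2 * lor U.vec (K i).vec * lor U.vec w := by
      intro w; rw [vec_reflect, lrefl_apply, lor_sub_left, lor_smul_left]
    refine ⟨hU, ?_, fun V hV hne => ?_⟩
    · rw [e, lor_vec_self, lor_comm (K i).vec]; linarith
    · rw [e, e, lor_vec_self, lor_comm (K i).vec, lor_comm (K i).vec]
      have h1 := (lor_dualDisks hK hU hV).resolve_left hne.symm
      obtain ⟨a, b, c, d⟩ := hV
      have h2 := d.lor_nonpos hK i
      nlinarith
  | step v U V h hV hne ih =>
    obtain ⟨hU, h1, h2⟩ := ih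
    have e : ∀ w, lor (V.reflect v).vec w = lor v.vec w - 2 * lor V.vec v.vec * lor V.vec w := by
      intro w; rw [vec_reflect, lrefl_apply, lor_sub_left, lor_smul_left]
    have h3 := h2 V hV hne
    rw [lor_comm] at h3
    refine ⟨hV, ?_, fun W hW hWne => ?_⟩
    · rw [e, lor_vec_self, lor_comm v.vec]; linarith
    · rw [e, e, lor_vec_self, lor_comm v.vec V.vec]
      have h4 := (lor_dualDisks hK hV hW).resolve_left hWne.symm
      rcases eq_or_ne W U with rfl | hWU
      · nlinarith
      · have h5 := h2 W hW hWU
        nlinarith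

theorem GapWord.inv_le (hK : IsInitialConfiguration K) {i : ι} {v U : GDisk}
    (h : GapWord K i v U) (j : ι) : v.inv (K j) ≤ -1 := by
  rw [← lor_vec]
  induction h with
  | base U hU h =>
    obtain ⟨a, b, c, d⟩ := hU
    rw [vec_reflect, lrefl_apply, lor_sub_left, lor_smul_left]
    rcases eq_or_ne i j with rfl | hij
    · rw [lor_vec_self]; nlinarith
    · have h1 := hK.inv_le hij
      rw [← lor_vec] at h1
      have h2 := d.lor_nonpos hK j
      nlinarith
  | step v U V h hV hne ih =>
    obtain ⟨-, h1, h2⟩ := h.lor_dual hK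
    have h3 := h2 V hV hne
    rw [lor_comm] at h3
    obtain ⟨a, b, c, d⟩ := hV
    rw [vec_reflect, lrefl_apply, lor_sub_left, lor_smul_left]
    have h2 := d.lor_nonpos hK j
    nlinarith

/-- An image of `K i` under the reflection group is `K i` or arises by a reduced word. -/
theorem eq_or_gapWord (hK : IsInitialConfiguration K) {σ : Equiv.Perm GDisk}
    (hσ : σ ∈ reflectionGroup K) (i : ι) : σ (K i) = K i ∨ ∃ U, GapWord K i (σ (K i)) U := by
  have step : ∀ V ∈ dualDisks K, ∀ v, (v = K i ∨ ∃ U, GapWord K i v U) →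
      (V.reflect v = K i ∨ ∃ U, GapWord K i (V.reflect v) U) := by
    rintro V hV v (rfl | ⟨U, h⟩)
    · obtain ⟨a, b, c, d⟩ := id hV
      rcases d.lor_eq_zero_or_le hK i with h0 | h0
      · left
        apply vec_injective
        rw [vec_reflect, lrefl_apply, h0, mul_zero, zero_smul, sub_zero]
      · exact Or.inr ⟨V, .base V hV h0⟩
    · rcases eq_or_ne V U with rfl | hne
      · cases h with
        | base V hV h => rw [reflect_reflect]; exact Or.inl rfl
        | step v' U' V h hV hne => rw [reflect_reflect]; exact Or.inr ⟨U', h⟩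
      · exact Or.inr ⟨V, .step v U V h hV hne⟩
  induction hσ using Subgroup.closure_induction_left with
  | one => exact Or.inl rfl
  | mul_left x hx y hy ih =>
    obtain ⟨a, b, c, V, d, rfl⟩ := hx
    exact step V ⟨a, b, c, d⟩ _ ih
  | inv_mul_cancel x hx y hy ih =>
    obtain ⟨a, b, c, V, d, rfl⟩ := hx
    exact step V ⟨a, b, c, d⟩ _ ih

end

/-- Every element of the reflection group acts by a linear Lorentz transformation. -/
theorem exists_linear {K : ι → GDisk} {σ : Equiv.Perm GDisk} (hσ : σ ∈ reflectionGroup K) :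
    ∃ L : LSpace ≃ₗ[ℝ] LSpace, IsMoebius L ∧ ∀ D : GDisk, (σ D).vec = L D.vec := by
  induction hσ using Subgroup.closure_induction with
  | mem x hx =>
    obtain ⟨i, j, k, U, -, rfl⟩ := hx
    exact ⟨lrefl U, isMoebius_lrefl U, fun D => vec_reflect U D⟩
  | one => exact ⟨1, IsMoebius.one, fun D => rfl⟩
  | mul x y hx hy ihx ihy =>
    obtain ⟨L, hL, h⟩ := ihx
    obtain ⟨M, hM, h'⟩ := ihy
    exact ⟨L * M, hL.mul hM, fun D => by
      rw [Equiv.Perm.mul_apply, h, h', LinearEquiv.mul_apply]⟩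
  | inv x hx ih =>
    obtain ⟨L, hL, h⟩ := ih
    refine ⟨L⁻¹, hL.inv, fun D => ?_⟩
    have h1 := h (x⁻¹ D)
    rw [show x (x⁻¹ D) = D from x.apply_symm_apply D] at h1
    rw [h1]
    exact (LinearEquiv.symm_apply_apply L _).symm

theorem inv_map_map {K : ι → GDisk} {σ : Equiv.Perm GDisk} (hσ : σ ∈ reflectionGroup K)
    (C D : GDisk) : (σ C).inv (σ D) = C.inv D := by
  obtain ⟨L, hL, h⟩ := exists_linear hσ
  rw [← lor_vec, ← lor_vec, h, h, hL.lor_map]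

/-- Different disks of the packing have inversive product at most `-1`. -/
theorem packing_inv_le [Fintype ι] {K : ι → GDisk} (hK : IsInitialConfiguration K) {C D : GDisk}
    (hC : C ∈ packing K) (hD : D ∈ packing K) : C = D ∨ C.inv D ≤ -1 := by
  obtain ⟨σ, hσ, i, rfl⟩ := hC
  obtain ⟨τ, hτ, j, rfl⟩ := hD
  have hτσ := mul_mem (inv_mem hτ) hσ
  have e : (σ (K i)).inv (τ (K j)) = ((τ⁻¹ * σ) (K i)).inv (K j) := by
    rw [← inv_map_map hτ ((τ⁻¹ * σ) (K i)) (K j), Equiv.Perm.mul_apply,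
      show τ (τ⁻¹ (σ (K i))) = σ (K i) from τ.apply_symm_apply _]
  rw [e]
  rcases eq_or_gapWord hK hτσ i with h | ⟨U, h⟩
  · rw [h]
    rcases eq_or_ne i j with rfl | hij
    · left
      rw [Equiv.Perm.mul_apply, Equiv.Perm.inv_eq_iff_eq] at h
      exact h
    · exact Or.inr (hK.inv_le hij)
  · exact Or.inr (h.inv_le hK j)

/-- Reflections in dual disks preserve the packing. -/
theorem reflect_mem_packing {K : ι → GDisk} {U C : GDisk} (hU : U ∈ dualDisks K)
    (hC : C ∈ packing K) : U.reflect C ∈ packing K := by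
  obtain ⟨σ, hσ, i, rfl⟩ := hC
  obtain ⟨a, b, c, d⟩ := hU
  exact ⟨U.reflection * σ, mul_mem (Subgroup.subset_closure ⟨a, b, c, U, d, rfl⟩) hσ, i, rfl⟩

theorem mem_packing (K : ι → GDisk) (i : ι) : K i ∈ packing K := ⟨1, one_mem _, i, rfl⟩

/-! ### The parametrization by arc length -/

namespace GDisk

theorem param_of_eq {D : GDisk} (ha : D.a = 0) (t : ℝ) :
    D.param t = ((D.c / 2 : ℝ) : ℂ) * D.b + (t : ℂ) * (Complex.I * D.b) := if_pos ha

theorem param_of_ne {D : GDisk} (ha : D.a ≠ 0) (t : ℝ) :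
    D.param t = D.b / (D.a : ℂ) +
      ((1 / |D.a| : ℝ) : ℂ) * Complex.exp (((|D.a| * t : ℝ) : ℂ) * Complex.I) := if_neg ha

theorem norm_b_of_eq {D : GDisk} (ha : D.a = 0) : ‖D.b‖ = 1 := by
  have h := D.norm_eq
  rw [ha, zero_mul, sub_zero, Complex.normSq_eq_norm_sq] at h
  nlinarith [norm_nonneg D.b]

theorem norm_param_sub_of_eq {D : GDisk} (ha : D.a = 0) (t t' : ℝ) :
    ‖D.param t - D.param t'‖ = |t - t'| := by
  rw [param_of_eq ha, param_of_eq ha,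
    show ((D.c / 2 : ℝ) : ℂ) * D.b + (t : ℂ) * (Complex.I * D.b) -
      (((D.c / 2 : ℝ) : ℂ) * D.b + (t' : ℂ) * (Complex.I * D.b)) =
      ((t - t' : ℝ) : ℂ) * (Complex.I * D.b) by push_cast; ring]
  rw [norm_mul, norm_mul, norm_b_of_eq ha, Complex.norm_I, Complex.norm_real, Real.norm_eq_abs]
  ring

theorem norm_param_sub_of_ne {D : GDisk} (ha : D.a ≠ 0) (t t' : ℝ) :
    ‖D.param t - D.param t'‖ =
      1 / |D.a| * ‖Complex.exp (Complex.I * ((|D.a| * (t - t') : ℝ) : ℂ)) - 1‖ := by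
  have e : D.param t - D.param t' = ((1 / |D.a| : ℝ) : ℂ) *
      (Complex.exp (((|D.a| * t' : ℝ) : ℂ) * Complex.I) *
        (Complex.exp (Complex.I * ((|D.a| * (t - t') : ℝ) : ℂ)) - 1)) := by
    rw [param_of_ne ha, param_of_ne ha, mul_sub, ← Complex.exp_add, mul_one]
    have : ((|D.a| * t' : ℝ) : ℂ) * Complex.I + Complex.I * ((|D.a| * (t - t') : ℝ) : ℂ) =
        ((|D.a| * t : ℝ) : ℂ) * Complex.I := by push_cast; ring
    rw [this]
    ring
  rw [e, norm_mul, norm_mul, Complex.norm_exp_ofReal_mul_I, one_mul, Complex.norm_real,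
    Real.norm_eq_abs, abs_of_nonneg (by positivity)]

theorem norm_param_sub_le (D : GDisk) (t t' : ℝ) : ‖D.param t - D.param t'‖ ≤ |t - t'| := by
  by_cases ha : D.a = 0
  · exact (norm_param_sub_of_eq ha t t').le
  · rw [norm_param_sub_of_ne ha]
    have h1 := Real.norm_exp_I_mul_ofReal_sub_one_le (x := |D.a| * (t - t'))
    rw [Real.norm_eq_abs, abs_mul, abs_abs] at h1
    have ha' : 0 < |D.a| := abs_pos.mpr ha
    calc _ ≤ 1 / |D.a| * (|D.a| * |t - t'|) := by gcongr
      _ = |t - t'| := by field_simp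

/-- The period of the parametrization of a circle is its circumference. -/
theorem two_pi_le_of_param_eq {D : GDisk} {t t' : ℝ} (h : D.param t = D.param t') (hlt : t < t') :
    2 * Real.pi ≤ |D.a| * (t' - t) := by
  by_cases ha : D.a = 0
  · have h1 := norm_param_sub_of_eq ha t t'
    rw [h, sub_self, norm_zero] at h1
    have := abs_eq_zero.mp h1.symm
    linarith
  · have ha' : 0 < |D.a| := abs_pos.mpr ha
    have h1 := norm_param_sub_of_ne ha t' t
    rw [h, sub_self, norm_zero] at h1
    have h2 : Complex.exp (Complex.I * ((|D.a| * (t' - t) : ℝ) : ℂ)) = 1 := by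
      rw [← sub_eq_zero, ← norm_eq_zero]
      rcases mul_eq_zero.mp h1.symm with h3 | h3
      · exact absurd h3 (by positivity)
      · exact h3
    rw [Complex.exp_eq_one_iff] at h2
    obtain ⟨n, hn⟩ := h2
    have h3 : |D.a| * (t' - t) = n * (2 * Real.pi) := by
      have : ((|D.a| * (t' - t) : ℝ) : ℂ) = ((n * (2 * Real.pi) : ℝ) : ℂ) := by
        apply mul_left_cancel₀ Complex.I_ne_zero
        rw [hn]; push_cast; ring
      exact_mod_cast this
    have h4 : 0 < |D.a| * (t' - t) := mul_pos ha' (by linarith)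
    rw [h3] at h4 ⊢
    have h5 : 0 < n := by
      by_contra hneg
      push Not at hneg
      have : (n : ℝ) ≤ 0 := by exact_mod_cast hneg
      nlinarith [Real.pi_pos]
    have h6 : (1 : ℝ) ≤ n := by exact_mod_cast h5
    nlinarith [Real.pi_pos]

/-- A finite point of the curve has a parameter whose distance from a given one is comparable with the
chord. -/
theorem exists_param_eq (D : GDisk) {z : ℂ} (hz : (z : OnePoint ℂ) ∈ D.circle) (t : ℝ) :
    ∃ t', D.param t' = z ∧ |t' - t| ≤ 2 * ‖z - D.param t‖ := by
  by_cases ha : D.a = 0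
  · have hb := norm_b_of_eq ha
    have hb' : D.b * (starRingEnd ℂ) D.b = 1 := by
      rw [Complex.mul_conj, Complex.normSq_eq_norm_sq, hb]; norm_num
    have hv : D.val z = 0 := hz
    rw [val, ha, zero_mul, zero_sub] at hv
    set w := (starRingEnd ℂ) D.b * z with hw
    have hzw : z = w * D.b := by rw [hw]; linear_combination (-z) * hb'
    have hp : D.param w.im = z := by
      rw [param_of_eq ha, hzw]
      have : w = ((D.c / 2 : ℝ) : ℂ) + (w.im : ℂ) * Complex.I := by
        apply Complex.ext
        · simp; linarith
        · simp
      conv_rhs => rw [this]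
      ring
    refine ⟨w.im, hp, ?_⟩
    rw [← hp, norm_param_sub_of_eq ha]
    linarith [abs_nonneg (w.im - t)]
  · have ha' : 0 < |D.a| := abs_pos.mpr ha
    rw [mem_circle_iff D ha] at hz
    set e := Complex.exp (((|D.a| * t : ℝ) : ℂ) * Complex.I) with he
    have hne : ‖e‖ = 1 := Complex.norm_exp_ofReal_mul_I _
    have he0 : e ≠ 0 := Complex.exp_ne_zero _
    set u := ((|D.a| : ℝ) : ℂ) * (z - D.b / D.a) / e with hu
    have hu1 : ‖u‖ = 1 := by
      rw [hu, norm_div, norm_mul, hne, hz, Complex.norm_real, Real.norm_eq_abs, abs_abs]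
      field_simp
    have hexp : Complex.exp ((u.arg : ℂ) * Complex.I) = u := by
      have := Complex.norm_mul_exp_arg_mul_I u
      rwa [hu1, Complex.ofReal_one, one_mul] at this
    have hac : ((|D.a| : ℝ) : ℂ) ≠ 0 := by exact_mod_cast ha'.ne'
    have hp : D.param (t + u.arg / |D.a|) = z := by
      rw [param_of_ne ha]
      have : ((|D.a| * (t + u.arg / |D.a|) : ℝ) : ℂ) * Complex.I =
          ((|D.a| * t : ℝ) : ℂ) * Complex.I + (u.arg : ℂ) * Complex.I := by
        push_cast; field_simp
      rw [this, Complex.exp_add, hexp, ← he, hu]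
      push_cast
      field_simp
      ring
    refine ⟨_, hp, ?_⟩
    rw [← hp, norm_param_sub_of_ne ha]
    have e1 : |D.a| * (t + u.arg / |D.a| - t) = u.arg := by field_simp; ring
    have e2 : t + u.arg / |D.a| - t = u.arg / |D.a| := by ring
    rw [e1, mul_comm Complex.I, hexp, e2, abs_div, abs_abs]
    have h1 := Complex.angle_le_mul_norm_sub hu1 (norm_one (α := ℂ))
    rw [InnerProductGeometry.angle_comm,
      Complex.angle_one_left (by rw [← norm_pos_iff, hu1]; exact one_pos)] at h1
    have h2 : |u.arg| ≤ 2 * ‖u - 1‖ :=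
      h1.trans (mul_le_mul_of_nonneg_right (by linarith [Real.pi_le_four]) (norm_nonneg _))
    rw [div_le_iff₀ ha']
    calc |u.arg| ≤ 2 * ‖u - 1‖ := h2
      _ = _ := by field_simp

end GDisk

/-! ### Separation of the points of tangency -/

/-- The disks `C` and `C₀` touch from outside at the finite point `x`. -/
structure TangentAt (C C₀ : GDisk) (x : ℂ) : Prop where
  inv_eq : C.inv C₀ = -1
  ne_zero : C.a + C₀.a ≠ 0
  add_eq : C.vec + C₀.vec = (C.a + C₀.a) • null x

theorem tangentAt_of_add_eq {C C₀ : GDisk} {x : ℂ} {r : ℝ} (h : C.inv C₀ = -1) (hr : r ≠ 0)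
    (hx : C.vec + C₀.vec = r • null x) : TangentAt C C₀ x := by
  have : C.a + C₀.a = r := by
    have := congrArg Prod.fst hx
    rw [null_coe] at this
    simpa [vec] using this
  exact ⟨h, this ▸ hr, by rw [this, hx]⟩

theorem TangentAt.tangent {C C₀ : GDisk} {x : ℂ} (h : TangentAt C C₀ x) :
    Tangent C C₀ ∧ (x : OnePoint ℂ) ∈ C.circle ∧ (x : OnePoint ℂ) ∈ C₀.circle :=
  tangent_of_add_eq h.inv_eq h.ne_zero h.add_eq

theorem TangentAt.eq {C C₀ : GDisk} {x y : ℂ} (h : TangentAt C C₀ x) (h' : TangentAt C C₀ y) :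
    x = y :=
  OnePoint.coe_injective (smul_null_inj h.ne_zero (h.add_eq.symm.trans h'.add_eq)).1

theorem tangentAt_of_tangent {C C₀ : GDisk} (h : C.inv C₀ ≤ -1) (ht : Tangent C C₀) {x : ℂ}
    (hx : (x : OnePoint ℂ) ∈ C.circle) (hx₀ : (x : OnePoint ℂ) ∈ C₀.circle) :
    TangentAt C C₀ x := by
  obtain ⟨h1, p, hp, hp₀, r, hr, e⟩ := ht.add_eq h
  obtain rfl := ht.unique ⟨hp, hp₀⟩ ⟨hx, hx₀⟩
  exact tangentAt_of_add_eq h1 hr e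

theorem mem_tangencies_iff [Fintype ι] {K : ι → GDisk} (hK : IsInitialConfiguration K)
    {C₀ : GDisk} (hC₀ : C₀ ∈ packing K) (T : ℝ) (x : ℂ) :
    x ∈ tangencies (packing K) C₀ T ↔ ∃ C ∈ packing K, |C.a| ≤ T ∧ TangentAt C C₀ x := by
  constructor
  · rintro ⟨C, hC, ht, hT, h1, h2⟩
    exact ⟨C, hC, hT, tangentAt_of_tangent ((packing_inv_le hK hC hC₀).resolve_left ht.ne) ht h1 h2⟩
  · rintro ⟨C, hC, hT, h⟩
    exact ⟨C, hC, h.tangent.1, hT, h.tangent.2.1, h.tangent.2.2⟩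

theorem TangentAt.norm_sub_sq {C₀ C D : GDisk} {x y : ℂ} (hC : TangentAt C C₀ x)
    (hD : TangentAt D C₀ y) :
    (C.a + C₀.a) * (D.a + C₀.a) * ‖x - y‖ ^ 2 = 2 * (1 - C.inv D) := by
  have h1 : lor (C.vec + C₀.vec) (D.vec + C₀.vec) = C.inv D - 1 := by
    rw [lor_add_left, lor_add_right, lor_add_right, lor_vec, lor_vec, lor_vec_self,
      lor_comm C₀.vec D.vec, lor_vec, hC.inv_eq, hD.inv_eq]
    ring
  rw [hC.add_eq, hD.add_eq, lor_smul_left, lor_smul_right, lor_null_coe_coe] at h1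
  linarith

theorem TangentAt.four_le {C₀ C D : GDisk} {x y : ℂ} (hC : TangentAt C C₀ x)
    (hD : TangentAt D C₀ y) (h : C.inv D ≤ -1) :
    0 < (C.a + C₀.a) * (D.a + C₀.a) ∧ 4 ≤ (C.a + C₀.a) * (D.a + C₀.a) * ‖x - y‖ ^ 2 := by
  have h1 := hC.norm_sub_sq hD
  have h2 : 4 ≤ (C.a + C₀.a) * (D.a + C₀.a) * ‖x - y‖ ^ 2 := by linarith
  refine ⟨?_, h2⟩
  by_contra hneg
  push Not at hneg
  nlinarith [sq_nonneg ‖x - y‖]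

theorem TangentAt.two_le {C₀ C D : GDisk} {x y : ℂ} (hC : TangentAt C C₀ x)
    (hD : TangentAt D C₀ y) (h : C.inv D ≤ -1) {T : ℝ} (hCT : |C.a| ≤ T) (hDT : |D.a| ≤ T) :
    2 ≤ ‖x - y‖ * (|C₀.a| + T) := by
  obtain ⟨h1, h2⟩ := hC.four_le hD h
  have h3 : |C.a + C₀.a| ≤ |C₀.a| + T := (abs_add_le _ _).trans (by linarith)
  have h4 : |D.a + C₀.a| ≤ |C₀.a| + T := (abs_add_le _ _).trans (by linarith)
  have h5 : (C.a + C₀.a) * (D.a + C₀.a) ≤ (|C₀.a| + T) ^ 2 := by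
    rw [← abs_of_pos h1, abs_mul, sq]
    exact mul_le_mul h3 h4 (abs_nonneg _) ((abs_nonneg _).trans h3)
  have h6 : (0 : ℝ) ≤ |C₀.a| + T := (abs_nonneg _).trans h3
  have h7 : 4 ≤ (‖x - y‖ * (|C₀.a| + T)) ^ 2 := by
    nlinarith [mul_le_mul_of_nonneg_right h5 (sq_nonneg ‖x - y‖)]
  nlinarith [mul_nonneg (norm_nonneg (x - y)) h6]

section

variable [Fintype ι] {K : ι → GDisk}

theorem IsGap.two_le (hK : IsInitialConfiguration K) {C₀ : GDisk} (hC₀ : C₀ ∈ packing K)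
    {T t t' : ℝ} (hT : 0 ≤ T) (h : IsGap (packing K) C₀ T t t') :
    2 ≤ (t' - t) * (|C₀.a| + T) := by
  obtain ⟨hlt, h1, h2, -⟩ := h
  rw [mem_tangencies_iff hK hC₀] at h1 h2
  obtain ⟨C, hC, hCT, hCx⟩ := h1
  obtain ⟨D, hD, hDT, hDx⟩ := h2
  rcases packing_inv_le hK hC hD with rfl | hinv
  · have h3 := two_pi_le_of_param_eq (hCx.eq hDx) hlt
    nlinarith [Real.pi_gt_three]
  · have h3 := hCx.two_le hDx hinv hCT hDT
    have h4 := C₀.norm_param_sub_le t t'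
    rw [abs_sub_comm, abs_of_pos (sub_pos.mpr hlt)] at h4
    exact h3.trans (mul_le_mul_of_nonneg_right h4 (by positivity))

/-- If no line of the packing touches the circle `C₀` then the
curvatures of the tangent circles are bounded from below: three points of a circle of radius `r` cannot
have distances much larger than `√3 r`, while the points of tangency with
circles of small curvature have distances close to `2 r`. -/
theorem exists_curvature_ge (hK : IsInitialConfiguration K) {C₀ : GDisk} (hC₀ : C₀ ∈ packing K)
    (ha : C₀.a ≠ 0) (h0 : tangencies (packing K) C₀ 0 = ∅) :
    ∃ m : ℝ, 0 < m ∧ ∀ C ∈ packing K, ∀ x, TangentAt C C₀ x → m ≤ |C.a| := by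
  by_contra hneg
  push Not at hneg
  have ha' : 0 < |C₀.a| := abs_pos.mpr ha
  have hpos : ∀ C ∈ packing K, ∀ x, TangentAt C C₀ x → 0 < |C.a| := by
    intro C hC x hx
    by_contra hle
    have : x ∈ tangencies (packing K) C₀ 0 :=
      (mem_tangencies_iff hK hC₀ 0 x).mpr ⟨C, hC, not_lt.mp hle, hx⟩
    rw [h0] at this
    exact this
  obtain ⟨C₁, hC₁, x₁, h₁, hlt₁⟩ := hneg (|C₀.a| / 10) (by positivity)
  obtain ⟨C₂, hC₂, x₂, h₂, hlt₂⟩ := hneg |C₁.a| (hpos C₁ hC₁ x₁ h₁)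
  obtain ⟨C₃, hC₃, x₃, h₃, hlt₃⟩ := hneg |C₂.a| (hpos C₂ hC₂ x₂ h₂)
  have far : ∀ C ∈ packing K, ∀ D ∈ packing K, ∀ x y, TangentAt C C₀ x → TangentAt D C₀ y →
      |D.a| < |C.a| → |C.a| ≤ |C₀.a| / 10 → 18 / 10 ≤ ‖x - y‖ * |C₀.a| := by
    intro C hC D hD x y hx hy hlt hle
    have hne : C ≠ D := by rintro rfl; exact lt_irrefl _ hlt
    have := hx.two_le hy ((packing_inv_le hK hC hD).resolve_left hne) hle (hlt.le.trans hle)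
    nlinarith
  have f₁₂ := far C₁ hC₁ C₂ hC₂ x₁ x₂ h₁ h₂ hlt₂ hlt₁.le
  have f₂₃ := far C₂ hC₂ C₃ hC₃ x₂ x₃ h₂ h₃ hlt₃ (hlt₂.le.trans hlt₁.le)
  have f₁₃ := far C₁ hC₁ C₃ hC₃ x₁ x₃ h₁ h₃ (hlt₃.trans hlt₂) hlt₁.le
  have on : ∀ C x, TangentAt C C₀ x → (‖x - C₀.b / C₀.a‖ * |C₀.a|) ^ 2 = 1 := by
    intro C x hx
    rw [(mem_circle_iff C₀ ha x).mp hx.tangent.2.2, one_div, inv_mul_cancel₀ ha'.ne', one_pow]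
  have g₁ := on C₁ x₁ h₁
  have g₂ := on C₂ x₂ h₂
  have g₃ := on C₃ x₃ h₃
  have k₁₂ : (18 / 10) ^ 2 ≤ (‖x₁ - x₂‖ * |C₀.a|) ^ 2 := by gcongr
  have k₂₃ : (18 / 10) ^ 2 ≤ (‖x₂ - x₃‖ * |C₀.a|) ^ 2 := by gcongr
  have k₁₃ : (18 / 10) ^ 2 ≤ (‖x₁ - x₃‖ * |C₀.a|) ^ 2 := by gcongr
  rw [mul_pow, sq_abs, ← Complex.normSq_eq_norm_sq, Complex.normSq_apply] at *
  simp only [Complex.sub_re, Complex.sub_im] at *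
  set m := C₀.b / (C₀.a : ℂ)
  nlinarith [mul_nonneg (sq_nonneg C₀.a) (add_nonneg
    (sq_nonneg (x₁.re + x₂.re + x₃.re - 3 * m.re)) (sq_nonneg (x₁.im + x₂.im + x₃.im - 3 * m.im)))]

/-- Consecutive points of tangency have distance at least `const / T`. -/
theorem exists_le_gap (hK : IsInitialConfiguration K) {C₀ : GDisk} (hC₀ : C₀ ∈ packing K) :
    ∃ m : ℝ, 0 < m ∧ ∀ T : ℝ, 0 < T → (tangencies (packing K) C₀ 0 = ∅ ∨ 1 ≤ T) →
      ∀ t t' : ℝ, IsGap (packing K) C₀ T t t' → m ≤ (t' - t) * T := by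
  -- a lower bound for the parameters `T` at which a gap exists gives a lower bound for the gaps
  have main : ∀ T₀ : ℝ, 0 < T₀ → ∀ T, T₀ ≤ T → ∀ t t', IsGap (packing K) C₀ T t t' →
      2 * T₀ / (|C₀.a| + T₀) ≤ (t' - t) * T := by
    intro T₀ hT₀ T hT t t' h
    have h1 := h.two_le hK hC₀ (hT₀.le.trans hT)
    have h2 : 0 < |C₀.a| + T₀ := by positivity
    have h3 : 0 < t' - t := sub_pos.mpr h.1
    rw [div_le_iff₀ h2]
    have h4 : |C₀.a| * T₀ ≤ |C₀.a| * T := mul_le_mul_of_nonneg_left hT (abs_nonneg _)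
    nlinarith
  by_cases ha : C₀.a = 0
  · refine ⟨2, two_pos, fun T hT _ t t' h => ?_⟩
    have := main T hT T le_rfl t t' h
    rwa [ha, abs_zero, zero_add, mul_div_cancel_right₀ _ hT.ne'] at this
  · by_cases h0 : tangencies (packing K) C₀ 0 = ∅
    · obtain ⟨m, hm, hle⟩ := exists_curvature_ge hK hC₀ ha h0
      refine ⟨2 * m / (|C₀.a| + m), by positivity, fun T hT _ t t' h => main m hm T ?_ t t' h⟩
      obtain ⟨C, hC, hCT, hx⟩ := (mem_tangencies_iff hK hC₀ T _).mp h.2.1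
      exact (hle C hC _ hx).trans hCT
    · refine ⟨2 * 1 / (|C₀.a| + 1), by positivity, fun T hT hT' t t' h =>
        main 1 one_pos T (hT'.resolve_left h0) t t' h⟩

end

/-! ### The gaps along the base circle -/

/-- The tessellation by hyperbolic polygons in the complement of `K i₀` is generated by the
reflections in these disks. -/
def baseDuals (K : ι → GDisk) (i₀ : ι) : Set GDisk := {U | ∃ i j, IsDualDisk K i₀ i j U}

theorem baseDuals_subset (K : ι → GDisk) (i₀ : ι) : baseDuals K i₀ ⊆ dualDisks K :=
  fun _ ⟨i, j, d⟩ => ⟨i₀, i, j, d⟩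

section

variable [Fintype ι] {K : ι → GDisk}

theorem exists_add_eq_of_mem_closedDisk (hK : IsInitialConfiguration K) {i₀ l : ι} (hl : l ≠ i₀)
    {p : OnePoint ℂ} (hp₀ : p ∈ (K i₀).circle) (hp : p ∈ (K l).closedDisk) :
    Tangent (K l) (K i₀) ∧ ∃ r : ℝ, 0 < r ∧ (K l).vec + (K i₀).vec = r • null p := by
  have hpl : p ∈ (K l).circle := by
    rw [mem_closedDisk_iff] at hp
    rw [mem_circle_iff_lor] at hp₀ ⊢
    rcases hp.eq_or_lt with h | h
    · exact h.symm
    · have := lor_neg_of_disjoint (hK.disjoint l i₀ hl) (((K l).mem_openDisk_iff p).mpr h)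
      linarith
  obtain ⟨h1, r, hr⟩ := add_eq_of_mem_circle (hK.inv_le hl) hpl hp₀
  have hr0 : r ≠ 0 := by
    rintro rfl
    rw [zero_smul] at hr
    exact hK.vec_add_ne_zero hr
  have ht := (tangent_of_add_eq h1 hr0 hr).1
  obtain ⟨-, q, -, -, s, hs, hq⟩ := ht.add_eq_of_disjoint (hK.disjoint l i₀ hl)
  have := (smul_null_inj hr0 (hr.symm.trans hq)).2
  exact ⟨ht, r, this ▸ hs, hr⟩

/-- Each boundary point of `K i₀` which is not a point of tangency lies in the closed dual disk
of a gap at `K i₀`. -/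
theorem exists_dual_of_mem_circle (hK : IsInitialConfiguration K) {i₀ : ι} {p : OnePoint ℂ}
    (hp₀ : p ∈ (K i₀).circle) (hp : ∀ l, l ≠ i₀ → p ∉ (K l).closedDisk) :
    ∃ U ∈ baseDuals K i₀, 0 ≤ lor U.vec (null p) := by
  obtain ⟨γ, h1, h2⟩ := (K i₀).exists_approach hp₀
  have hpos : ∀ l, l ≠ i₀ → 0 < (K l).sval p := fun l hl => not_le.mp (hp l hl)
  obtain ⟨U, ⟨i, j, k, d⟩, hU⟩ : ∃ U ∈ dualDisks K, p ∈ U.closedDisk := by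
    by_contra hneg
    push Not at hneg
    have e1 : ∀ᶠ n in atTop, ∀ U ∈ dualDisks K, 0 < U.val (γ n) :=
      (eventually_all_finite (finite_dualDisks hK)).mpr fun U hU => h2 U (not_le.mp (hneg U hU))
    have e2 : ∀ᶠ n in atTop, ∀ l, 0 < (K l).val (γ n) := by
      rw [eventually_all]
      intro l
      rcases eq_or_ne l i₀ with rfl | hl
      · exact h1
      · exact h2 _ (hpos l hl)
    obtain ⟨n, h3, h4⟩ := (e1.and e2).exists
    obtain ⟨i, j, k, U, d, hU⟩ := hK.triangular (γ n : OnePoint ℂ) fun l => not_le.mpr (h4 l)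
    exact lt_asymm hU (h3 U ⟨i, j, k, d⟩)
  rw [mem_closedDisk_iff] at hU
  by_cases hi : i = i₀
  · exact ⟨U, ⟨j, k, hi ▸ d⟩, hU⟩
  by_cases hj : j = i₀
  · exact ⟨U, ⟨k, i, hj ▸ d.rotate⟩, hU⟩
  by_cases hk : k = i₀
  · exact ⟨U, ⟨i, j, hk ▸ d.rotate.rotate⟩, hU⟩
  exfalso
  -- the boundary of `U` is covered by the three disks around the gap
  have h0 : lor U.vec (null p) = 0 := by
    rcases hU.eq_or_lt with h | h
    · exact h.symm
    · have h3 := lor_neg_of_disjoint (d.disjoint i₀ (Ne.symm hi) (Ne.symm hj) (Ne.symm hk))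
        ((U.mem_openDisk_iff p).mpr h)
      rw [mem_circle_iff_lor] at hp₀
      linarith
  have hneg : ∀ l, l ≠ i₀ → lor (null p) (K l).vec < 0 := by
    intro l hl
    have := hp l hl
    rw [mem_closedDisk_iff, not_le, lor_comm] at this
    exact this
  have h3 := d.lor_self_eq hK (null p)
  rw [lor_null_null, lor_comm _ U.vec, h0] at h3
  nlinarith [mul_pos_of_neg_of_neg (hneg i hi) (hneg j hj),
    mul_pos_of_neg_of_neg (hneg j hj) (hneg k hk), mul_pos_of_neg_of_neg (hneg k hk) (hneg i hi)]

theorem GDisk.infinite_circle (D : GDisk) : D.circle.Infinite := by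
  set e := 1 / (|D.a| + 1) with he
  have h0 : 0 < |D.a| + 1 := by positivity
  have he0 : 0 < e := by positivity
  have hinj : InjOn (fun t => (D.param t : OnePoint ℂ)) (Icc 0 e) := by
    have main : ∀ t ∈ Icc 0 e, ∀ t' ∈ Icc 0 e, D.param t = D.param t' → ¬ t < t' := by
      intro t ht t' ht' h hlt
      have h1 := two_pi_le_of_param_eq h hlt
      have h2 : |D.a| * (t' - t) ≤ |D.a| * e :=
        mul_le_mul_of_nonneg_left (by linarith [ht.1, ht'.2]) (abs_nonneg _)
      have h3 : |D.a| * e ≤ 1 := by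
        rw [he, mul_one_div, div_le_one h0]; linarith
      linarith [Real.pi_gt_three]
    intro t ht t' ht' h
    have h' := OnePoint.coe_injective h
    exact le_antisymm (not_lt.mp (main t' ht' t ht h'.symm)) (not_lt.mp (main t ht t' ht' h'))
  refine Set.Infinite.mono ?_ ((Set.Icc_infinite he0).image hinj)
  rintro _ ⟨t, -, rfl⟩
  exact D.param_mem_circle t

theorem baseDuals_nonempty (hK : IsInitialConfiguration K) (i₀ : ι) :
    (baseDuals K i₀).Nonempty := by
  have hfin : {p | p ∈ (K i₀).circle ∧ ∃ l, l ≠ i₀ ∧ p ∈ (K l).closedDisk}.Finite := by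
    have : {p | p ∈ (K i₀).circle ∧ ∃ l, l ≠ i₀ ∧ p ∈ (K l).closedDisk} =
        ⋃ l, {p | p ∈ (K i₀).circle ∧ l ≠ i₀ ∧ p ∈ (K l).closedDisk} := by
      ext p; simp only [mem_ofPred_eq, mem_iUnion, exists_and_left]
    rw [this]
    refine Set.finite_iUnion fun l => Set.Subsingleton.finite ?_
    rintro p ⟨h1, h2, h3⟩ q ⟨h1', -, h3'⟩
    obtain ⟨-, r, hr, e⟩ := exists_add_eq_of_mem_closedDisk hK h2 h1 h3
    obtain ⟨-, s, hs, e'⟩ := exists_add_eq_of_mem_closedDisk hK h2 h1' h3'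
    exact (smul_null_inj hr.ne' (e.symm.trans e')).1
  obtain ⟨p, hp, hp'⟩ := (K i₀).infinite_circle.exists_notMem_finite hfin
  obtain ⟨U, hU, -⟩ := exists_dual_of_mem_circle hK hp fun l hl h => hp' ⟨hp, l, hl, h⟩
  exact ⟨U, hU⟩

/-- The isotropic vector of the point of tangency of `K l` and `K i₀`. -/
def cuspVec (K : ι → GDisk) (i₀ l : ι) : LSpace := (K l).vec + (K i₀).vec

theorem lor_cuspVec_base {i₀ l : ι} (hK : IsInitialConfiguration K)
    (hl : Tangent (K l) (K i₀)) : lor (K i₀).vec (cuspVec K i₀ l) = 0 := by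
  rw [cuspVec, lor_add_right, lor_vec_self, lor_comm, lor_vec,
    (hl.add_eq (hK.inv_le fun h => hl.ne (by rw [h]))).1]
  norm_num

theorem exists_cuspVec_eq {i₀ l : ι} (hK : IsInitialConfiguration K)
    (hl : Tangent (K l) (K i₀)) : ∃ p, ∃ r : ℝ, 0 < r ∧ cuspVec K i₀ l = r • null p := by
  obtain ⟨-, p, -, -, r, hr, h⟩ :=
    hl.add_eq_of_disjoint (hK.disjoint l i₀ fun h => hl.ne (by rw [h]))
  exact ⟨p, r, hr, h⟩

theorem lor_cuspVec_cuspVec {i₀ l m : ι} (hK : IsInitialConfiguration K)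
    (hl : Tangent (K l) (K i₀)) (hm : Tangent (K m) (K i₀)) :
    lor (cuspVec K i₀ l) (cuspVec K i₀ m) = lor (K l).vec (K m).vec - 1 := by
  rw [show cuspVec K i₀ l = (K l).vec + (K i₀).vec from rfl, lor_add_left,
    lor_cuspVec_base hK hm, cuspVec, lor_add_right, lor_vec (K l) (K i₀),
    (hl.add_eq (hK.inv_le fun h => hl.ne (by rw [h]))).1]
  ring

theorem lor_cuspVec_of_dual {i₀ i j l : ι} {U : GDisk} (hK : IsInitialConfiguration K)
    (d : IsDualDisk K i₀ i j U) :
    lor U.vec (cuspVec K i₀ l) = lor U.vec (K l).vec := by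
  rw [cuspVec, lor_add_right, d.lor_eq_zero hK, add_zero]

/-- At least three disks touch `K i₀`. -/
theorem exists_third_tangent (hK : IsInitialConfiguration K) {i₀ i j : ι} {U : GDisk}
    (d : IsDualDisk K i₀ i j U) : ∃ l, l ≠ i ∧ l ≠ j ∧ Tangent (K l) (K i₀) := by
  by_contra hneg
  push Not at hneg
  have hti : Tangent (K i) (K i₀) := tangent_comm.mp d.tangent_ij
  have htj : Tangent (K j) (K i₀) := d.tangent_ki
  have hUi : lor U.vec (cuspVec K i₀ i) = 0 := by
    rw [lor_cuspVec_of_dual hK d, d.rotate.lor_eq_zero hK]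
  have hUj : lor U.vec (cuspVec K i₀ j) = 0 := by
    rw [lor_cuspVec_of_dual hK d, d.rotate.rotate.lor_eq_zero hK]
  have hij : lor (cuspVec K i₀ i) (cuspVec K i₀ j) = -2 := by
    rw [lor_cuspVec_cuspVec hK hti htj, lor_vec, d.rotate.inv_eq hK]; norm_num
  obtain ⟨q, s, hs, hq⟩ := exists_cuspVec_eq hK hti
  have hii : lor (cuspVec K i₀ i) (cuspVec K i₀ i) = 0 := by
    rw [hq, lor_smul_left, lor_smul_right, lor_null_null]; ring
  have hjj : lor (cuspVec K i₀ j) (cuspVec K i₀ j) = 0 := by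
    rw [lor_cuspVec_cuspVec hK htj htj, lor_vec_self]; ring
  -- a point of the base circle outside of `U` which is not a point of tangency
  set X : LSpace := cuspVec K i₀ i + cuspVec K i₀ j - (2 : ℝ) • U.vec with hX
  have e : ∀ w, lor w X = lor w (cuspVec K i₀ i) + lor w (cuspVec K i₀ j) - 2 * lor w U.vec := by
    intro w; rw [hX, lor_sub_right, lor_add_right, lor_smul_right]
  have hXU : lor U.vec X = -2 := by rw [e, hUi, hUj, lor_vec_self]; norm_num
  have hX0 : lor (K i₀).vec X = 0 := by
    rw [e, lor_cuspVec_base hK hti, lor_cuspVec_base hK htj, lor_comm _ U.vec, d.lor_eq_zero hK]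
    norm_num
  have hXi : lor (cuspVec K i₀ i) X = -2 := by
    rw [e, hii, hij, lor_comm _ U.vec, hUi]; norm_num
  have hXj : lor (cuspVec K i₀ j) X = -2 := by
    rw [e, hjj, lor_comm _ (cuspVec K i₀ i), hij, lor_comm _ U.vec, hUj]; norm_num
  have hXX : lor X X = 0 := by
    rw [e, lor_comm X, lor_comm X, lor_comm X, hXi, hXj, hXU]; norm_num
  obtain ⟨p, r, hr, hp⟩ := exists_eq_smul_null hXX (by
    rintro h; rw [h, lor_comm, lor_zero_left] at hXU; norm_num at hXU)
  have hr0 : 0 < r := by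
    rw [hp, hq, lor_smul_left, lor_smul_right] at hXi
    by_contra h
    nlinarith [lor_null_nonpos q p, mul_nonneg hs.le (neg_nonneg.mpr (not_lt.mp h)),
      mul_nonneg (mul_nonneg hs.le (neg_nonneg.mpr (not_lt.mp h)))
        (neg_nonneg.mpr (lor_null_nonpos q p))]
  have hUp : lor U.vec (null p) < 0 := by
    rw [hp, lor_smul_right] at hXU
    by_contra h
    nlinarith
  have hp₀ : p ∈ (K i₀).circle := by
    rw [mem_circle_iff_lor]
    rw [hp, lor_smul_right] at hX0
    exact (mul_eq_zero.mp hX0).resolve_left hr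
  have honly : ∀ l, Tangent (K l) (K i₀) → l = i ∨ l = j := by
    intro l hl
    by_contra h
    push Not at h
    exact hneg l h.1 h.2 hl
  obtain ⟨V, ⟨i', j', d'⟩, hV⟩ := exists_dual_of_mem_circle hK hp₀ (by
    intro l hl h
    obtain ⟨ht, s, hs, e'⟩ := exists_add_eq_of_mem_closedDisk hK hl hp₀ h
    have h0 : lor U.vec (cuspVec K i₀ l) = 0 := by
      rcases honly l ht with rfl | rfl
      exacts [hUi, hUj]
    rw [cuspVec, e', lor_smul_right] at h0
    exact hUp.ne ((mul_eq_zero.mp h0).resolve_left hs.ne'))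
  have hVU : V = U := by
    have hne : i' ≠ j' := d'.rotate.ne
    rcases honly i' (tangent_comm.mp d'.tangent_ij) with h1 | h1 <;>
      rcases honly j' d'.tangent_ki with h2 | h2
    · exact absurd (h1.trans h2.symm) hne
    · subst h1 h2; exact d'.unique hK d
    · subst h1 h2; exact d'.unique hK d.swap
    · exact absurd (h1.trans h2.symm) hne
  rw [hVU] at hV
  linarith

open Classical in
/-- The sum of the isotropic vectors of the points of tangency on `K i₀`; it represents a point inside
the fundamental polygon. -/
def centerVec (K : ι → GDisk) (i₀ : ι) : LSpace :=
  ∑ l with Tangent (K l) (K i₀), cuspVec K i₀ l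

theorem lor_centerVec_le {i₀ l : ι} {v : LSpace} (hl : Tangent (K l) (K i₀))
    (h : ∀ m, Tangent (K m) (K i₀) → lor v (cuspVec K i₀ m) ≤ 0) :
    lor v (centerVec K i₀) ≤ lor v (cuspVec K i₀ l) := by
  classical
  rw [centerVec, lor_sum_right, ← neg_le_neg_iff, ← Finset.sum_neg_distrib]
  exact Finset.single_le_sum (f := fun m => -lor v (cuspVec K i₀ m))
    (fun m hm => neg_nonneg.mpr (h m (Finset.mem_filter.mp hm).2))
    (Finset.mem_filter.mpr ⟨Finset.mem_univ l, hl⟩)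

theorem lor_centerVec_base (hK : IsInitialConfiguration K) (i₀ : ι) :
    lor (centerVec K i₀) (K i₀).vec = 0 := by
  classical
  rw [lor_comm, centerVec, lor_sum_right]
  exact Finset.sum_eq_zero fun l hl => lor_cuspVec_base hK (Finset.mem_filter.mp hl).2

theorem lor_centerVec_dual (hK : IsInitialConfiguration K) {i₀ : ι} {U : GDisk}
    (hU : U ∈ baseDuals K i₀) : lor U.vec (centerVec K i₀) ≤ -1 := by
  obtain ⟨i, j, d⟩ := hU
  obtain ⟨l, hi, hj, hl⟩ := exists_third_tangent hK d
  have h1 := d.lor_le (fun h => hl.ne (by rw [h])) hi hj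
  rw [← lor_cuspVec_of_dual hK d] at h1
  refine le_trans (lor_centerVec_le hl fun m hm => ?_) h1
  rw [lor_cuspVec_of_dual hK d]
  exact d.lor_nonpos hK m

theorem lor_cuspVec_nonpos (hK : IsInitialConfiguration K) {i₀ l m : ι}
    (hl : Tangent (K l) (K i₀)) (hm : Tangent (K m) (K i₀)) :
    lor (cuspVec K i₀ l) (cuspVec K i₀ m) ≤ 0 := by
  rw [lor_cuspVec_cuspVec hK hl hm]
  rcases eq_or_ne l m with rfl | h
  · rw [lor_vec_self, sub_self]
  · rw [lor_vec]; linarith [hK.inv_le h]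

theorem lor_cuspVec_centerVec (hK : IsInitialConfiguration K) {i₀ l : ι}
    (hl : Tangent (K l) (K i₀)) : lor (cuspVec K i₀ l) (centerVec K i₀) ≤ -2 := by
  obtain ⟨U, i, j, d⟩ := baseDuals_nonempty hK i₀
  obtain ⟨m, hm, hml⟩ : ∃ m, Tangent (K m) (K i₀) ∧ l ≠ m := by
    rcases eq_or_ne l i with rfl | h
    · exact ⟨j, d.tangent_ki, d.rotate.ne⟩
    · exact ⟨i, tangent_comm.mp d.tangent_ij, h⟩
  refine (lor_centerVec_le hm fun m' hm' => lor_cuspVec_nonpos hK hl hm').trans ?_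
  rw [lor_cuspVec_cuspVec hK hl hm, lor_vec]
  linarith [hK.inv_le hml]

theorem lor_centerVec_self_neg (hK : IsInitialConfiguration K) (i₀ : ι) :
    lor (centerVec K i₀) (centerVec K i₀) < 0 := by
  obtain ⟨U, i, j, d⟩ := baseDuals_nonempty hK i₀
  have hl : Tangent (K i) (K i₀) := tangent_comm.mp d.tangent_ij
  have h := lor_cuspVec_centerVec hK hl
  rw [lor_comm] at h
  refine lt_of_le_of_lt (lor_centerVec_le hl fun m hm => ?_) (lt_of_le_of_lt h (by norm_num))
  rw [lor_comm]
  linarith [lor_cuspVec_centerVec hK hm]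

theorem lor_centerVec_null_nonpos (hK : IsInitialConfiguration K) (i₀ : ι) {v : LSpace}
    (hv : ∀ p, lor v (null p) ≤ 0) : lor v (centerVec K i₀) ≤ 0 := by
  classical
  rw [centerVec, lor_sum_right]
  refine Finset.sum_nonpos fun l hl => ?_
  obtain ⟨p, r, hr, e⟩ := exists_cuspVec_eq hK (Finset.mem_filter.mp hl).2
  rw [e, lor_smul_right]
  exact mul_nonpos_of_nonneg_of_nonpos hr.le (hv p)

theorem lor_centerVec_null (hK : IsInitialConfiguration K) (i₀ : ι) (p : OnePoint ℂ) :
    lor (centerVec K i₀) (null p) < 0 := by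
  refine lt_of_le_of_ne ?_ fun h => ?_
  · rw [lor_comm]
    exact lor_centerVec_null_nonpos hK i₀ fun q => lor_null_nonpos p q
  · have h1 := lor_centerVec_self_neg hK i₀
    obtain ⟨r, hr⟩ := eq_smul_null_of_lor_eq_zero h h1.le
    rw [hr, lor_smul_left, lor_smul_right, lor_null_null, mul_zero, mul_zero] at h1
    exact lt_irrefl _ h1

/-! ### Approximation by points of tangency -/

/-- The reversed Cauchy–Schwarz inequality for unit vectors in the future cone. -/
theorem one_le_neg_lor {v w : LSpace} (hv : lor v v = -1) (hw : lor w w = -1)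
    (hv' : ∀ p, lor v (null p) ≤ 0) (hw' : ∀ p, lor w (null p) ≤ 0) : 1 ≤ -lor v w := by
  have pos : ∀ u : LSpace, lor u u = -1 → (∀ p, lor u (null p) ≤ 0) → 0 < u.1 := by
    intro u hu hu'
    have h1 := hu' OnePoint.infty
    rw [null_infty] at h1
    simp [lor] at h1 hu
    refine lt_of_le_of_ne (by linarith) fun h => ?_
    rw [← h] at hu
    nlinarith [sq_nonneg u.2.1.re, sq_nonneg u.2.1.im]
  have pv := pos v hv hv'
  have pw := pos w hw hw'
  -- a vector with vanishing first coordinate is not timelike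
  have h1 : 0 ≤ lor (w.1 • v - v.1 • w) (w.1 • v - v.1 • w) := by
    have : (w.1 • v - v.1 • w).1 = 0 := by simp [mul_comm]
    rw [lor, this]
    nlinarith [sq_nonneg (w.1 • v - v.1 • w).2.1.re, sq_nonneg (w.1 • v - v.1 • w).2.1.im]
  simp only [lor_sub_left, lor_sub_right, lor_smul_left, lor_smul_right, hv, hw,
    lor_comm w v] at h1
  have h2 : 0 < v.1 * w.1 := mul_pos pv pw
  nlinarith [sq_nonneg (v.1 - w.1)]

/-- A point of the hyperbolic plane in the complement of `K i₀` which lies in the fundamental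
polygon, or not far from it, is close to the horocycle of one of its cusps. -/
theorem exists_cuspVec_le (hK : IsInitialConfiguration K) (i₀ : ι) :
    ∃ c : ℝ, 0 < c ∧ ∀ W : LSpace, lor W W = -1 → lor W (K i₀).vec = 0 →
      (∀ p, lor W (null p) ≤ 0) → (∀ U ∈ baseDuals K i₀, lor W U.vec ≤ 1) →
      ∃ l, Tangent (K l) (K i₀) ∧ -lor W (cuspVec K i₀ l) ≤ c := by
  obtain ⟨κ, hκ, hκ1⟩ : ∃ κ : ℝ, 0 < κ ∧
      lor (κ • centerVec K i₀) (κ • centerVec K i₀) = -1 := by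
    have h := lor_centerVec_self_neg hK i₀
    have h' : 0 < -lor (centerVec K i₀) (centerVec K i₀) := by linarith
    refine ⟨1 / √(-lor (centerVec K i₀) (centerVec K i₀)), by positivity, ?_⟩
    rw [lor_smul_left, lor_smul_right, ← mul_assoc, ← sq, div_pow, Real.sq_sqrt h'.le]
    field_simp
    rw [div_self h.ne]
  obtain ⟨S, hS⟩ : ∃ S, S = κ • centerVec K i₀ := ⟨_, rfl⟩
  rw [← hS] at hκ1
  obtain ⟨M₁, hM₁⟩ : ∃ M, ∀ U ∈ baseDuals K i₀, |lor S U.vec| ≤ M := by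
    obtain ⟨M, hM⟩ := (((finite_dualDisks hK).subset (baseDuals_subset K i₀)).image
      fun U : GDisk => |lor S U.vec|).bddAbove
    exact ⟨M, fun U hU => hM ⟨U, hU, rfl⟩⟩
  obtain ⟨M₂, hM₂⟩ : ∃ M, ∀ l, |lor S (cuspVec K i₀ l)| ≤ M := by
    obtain ⟨M, hM⟩ := (Set.finite_range fun l => |lor S (cuspVec K i₀ l)|).bddAbove
    exact ⟨M, fun l => hM ⟨l, rfl⟩⟩
  have hM₁0 : 0 ≤ M₁ := by
    obtain ⟨U, hU⟩ := baseDuals_nonempty hK i₀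
    exact (abs_nonneg _).trans (hM₁ U hU)
  refine ⟨max (M₁ + 2) M₂, lt_max_of_lt_left (by linarith), fun W hWW hW0 hWf hWU => ?_⟩
  have hSf : ∀ p, lor S (null p) < 0 := fun p => by
    rw [hS, lor_smul_left]
    exact mul_neg_of_pos_of_neg hκ (lor_centerVec_null hK i₀ p)
  have hσ := one_le_neg_lor hWW hκ1 hWf fun p => (hSf p).le
  set σ := -lor W S with hσdef
  have hsq : √(σ ^ 2 - 1) ^ 2 = σ ^ 2 - 1 := Real.sq_sqrt (by nlinarith)
  have hsq0 := Real.sqrt_nonneg (σ ^ 2 - 1)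
  set ρ := √(σ ^ 2 - 1)
  -- `W = t S + X` with isotropic `X`
  set t := σ - ρ with ht
  have ht0 : 0 ≤ t := by
    by_contra h; nlinarith
  have ht1 : t ≤ 1 := by
    by_contra h; nlinarith
  set X := W - t • S with hX
  have hWX : ∀ v, lor W v = t * lor S v + lor X v := by
    intro v; rw [hX, lor_sub_left, lor_smul_left]; ring
  have hXX : lor X X = 0 := by
    simp only [hX, lor_sub_left, lor_sub_right, lor_smul_left, lor_smul_right, hWW, hκ1,
      lor_comm S W]
    rw [show lor W S = -σ by rw [hσdef, neg_neg], ht]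
    linear_combination -hsq
  have tS : ∀ x M : ℝ, |x| ≤ M → 0 ≤ M ∧ -M ≤ t * x := by
    intro x M hx
    have h0 : 0 ≤ M := (abs_nonneg x).trans hx
    have h1 := (abs_le.mp hx).1
    exact ⟨h0, by nlinarith⟩
  have main : (∃ l, Tangent (K l) (K i₀) ∧ -lor W (cuspVec K i₀ l) ≤ M₂) ∨
      ∃ U ∈ baseDuals K i₀, -M₁ ≤ lor W U.vec := by
    by_cases hX0 : X = 0
    · right
      obtain ⟨U, hU⟩ := baseDuals_nonempty hK i₀
      refine ⟨U, hU, ?_⟩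
      rw [hWX, hX0, lor_zero_left, add_zero]
      exact (tS _ _ (hM₁ U hU)).2
    · obtain ⟨p, r, hr, hp⟩ := exists_eq_smul_null hXX hX0
      have hr0 : 0 < r := by
        have h1 : lor X S ≤ 0 := by
          have := hWX S
          rw [hκ1] at this
          have h2 : lor W S = -σ := by rw [hσdef, neg_neg]
          linarith
        rw [hp, lor_smul_left, lor_comm] at h1
        by_contra h
        have h2 : r < 0 := lt_of_le_of_ne (not_lt.mp h) hr
        nlinarith [hSf p]
      have hp₀ : p ∈ (K i₀).circle := by
        have h1 : lor X (K i₀).vec = 0 := by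
          rw [hX, lor_sub_left, lor_smul_left, hW0, hS, lor_smul_left, lor_centerVec_base hK]
          ring
        rw [hp, lor_smul_left, lor_comm] at h1
        rw [mem_circle_iff_lor]
        exact (mul_eq_zero.mp h1).resolve_left hr
      by_cases htan : ∃ l, l ≠ i₀ ∧ p ∈ (K l).closedDisk
      · left
        obtain ⟨l, hl, hpl⟩ := htan
        obtain ⟨hlt, s, hs, e⟩ := exists_add_eq_of_mem_closedDisk hK hl hp₀ hpl
        refine ⟨l, hlt, ?_⟩
        have h1 : lor X (cuspVec K i₀ l) = 0 := by
          rw [cuspVec, e, hp, lor_smul_left, lor_smul_right, lor_null_null]; ring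
        rw [hWX, h1]
        linarith [(tS _ _ (hM₂ l)).2]
      · right
        push Not at htan
        obtain ⟨U, hU, hpU⟩ := exists_dual_of_mem_circle hK hp₀ htan
        refine ⟨U, hU, ?_⟩
        rw [hWX, hp, lor_smul_left, lor_comm (null p)]
        have := (tS _ _ (hM₁ U hU)).2
        have := mul_nonneg hr0.le hpU
        linarith
  rcases main with ⟨l, hl, hle⟩ | ⟨U, hU, hge⟩
  · exact ⟨l, hl, hle.trans (le_max_right _ _)⟩
  · have hle := hWU U hU
    obtain ⟨i, j, d⟩ := hU
    have h1 := d.lor_self_eq hK W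
    rw [hW0, hWW] at h1
    have e : ∀ l, lor W (cuspVec K i₀ l) = lor W (K l).vec := by
      intro l; rw [cuspVec, lor_add_right, hW0, add_zero]
    have neg : ∀ l, Tangent (K l) (K i₀) → lor W (K l).vec ≤ 0 := by
      intro l hl
      obtain ⟨p, r, hr, h⟩ := exists_cuspVec_eq hK hl
      rw [← e, h, lor_smul_right]
      exact mul_nonpos_of_nonneg_of_nonpos hr.le (hWf p)
    have hti : Tangent (K i) (K i₀) := tangent_comm.mp d.tangent_ij
    have ni := neg i hti
    have nj := neg j d.tangent_ki
    by_cases hi : -lor W (K i).vec ≤ M₁ + 2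
    · exact ⟨i, hti, by rw [e]; exact hi.trans (le_max_left _ _)⟩
    · refine ⟨j, d.tangent_ki, ?_⟩
      rw [e]
      refine le_trans ?_ (le_max_left _ _)
      by_contra hj
      push Not at hi hj
      have h2 : lor W U.vec ^ 2 ≤ (M₁ + 1) ^ 2 := by
        apply sq_le_sq'
        · linarith
        · linarith
      nlinarith [mul_lt_mul'' hi hj (by linarith) (by linarith)]

/-- The monoid generated by the reflections that generate the tessellation by fundamental
polygons. -/
def baseMonoid (K : ι → GDisk) (i₀ : ι) : Submonoid (LSpace ≃ₗ[ℝ] LSpace) :=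
  Submonoid.closure (lrefl '' baseDuals K i₀)

theorem baseMonoid_prop (hK : IsInitialConfiguration K) {i₀ : ι} {L : LSpace ≃ₗ[ℝ] LSpace}
    (hL : L ∈ baseMonoid K i₀) : IsMoebius L ∧ L (K i₀).vec = (K i₀).vec ∧
      ∀ C ∈ packing K, ∃ C' ∈ packing K, L C.vec = C'.vec := by
  induction hL using Submonoid.closure_induction with
  | mem x hx =>
    obtain ⟨U, ⟨i, j, d⟩, rfl⟩ := hx
    refine ⟨isMoebius_lrefl U, ?_, fun C hC => ⟨U.reflect C, ?_, (vec_reflect U C).symm⟩⟩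
    · rw [lrefl_apply, d.lor_eq_zero hK, mul_zero, zero_smul, sub_zero]
    · exact reflect_mem_packing ⟨i₀, i, j, d⟩ hC
  | one => exact ⟨IsMoebius.one, rfl, fun C hC => ⟨C, hC, rfl⟩⟩
  | mul x y _ _ ihx ihy =>
    refine ⟨ihx.1.mul ihy.1, ?_, fun C hC => ?_⟩
    · rw [LinearEquiv.mul_apply, ihy.2.1, ihx.2.1]
    · obtain ⟨C', hC', e⟩ := ihy.2.2 C hC
      obtain ⟨C'', hC'', e'⟩ := ihx.2.2 C' hC'
      exact ⟨C'', hC'', by rw [LinearEquiv.mul_apply, e, e']⟩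

/-- Every point `Z` of the hyperbolic plane in the complement of `K i₀` has bounded distance from the
horocycle of some disk of the packing: the image of the centre of the
fundamental polygon which is almost closest to `Z` belongs to a polygon that contains `Z` or
almost does so. -/
theorem exists_tangent_near (hK : IsInitialConfiguration K) (i₀ : ι) :
    ∃ c : ℝ, 0 < c ∧ ∀ Z : LSpace, lor Z Z = -1 → lor Z (K i₀).vec = 0 →
      (∀ p, lor Z (null p) ≤ 0) →
      ∃ C ∈ packing K, C.inv (K i₀) = -1 ∧ ∃ p, ∃ r : ℝ, 0 < r ∧
        C.vec + (K i₀).vec = r • null p ∧ -lor Z (C.vec + (K i₀).vec) ≤ c := by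
  obtain ⟨c, hc, hmain⟩ := exists_cuspVec_le hK i₀
  refine ⟨c, hc, fun Z hZZ hZ0 hZf => ?_⟩
  set S := centerVec K i₀
  set E : Set ℝ := (fun L : LSpace ≃ₗ[ℝ] LSpace => -lor Z (L S)) '' baseMonoid K i₀ with hE
  -- the form of `L⁻¹ Z`, in terms of `Z`
  have hinv : ∀ {L : LSpace ≃ₗ[ℝ] LSpace}, IsMoebius L → ∀ v, lor (L⁻¹ Z) v = lor Z (L v) := by
    intro L hL v
    rw [← hL.lor_map, show L (L⁻¹ Z) = Z from LinearEquiv.apply_symm_apply L Z]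
  have hfut : ∀ {L : LSpace ≃ₗ[ℝ] LSpace}, IsMoebius L → ∀ p, lor (L⁻¹ Z) (null p) ≤ 0 := by
    intro L hL p
    obtain ⟨q, r, hr, e⟩ := hL.map_null p
    rw [hinv hL, e, lor_smul_right]
    exact mul_nonpos_of_nonneg_of_nonpos hr.le (hZf q)
  have hbdd : BddBelow E := by
    refine ⟨0, ?_⟩
    rintro _ ⟨L, hL, rfl⟩
    have hLM := (baseMonoid_prop hK hL).1
    have := lor_centerVec_null_nonpos hK i₀ (hfut hLM)
    rw [hinv hLM] at this
    exact neg_nonneg.mpr this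
  have hne : E.Nonempty := ⟨_, 1, one_mem _, rfl⟩
  obtain ⟨_, ⟨L, hL, rfl⟩, hlt⟩ := Real.lt_sInf_add_pos hne one_pos
  obtain ⟨hLM, hL0, hLP⟩ := baseMonoid_prop hK hL
  obtain ⟨l, hl, hle⟩ := hmain (L⁻¹ Z) (by rw [hLM.inv.lor_map, hZZ])
    (by rw [hinv hLM, hL0, hZ0]) (hfut hLM) (by
      intro U hU
      have hLU : L * lrefl U ∈ baseMonoid K i₀ :=
        mul_mem hL (Submonoid.subset_closure ⟨U, hU, rfl⟩)
      have h1 : sInf E ≤ -lor Z ((L * lrefl U) S) := csInf_le hbdd ⟨_, hLU, rfl⟩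
      rw [LinearEquiv.mul_apply, lrefl_apply, map_sub, map_smul, lor_sub_right,
        lor_smul_right] at h1
      have h2 := lor_centerVec_dual hK hU
      rw [hinv hLM]
      by_contra h3
      push Not at h3
      simp only at hlt
      nlinarith)
  obtain ⟨C, hC, e⟩ := hLP (K l) (mem_packing K l)
  have e' : L (cuspVec K i₀ l) = C.vec + (K i₀).vec := by
    rw [cuspVec, map_add, e, hL0]
  refine ⟨C, hC, ?_, ?_⟩
  · rw [← lor_vec, ← e, ← hL0, hLM.lor_map, lor_vec]
    exact (hl.add_eq (hK.inv_le fun h => hl.ne (by rw [h]))).1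
  · obtain ⟨p, r, hr, h⟩ := exists_cuspVec_eq hK hl
    obtain ⟨q, s, hs, hq⟩ := hLM.map_null p
    refine ⟨q, r * s, mul_pos hr hs, ?_, ?_⟩
    · rw [← e', h, map_smul, hq, mul_smul]
    · rw [← e', ← hinv hLM]
      exact hle

end

section

variable [Fintype ι] {K : ι → GDisk}

/-- A Dirichlet theorem for the packing: a point `x` of the base circle is close to a point of tangency
with a circle whose curvature is bounded by a multiple of `T`. It is obtained from
the point of the hyperbolic plane at height about `1 / T` above `x`. -/
theorem exists_tangentAt_near (hK : IsInitialConfiguration K) (i₀ : ι) :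
    ∃ c T₀ : ℝ, 0 < c ∧ ∀ T, T₀ ≤ T → ∀ x : ℂ, (x : OnePoint ℂ) ∈ (K i₀).circle →
      ∃ C ∈ packing K, ∃ y, TangentAt C (K i₀) y ∧ 0 < C.a + (K i₀).a ∧
        C.a + (K i₀).a ≤ c * T ∧ (C.a + (K i₀).a) * ‖x - y‖ ^ 2 * T ≤ c := by
  obtain ⟨c, hc, hmain⟩ := exists_tangent_near hK i₀
  -- for large `T` a disk that touches at infinity is too far away
  obtain ⟨T₀, hT₀, hinf⟩ : ∃ T₀ : ℝ, 1 ≤ T₀ ∧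
      ∀ C ∈ packing K, C.inv (K i₀) = -1 → ∀ r : ℝ, 0 < r →
        C.vec + (K i₀).vec = r • null OnePoint.infty → 2 * c < T₀ * r := by
    by_cases h : ∃ C ∈ packing K, C.inv (K i₀) = -1 ∧ ∃ r : ℝ, 0 < r ∧
        C.vec + (K i₀).vec = r • null OnePoint.infty
    · obtain ⟨C, hC, hi, r, hr, e⟩ := h
      have h0 : 0 < 2 * c / r := by positivity
      refine ⟨2 * c / r + 1, by linarith, fun D hD hi' s hs e' => ?_⟩
      have h1 : lor (C.vec + (K i₀).vec) (D.vec + (K i₀).vec) = 0 := by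
        rw [e, e', lor_smul_left, lor_smul_right, lor_null_null]; ring
      rw [lor_add_left, lor_add_right, lor_add_right, lor_vec_self, lor_vec, lor_vec,
        lor_comm _ D.vec, lor_vec, hi, hi'] at h1
      have hCD : C = D := by
        rcases packing_inv_le hK hC hD with h2 | h2
        · exact h2
        · linarith
      subst hCD
      have hrs := (smul_null_inj hr.ne' (e.symm.trans e')).2
      rw [← hrs, add_mul, div_mul_cancel₀ _ hr.ne']
      linarith
    · refine ⟨1, le_rfl, fun C hC hi r hr e => absurd ⟨C, hC, hi, r, hr, e⟩ h⟩
  set a₀ := (K i₀).a with ha₀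
  refine ⟨2 * c + a₀ ^ 2 * c / 2, T₀, by positivity, fun T hT x hx => ?_⟩
  have hT1 : 1 ≤ T := hT₀.trans hT
  have hT0 : 0 < T := by linarith
  rw [mem_circle_iff_lor] at hx
  have hI0 : lor (null OnePoint.infty) (K i₀).vec = -a₀ / 2 := by
    rw [null_infty]; simp [lor, vec, ha₀]; ring
  have hIx : lor (null OnePoint.infty) (null x) = -1 / 2 := by
    rw [null_infty, null_coe]; simp [lor]; ring
  have hx' : lor (null x) (K i₀).vec = 0 := by rw [lor_comm, hx]
  -- `Y` represents the point of the circle opposite to `x`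
  obtain ⟨Y, hY⟩ : ∃ Y, Y = (a₀ / 2) • (K i₀).vec - (a₀ ^ 2 / 4) • null x
      + null OnePoint.infty := ⟨_, rfl⟩
  have eY : ∀ v, lor Y v = a₀ / 2 * lor (K i₀).vec v - a₀ ^ 2 / 4 * lor (null x) v +
      lor (null OnePoint.infty) v := by
    intro v; rw [hY, lor_add_left, lor_sub_left, lor_smul_left, lor_smul_left]
  have hY0 : lor Y (K i₀).vec = 0 := by rw [eY, lor_vec_self, hx', hI0]; ring
  have hYx : lor Y (null x) = -1 / 2 := by rw [eY, hx, lor_null_null, hIx]; ring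
  have hYY : lor Y Y = 0 := by
    rw [eY, lor_comm _ Y, hY0, lor_comm _ Y, hYx, lor_comm _ Y, eY, lor_null_null,
      lor_comm _ (null OnePoint.infty), hI0, lor_comm _ (null OnePoint.infty), hIx]
    ring
  have hYf : ∀ p, lor Y (null p) ≤ 0 := by
    obtain ⟨q, r, hr, e⟩ := exists_eq_smul_null hYY (by
      rintro h; rw [h, lor_zero_left] at hYx; norm_num at hYx)
    have hr0 : 0 < r := by
      rw [e, lor_smul_left] at hYx
      by_contra h
      nlinarith [lor_null_nonpos q x]
    intro p
    rw [e, lor_smul_left]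
    exact mul_nonpos_of_nonneg_of_nonpos hr0.le (lor_null_nonpos q p)
  have eZ : ∀ v, lor (T • null x + (1 / T) • Y) v = T * lor (null x) v + 1 / T * lor Y v := by
    intro v; rw [lor_add_left, lor_smul_left, lor_smul_left]
  obtain ⟨C, hC, hi, p, r, hr, hp, hle⟩ := hmain (T • null x + (1 / T) • Y) (by
      rw [eZ, lor_comm _ (T • null x + (1 / T) • Y), eZ, lor_comm _ (T • null x + (1 / T) • Y), eZ,
        lor_null_null, hYY, hYx, lor_comm, hYx]
      field_simp
      norm_num
      ring) (by rw [eZ, hx', hY0]; ring) (fun p => by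
      rw [eZ]
      have h1 := mul_nonpos_of_nonneg_of_nonpos hT0.le (lor_null_nonpos x p)
      have h2 := mul_nonpos_of_nonneg_of_nonpos (one_div_pos.mpr hT0).le (hYf p)
      linarith)
  rw [eZ, hp, lor_smul_right, lor_smul_right] at hle
  have h1 : 0 ≤ -(1 / T * (r * lor Y (null p))) := by
    rw [← mul_assoc]
    exact neg_nonneg.mpr (mul_nonpos_of_nonneg_of_nonpos (by positivity) (hYf p))
  have h2 : 0 ≤ -(T * (r * lor (null x) (null p))) := by
    rw [← mul_assoc]
    exact neg_nonneg.mpr (mul_nonpos_of_nonneg_of_nonpos (by positivity) (lor_null_nonpos _ p))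
  cases p with
  | infty =>
    exfalso
    have h3 := hinf C hC hi r hr hp
    rw [lor_comm (null x), hIx] at hle
    nlinarith
  | coe y =>
    have ht := tangentAt_of_add_eq hi hr.ne' hp
    have hA : C.a + a₀ = r := by
      have := congrArg Prod.fst hp
      rw [null_coe] at this
      simpa [vec] using this
    have h0 : lor (K i₀).vec (null (y : OnePoint ℂ)) = 0 :=
      ((K i₀).mem_circle_iff_lor y).mp ht.tangent.2.2
    have hIy : lor (null OnePoint.infty) (null (y : OnePoint ℂ)) = -1 / 2 := by
      rw [null_infty, null_coe]; simp [lor]; ring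
    rw [eY, h0, hIy, lor_null_coe_coe] at hle h1
    rw [lor_null_coe_coe] at h2
    set d := ‖x - y‖ ^ 2 with hd
    have h3 : r * d * T ≤ 2 * c := by linarith
    have hrd : 0 ≤ r * d := by positivity
    have h4 : 1 / T * (r * (1 - a₀ ^ 2 / 4 * d)) ≤ 2 * c := by linarith
    have h5 : r * (1 - a₀ ^ 2 / 4 * d) ≤ 2 * c * T := by
      rw [one_div, inv_mul_le_iff₀ hT0] at h4
      linarith
    have h6 : r * d ≤ 2 * c * T := by nlinarith
    refine ⟨C, hC, y, ht, by rw [hA]; exact hr, ?_, ?_⟩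
    · rw [hA]
      nlinarith [sq_nonneg a₀]
    · rw [hA]
      have : 0 ≤ a₀ ^ 2 * c / 2 := by positivity
      linarith

/-- The tangent disks lie outside of `K i₀`; away from infinity, the curvatures relative to `K i₀` are
bounded from below. -/
theorem exists_one_le_mul (hK : IsInitialConfiguration K) (i₀ : ι) :
    ∃ B : ℝ, 0 < B ∧ ∀ C ∈ packing K, ∀ y, TangentAt C (K i₀) y →
      0 < C.a + (K i₀).a ∧ 1 ≤ (C.a + (K i₀).a) * (B * (1 + ‖y‖ ^ 2)) := by
  obtain ⟨c, T₀, hc, hmain⟩ := exists_tangentAt_near hK i₀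
  obtain ⟨C', hC', y', hy', hA', -⟩ := hmain T₀ le_rfl _ ((K i₀).param_mem_circle 0)
  set A' := C'.a + (K i₀).a
  refine ⟨1 / A' + A' * (1 + ‖y'‖ ^ 2), by positivity, fun C hC y hy => ?_⟩
  rcases packing_inv_le hK hC hC' with rfl | hinv
  · refine ⟨hA', ?_⟩
    have h1 : A' * (1 / A') = 1 := by field_simp
    have h2 : 0 ≤ A' * (1 / A') * ‖y‖ ^ 2 + A' * (A' * (1 + ‖y'‖ ^ 2)) * (1 + ‖y‖ ^ 2) := by
      positivity
    have h3 : A' * ((1 / A' + A' * (1 + ‖y'‖ ^ 2)) * (1 + ‖y‖ ^ 2)) = A' * (1 / A') +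
      (A' * (1 / A') * ‖y‖ ^ 2 + A' * (A' * (1 + ‖y'‖ ^ 2)) * (1 + ‖y‖ ^ 2)) := by ring
    rw [h3, h1]
    rw [h1] at h2
    linarith
  · obtain ⟨h1, h2⟩ := hy.four_le hy' hinv
    have hA : 0 < C.a + (K i₀).a := pos_of_mul_pos_left h1 hA'.le
    refine ⟨hA, ?_⟩
    set A := C.a + (K i₀).a
    have h3 : ‖y - y'‖ ^ 2 ≤ 2 * ((1 + ‖y'‖ ^ 2) * (1 + ‖y‖ ^ 2)) := by
      have h4 := norm_sub_le y y'
      have h5 : ‖y - y'‖ ^ 2 ≤ (‖y‖ + ‖y'‖) ^ 2 := by gcongr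
      nlinarith [sq_nonneg (‖y‖ - ‖y'‖), sq_nonneg (‖y‖ * ‖y'‖)]
    have h4 := mul_le_mul_of_nonneg_left h3 h1.le
    have h5 : 0 ≤ A * (1 / A' * (1 + ‖y‖ ^ 2)) := by positivity
    have h6 : A * ((1 / A' + A' * (1 + ‖y'‖ ^ 2)) * (1 + ‖y‖ ^ 2)) =
      A * (1 / A' * (1 + ‖y‖ ^ 2)) + A * A' * ((1 + ‖y'‖ ^ 2) * (1 + ‖y‖ ^ 2)) := by ring
    rw [h6]
    linarith

end

/-! ### Counting points of tangency -/

theorem sum_le_of_pairwiseDisjoint {E : Finset ℝ} {r : ℝ → ℝ} {x y : ℝ} (hr : ∀ τ ∈ E, 0 ≤ r τ)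
    (hxy : x ≤ y)
    (hdisj : (E : Set ℝ).PairwiseDisjoint fun τ => Ioo (τ - r τ) (τ + r τ))
    (hsub : ∀ τ ∈ E, Ioo (τ - r τ) (τ + r τ) ⊆ Icc x y) : ∑ τ ∈ E, 2 * r τ ≤ y - x := by
  have h1 : volume (⋃ τ ∈ E, Ioo (τ - r τ) (τ + r τ)) ≤ volume (Icc x y) :=
    measure_mono (iUnion₂_subset hsub)
  rw [measure_biUnion_finset hdisj fun τ _ => measurableSet_Ioo, Real.volume_Icc] at h1
  have h2 : ∀ τ ∈ E, volume (Ioo (τ - r τ) (τ + r τ)) = ENNReal.ofReal (2 * r τ) := by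
    intro τ _
    rw [Real.volume_Ioo]
    congr 1
    ring
  rw [Finset.sum_congr rfl h2, ← ENNReal.ofReal_sum_of_nonneg fun τ hτ => by
    linarith [hr τ hτ]] at h1
  exact (ENNReal.ofReal_le_ofReal_iff (by linarith)).mp h1

theorem le_sum_of_subset_biUnion {E : Finset ℝ} {r : ℝ → ℝ} {x y : ℝ} (hr : ∀ τ ∈ E, 0 ≤ r τ)
    (hcov : Icc x y ⊆ ⋃ τ ∈ E, Icc (τ - r τ) (τ + r τ)) : y - x ≤ ∑ τ ∈ E, 2 * r τ := by
  have h1 := (measure_mono (μ := volume) hcov).trans (measure_biUnion_finset_le E _)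
  have h2 : ∀ τ ∈ E, volume (Icc (τ - r τ) (τ + r τ)) = ENNReal.ofReal (2 * r τ) := by
    intro τ _
    rw [Real.volume_Icc]
    congr 1
    ring
  rw [Finset.sum_congr rfl h2, ← ENNReal.ofReal_sum_of_nonneg (fun τ hτ => by
    linarith [hr τ hτ]), Real.volume_Icc] at h1
  exact (ENNReal.ofReal_le_ofReal_iff
    (Finset.sum_nonneg fun τ hτ => by linarith [hr τ hτ])).mp h1

/-- A lower bound for the number of points `τ` of weights `A τ` which are separated by
`2 / √(A τ A τ')` and satisfy a Dirichlet theorem. The points of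
weight at most `Q / (144 c)` are the centres of disjoint intervals of radius `12 √c / √(A τ Q)`, hence the
intervals of radius `√c / √(A τ Q)` around them cover only a small part; the
remaining part is covered by intervals of length at most `24 c / Q`. -/
theorem length_mul_le_card {E : Finset ℝ} {A : ℝ → ℝ} {c Q x y : ℝ} (hc : 0 < c) (hQ : 0 < Q)
    (hxy : x < y) (hA : ∀ τ ∈ E, 0 < A τ) (hE : ∀ τ ∈ E, τ ∈ Icc x y)
    (hsep : ∀ τ ∈ E, ∀ τ' ∈ E, τ ≠ τ' → 4 ≤ A τ * A τ' * (τ - τ') ^ 2)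
    (hcov : ∀ t ∈ Icc (x + (y - x) / 4) (y - (y - x) / 4), ∃ τ ∈ E, A τ * (t - τ) ^ 2 * Q ≤ c)
    (hlarge : ∀ τ ∈ E, 144 * c ≤ A τ * Q * (y - x) ^ 2) :
    (y - x) * Q ≤ 96 * c * E.card := by
  classical
  set ρ : ℝ → ℝ := fun τ => √(c / (A τ * Q)) with hρ
  have hρ0 : ∀ τ ∈ E, 0 ≤ ρ τ := fun τ _ => Real.sqrt_nonneg _
  have hρsq : ∀ τ ∈ E, ρ τ ^ 2 * (A τ * Q) = c := by
    intro τ hτ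
    have := mul_pos (hA τ hτ) hQ
    rw [hρ]
    simp only
    rw [Real.sq_sqrt (by have := hc.le; positivity), div_mul_cancel₀ _ this.ne']
  have h1 : (y - x) / 2 ≤ ∑ τ ∈ E, 2 * ρ τ := by
    have := le_sum_of_subset_biUnion hρ0 (x := x + (y - x) / 4) (y := y - (y - x) / 4) (by
      intro t ht
      obtain ⟨τ, hτ, hle⟩ := hcov t ht
      refine mem_iUnion₂.mpr ⟨τ, hτ, ?_⟩
      have hAQ := mul_pos (hA τ hτ) hQ
      have h2 : |t - τ| ≤ ρ τ := by
        apply Real.abs_le_sqrt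
        rw [le_div_iff₀ hAQ]
        linarith
      rw [abs_le] at h2
      exact ⟨by linarith, by linarith⟩)
    linarith
  set S := E.filter fun τ => A τ * (144 * c) ≤ Q with hS
  have hsmall : ∑ τ ∈ S, 2 * (12 * ρ τ) ≤ (y + (y - x)) - (x - (y - x)) := by
    refine sum_le_of_pairwiseDisjoint (r := fun τ => 12 * ρ τ) ?_ (by linarith) ?_ ?_
    · intro τ hτ
      have := hρ0 τ (Finset.mem_filter.mp hτ).1
      positivity
    · intro τ hτ τ' hτ' hne
      have hτ := Finset.mem_filter.mp hτ
      have hτ' := Finset.mem_filter.mp hτ'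
      have e1 := hρsq τ hτ.1
      have e2 := hρsq τ' hτ'.1
      have p1 := hA τ hτ.1
      have p2 := hA τ' hτ'.1
      have key : ∀ σ ∈ E, ∀ σ' ∈ E, A σ' * (144 * c) ≤ Q →
          (12 * ρ σ) ^ 2 * (A σ * A σ') ≤ 1 := by
        intro σ hσ σ' hσ' hle
        have e := hρsq σ hσ
        have pσ := hA σ hσ
        have pσ' := hA σ' hσ'
        have h3 : (12 * ρ σ) ^ 2 * (A σ * A σ') * Q = A σ' * (144 * c) := by
          rw [← e]; ring
        have h4 : (12 * ρ σ) ^ 2 * (A σ * A σ') * Q ≤ 1 * Q := by rw [h3, one_mul]; exact hle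
        exact le_of_mul_le_mul_right h4 hQ
      have k1 := key τ hτ.1 τ' hτ'.1 hτ'.2
      have k2 := key τ' hτ'.1 τ hτ.1 hτ.2
      have hs := hsep τ hτ.1 τ' hτ'.1 hne
      have q1 := hρ0 τ hτ.1
      have q2 := hρ0 τ' hτ'.1
      have hAA : 0 < A τ * A τ' := mul_pos p1 p2
      have h5 : 12 * ρ τ + 12 * ρ τ' ≤ |τ - τ'| := by
        apply abs_le_of_sq_le_sq' _ (abs_nonneg _) |>.2
        rw [sq_abs]
        have h6 : (12 * ρ τ + 12 * ρ τ') ^ 2 * (A τ * A τ') ≤ 4 := by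
          nlinarith [mul_nonneg hAA.le (sq_nonneg (12 * ρ τ - 12 * ρ τ'))]
        have h7 : (12 * ρ τ + 12 * ρ τ') ^ 2 * (A τ * A τ') ≤ (τ - τ') ^ 2 * (A τ * A τ') := by
          linarith
        exact le_of_mul_le_mul_right h7 hAA
      rw [Function.onFun, Set.disjoint_left]
      rintro z ⟨hz1, hz2⟩ ⟨hz3, hz4⟩
      rcases abs_cases (τ - τ') with ⟨h, -⟩ | ⟨h, -⟩ <;> linarith
    · intro τ hτ z hz
      have hτ := (Finset.mem_filter.mp hτ).1
      have h2 : 12 * ρ τ ≤ y - x := by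
        have hAQ := mul_pos (hA τ hτ) hQ
        apply abs_le_of_sq_le_sq' _ (by linarith) |>.2
        have h3 : (12 * ρ τ) ^ 2 * (A τ * Q) ≤ (y - x) ^ 2 * (A τ * Q) := by
          rw [mul_pow, mul_assoc, hρsq τ hτ]
          linarith [hlarge τ hτ]
        exact le_of_mul_le_mul_right h3 hAQ
      have h3 := hE τ hτ
      exact ⟨by linarith [h3.1, hz.1], by linarith [h3.2, hz.2]⟩
  have hbig : ∑ τ ∈ E.filter (fun τ => ¬ A τ * (144 * c) ≤ Q), 2 * ρ τ ≤ E.card * (24 * c / Q) := by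
    calc _ ≤ ∑ τ ∈ E.filter (fun τ => ¬ A τ * (144 * c) ≤ Q), 24 * c / Q := by
          refine Finset.sum_le_sum fun τ hτ => ?_
          obtain ⟨hτ, hlt⟩ := Finset.mem_filter.mp hτ
          push Not at hlt
          have h2 : ρ τ ≤ 12 * c / Q := by
            apply Real.sqrt_le_iff.mpr
            refine ⟨by positivity, ?_⟩
            have hAQ := mul_pos (hA τ hτ) hQ
            rw [div_le_iff₀ hAQ]
            have h3 : (12 * c / Q) ^ 2 * (A τ * Q) = c * (A τ * (144 * c) / Q) := by
              field_simp; ring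
            rw [h3]
            have h4 : 1 ≤ A τ * (144 * c) / Q := by rw [one_le_div hQ]; exact hlt.le
            nlinarith
          have h3 : 24 * c / Q = 2 * (12 * c / Q) := by ring
          rw [h3]
          linarith
      _ ≤ E.card * (24 * c / Q) := by
          rw [Finset.sum_const, nsmul_eq_mul]
          gcongr
          exact Finset.filter_subset _ _
  rw [← Finset.sum_filter_add_sum_filter_not E (fun τ => A τ * (144 * c) ≤ Q)] at h1
  have h2 : ∑ τ ∈ S, 2 * (12 * ρ τ) = 12 * ∑ τ ∈ S, 2 * ρ τ := by
    rw [Finset.mul_sum]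
    exact Finset.sum_congr rfl fun τ _ => by ring
  have h3 : (y - x) / 4 ≤ E.card * (24 * c / Q) := by linarith
  rw [← mul_div_assoc, le_div_iff₀ hQ] at h3
  linarith

theorem IsArc.exists_bounds {C₀ : GDisk} {J : Set ℝ} (hJ : IsArc C₀ J) :
    ∃ x y : ℝ, x < y ∧ Ioo x y ⊆ J ∧ J ⊆ Icc x y := by
  have hbb := hJ.bounded.bddBelow
  have hba := hJ.bounded.bddAbove
  obtain ⟨z, hz⟩ := hJ.nontrivial
  have hne : J.Nonempty := ⟨z, interior_subset hz⟩
  have hsub : J ⊆ Icc (sInf J) (sSup J) := fun t ht => ⟨csInf_le hbb ht, le_csSup hba ht⟩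
  refine ⟨sInf J, sSup J, ?_, ?_, hsub⟩
  · rw [mem_interior_iff_mem_nhds, Metric.mem_nhds_iff] at hz
    obtain ⟨e, he, hball⟩ := hz
    have h1 : z + e / 2 ∈ J := hball (by
      rw [Metric.mem_ball, Real.dist_eq, add_sub_cancel_left, abs_of_pos (by positivity)]; linarith)
    have h2 : z ∈ J := hball (Metric.mem_ball_self he)
    linarith [(hsub h1).2, (hsub h2).1]
  · intro t ht
    obtain ⟨u, hu, hut⟩ := exists_lt_of_csInf_lt hne ht.1
    obtain ⟨v, hv, htv⟩ := exists_lt_of_lt_csSup hne ht.2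
    exact hJ.ordConnected.out hu hv ⟨hut.le, htv.le⟩

/-- The number of points of tangency in an arc has at least the order of magnitude of the length
of the arc times `T`, with a constant that does not depend on the arc. -/
theorem exists_le_ncard [Fintype ι] {K : ι → GDisk} (hK : IsInitialConfiguration K) (i₀ : ι) :
    ∃ ε : ℝ, 0 < ε ∧ ∀ J : Set ℝ, IsArc (K i₀) J → ∀ᶠ T in atTop,
      (tangencies (packing K) (K i₀) T ∩ (K i₀).param '' J).Finite →
      ε * (volume J).toReal * T ≤
        ((tangencies (packing K) (K i₀) T ∩ (K i₀).param '' J).ncard : ℝ) := by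
  classical
  obtain ⟨c, T₀, hc, hmain⟩ := exists_tangentAt_near hK i₀
  obtain ⟨B, hB, hAB⟩ := exists_one_le_mul hK i₀
  set D := K i₀ with hD
  have hDP : D ∈ packing K := mem_packing K i₀
  set k := c + |D.a| with hk
  have hk0 : 0 < k := by positivity
  refine ⟨1 / (384 * c * k), by positivity, fun J hJ => ?_⟩
  obtain ⟨x, y, hxy, hJ1, hJ2⟩ := hJ.exists_bounds
  have hl : 0 < y - x := by linarith
  set R := ‖D.param x‖ + (y - x) with hR
  have hR0 : 0 ≤ R := by positivity
  have hbound : ∀ t ∈ Icc x y, ‖D.param t‖ ≤ R := by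
    intro t ht
    have h1 := D.norm_param_sub_le t x
    rw [abs_of_nonneg (by linarith [ht.1])] at h1
    have h2 := norm_sub_norm_le (D.param t) (D.param x)
    linarith [ht.2]
  -- the parameter `T` of the counting function is a multiple of the one in the Dirichlet theorem
  have hQlim : Tendsto (fun T : ℝ => T / k) atTop atTop := tendsto_id.atTop_div_const hk0
  filter_upwards [hQlim.eventually_ge_atTop T₀, hQlim.eventually_ge_atTop 1,
    hQlim.eventually_gt_atTop (4 * c * B + 2 * c * B * (1 + 2 * R ^ 2) * (64 / (y - x) ^ 2)),
    hQlim.eventually_ge_atTop (576 * c * (B * (1 + R ^ 2)) / (y - x) ^ 2)]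
    with T hT1 hT2 hT3 hT4 hfin
  set Q := T / k with hQ
  have hQ0 : 0 < Q := by linarith
  have hTQ : T = k * Q := by rw [hQ]; field_simp
  set E₀ : Set ℝ := {τ | τ ∈ J ∧ D.param τ ∈ tangencies (packing K) D T} with hE₀
  have himg : tangencies (packing K) D T ∩ D.param '' J = D.param '' E₀ := by
    ext z
    constructor
    · rintro ⟨h1, τ, h2, rfl⟩; exact ⟨τ, ⟨h2, h1⟩, rfl⟩
    · rintro ⟨τ, ⟨h2, h1⟩, rfl⟩; exact ⟨h1, τ, h2, rfl⟩
  have hinj : InjOn D.param E₀ := hJ.injOn.mono fun τ hτ => hτ.1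
  have hE₀fin : E₀.Finite := by
    rw [himg] at hfin
    exact hfin.of_finite_image hinj
  rw [himg, hinj.ncard_image]
  set E := hE₀fin.toFinset with hE
  rw [ncard_eq_toFinset_card E₀ hE₀fin]
  have hmemE : ∀ τ, τ ∈ E ↔ τ ∈ J ∧ D.param τ ∈ tangencies (packing K) D T := by
    intro τ; rw [hE, Set.Finite.mem_toFinset]; rfl
  have hex : ∀ τ, ∃ C, τ ∈ E → C ∈ packing K ∧ TangentAt C D (D.param τ) := by
    intro τ
    by_cases h : τ ∈ E
    · obtain ⟨C, hC, -, ht⟩ := (mem_tangencies_iff hK hDP T _).mp ((hmemE τ).mp h).2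
      exact ⟨C, fun _ => ⟨hC, ht⟩⟩
    · exact ⟨D, fun h' => absurd h' h⟩
  choose Cf hCf using hex
  have hl2 : volume J ≤ ENNReal.ofReal (y - x) := by
    rw [← Real.volume_Icc]; exact measure_mono hJ2
  have hlen : (volume J).toReal ≤ y - x := ENNReal.toReal_le_of_le_ofReal hl.le hl2
  have main := length_mul_le_card (E := E) (A := fun τ => (Cf τ).a + D.a) (c := 4 * c) (Q := Q)
    (x := x) (y := y) (by positivity) hQ0 hxy
    (fun τ hτ => (hAB _ (hCf τ hτ).1 _ (hCf τ hτ).2).1)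
    (fun τ hτ => hJ2 ((hmemE τ).mp hτ).1)
    (fun τ hτ τ' hτ' hne => by
      have hCne : (Cf τ).inv (Cf τ') ≤ -1 := by
        refine (packing_inv_le hK (hCf τ hτ).1 (hCf τ' hτ').1).resolve_left fun h => hne ?_
        have h1 := (hCf τ hτ).2
        rw [h] at h1
        exact hJ.injOn ((hmemE τ).mp hτ).1 ((hmemE τ').mp hτ').1 (h1.eq (hCf τ' hτ').2)
      obtain ⟨h1, h2⟩ := (hCf τ hτ).2.four_le (hCf τ' hτ').2 hCne
      have h3 : ‖D.param τ - D.param τ'‖ ^ 2 ≤ (τ - τ') ^ 2 := by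
        rw [← sq_abs (τ - τ')]
        have := D.norm_param_sub_le τ τ'
        gcongr
      exact h2.trans (mul_le_mul_of_nonneg_left h3 h1.le))
    (fun t ht => by
      have htI : t ∈ Icc x y := ⟨by linarith [ht.1], by linarith [ht.2]⟩
      obtain ⟨C, hC, z, hz, hA0, hA1, hA2⟩ := hmain Q hT1 _ (D.param_mem_circle t)
      obtain ⟨-, hA3⟩ := hAB C hC z hz
      obtain ⟨τ, hτz, hτt⟩ := D.exists_param_eq hz.tangent.2.2 t
      set A := C.a + D.a
      set d := ‖D.param t - z‖ with hd
      rw [norm_sub_rev, ← hd] at hτt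
      have hd0 : 0 ≤ d := norm_nonneg _
      -- the point of tangency is so close that it belongs to the arc
      have h1 : d ^ 2 * Q ≤ c * (B * (1 + ‖z‖ ^ 2)) := by
        have h2 : d ^ 2 * Q ≤ A * (B * (1 + ‖z‖ ^ 2)) * (d ^ 2 * Q) :=
          le_mul_of_one_le_left (by positivity) hA3
        have h3 : A * (B * (1 + ‖z‖ ^ 2)) * (d ^ 2 * Q) = A * d ^ 2 * Q * (B * (1 + ‖z‖ ^ 2)) := by
          ring
        rw [h3] at h2
        exact h2.trans (mul_le_mul_of_nonneg_right hA2 (by positivity))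
      have h2 : ‖z‖ ^ 2 ≤ 2 * R ^ 2 + 2 * d ^ 2 := by
        have h3 : ‖z‖ ≤ R + d := by
          have h4 := norm_sub_norm_le z (D.param t)
          rw [norm_sub_rev, ← hd] at h4
          linarith [hbound t htI]
        have h5 : ‖z‖ ^ 2 ≤ (R + d) ^ 2 := by gcongr
        nlinarith [sq_nonneg (R - d)]
      have h3 : d < (y - x) / 8 := by
        by_contra hge
        push Not at hge
        have h4 : ((y - x) / 8) ^ 2 ≤ d ^ 2 := by gcongr
        have h5 : d ^ 2 * Q ≤ c * B * (1 + 2 * R ^ 2) + 2 * c * B * d ^ 2 := by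
          have : c * (B * (1 + ‖z‖ ^ 2)) ≤ c * (B * (1 + (2 * R ^ 2 + 2 * d ^ 2))) := by gcongr
          linarith
        have h6 : 1 ≤ 64 / (y - x) ^ 2 * d ^ 2 := by
          rw [div_mul_eq_mul_div, le_div_iff₀ (by positivity)]
          linarith
        have hd2 : 0 < d ^ 2 := lt_of_lt_of_le (by positivity) h4
        have h7 := mul_lt_mul_of_pos_left hT3 hd2
        have h8 : c * B * (1 + 2 * R ^ 2) ≤
            c * B * (1 + 2 * R ^ 2) * (64 / (y - x) ^ 2 * d ^ 2) :=
          le_mul_of_one_le_right (by positivity) h6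
        have h9 : 0 ≤ c * B * d ^ 2 := by positivity
        nlinarith
      have hτJ : τ ∈ J := by
        apply hJ1
        obtain ⟨h4, h5⟩ := abs_le.mp hτt
        exact ⟨by linarith [ht.1], by linarith [ht.2]⟩
      have hτE : τ ∈ E := by
        rw [hmemE]
        refine ⟨hτJ, (mem_tangencies_iff hK hDP T _).mpr ⟨C, hC, ?_, by rw [hτz]; exact hz⟩⟩
        have h4 : |C.a| ≤ A + |D.a| := by
          have h5 : C.a = A - D.a := by ring
          calc |C.a| = |A - D.a| := by rw [← h5]
            _ ≤ |A| + |D.a| := abs_sub _ _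
            _ = A + |D.a| := by rw [abs_of_pos hA0]
        rw [hTQ, hk, add_mul]
        have h5 : |D.a| ≤ |D.a| * Q := le_mul_of_one_le_right (abs_nonneg _) hT2
        linarith
      refine ⟨τ, hτE, ?_⟩
      have hCeq : Cf τ = C := by
        rcases packing_inv_le hK (hCf τ hτE).1 hC with h4 | h4
        · exact h4
        · have h5 := ((hCf τ hτE).2.four_le hz h4).2
          rw [hτz, sub_self, norm_zero] at h5
          norm_num at h5
      rw [hCeq]
      have h4 : (t - τ) ^ 2 ≤ (2 * d) ^ 2 := by
        rw [← sq_abs (t - τ), abs_sub_comm]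
        gcongr
      have h5 : A * (t - τ) ^ 2 * Q ≤ A * (2 * d) ^ 2 * Q := by gcongr
      linarith)
    (fun τ hτ => by
      obtain ⟨h1, h2⟩ := hAB _ (hCf τ hτ).1 _ (hCf τ hτ).2
      set A := (Cf τ).a + D.a
      have h3 : ‖D.param τ‖ ^ 2 ≤ R ^ 2 := by
        have := hbound τ (hJ2 ((hmemE τ).mp hτ).1)
        gcongr
      have h4 : 1 ≤ A * (B * (1 + R ^ 2)) :=
        h2.trans (by gcongr)
      rw [div_le_iff₀ (by positivity)] at hT4
      have h5 := mul_le_mul_of_nonneg_left hT4 h1.le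
      have h6 := mul_le_mul_of_nonneg_left h4 (show 0 ≤ 576 * c by positivity)
      linarith)
  rw [hTQ]
  have h1 : 1 / (384 * c * k) * (volume J).toReal * (k * Q) =
      (volume J).toReal * Q / (384 * c) := by
    field_simp
  rw [h1, div_le_iff₀ (by positivity)]
  have h2 := mul_le_mul_of_nonneg_right hlen hQ0.le
  linarith

/-! ### The area of the cusp regions -/

namespace GDisk

/-- The normal vector of length one of the bounding curve at one of its points. -/
def normal (D : GDisk) (z : ℂ) : ℂ := D.b - D.a * z

theorem normSq_normal (D : GDisk) {z : ℂ} (hz : D.val z = 0) : Complex.normSq (D.normal z) = 1 := by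
  have h := D.norm_eq
  simp only [val, normal, Complex.normSq_apply, Complex.mul_re, Complex.mul_im, Complex.sub_re,
    Complex.sub_im, Complex.ofReal_re, Complex.ofReal_im, Complex.conj_re, Complex.conj_im] at *
  linear_combination h + D.a * hz

/-- The inversive product is the cosine of the angle of the normal vectors. -/
theorem re_conj_normal_mul_normal (C D : GDisk) {z : ℂ} (hC : C.val z = 0) (hD : D.val z = 0) :
    ((starRingEnd ℂ) (C.normal z) * D.normal z).re = C.inv D := by
  simp only [val, normal, inv, Complex.normSq_apply, Complex.mul_re, Complex.mul_im, Complex.sub_re,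
    Complex.sub_im, Complex.ofReal_re, Complex.ofReal_im, Complex.conj_re, Complex.conj_im] at *
  linear_combination C.a / 2 * hD + D.a / 2 * hC

end GDisk

/-- The map `w ↦ α - n / w`. If `n` is the normal vector of a circle at its point `α`, it takes a half plane
`Re w > const` to the complement of the disk, and infinity to `α`. -/
def cuspChart (α n w : ℂ) : ℂ := α - n / w

theorem val_cuspChart (D : GDisk) {α n w : ℂ} (hα : D.val α = 0) (hn : Complex.normSq n = 1)
    (hw : w ≠ 0) : D.val (cuspChart α n w) = (D.a + 2 * ((starRingEnd ℂ) (D.normal α) * n *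
      (starRingEnd ℂ) w).re) / Complex.normSq w := by
  have hw' : Complex.normSq w ≠ 0 := (Complex.normSq_pos.mpr hw).ne'
  have e : n / w = n * (starRingEnd ℂ) w * ((1 / Complex.normSq w : ℝ) : ℂ) := by
    rw [div_eq_mul_inv, Complex.inv_def]
    push_cast
    ring
  rw [cuspChart, e, eq_div_iff hw']
  have hk : 1 / Complex.normSq w * Complex.normSq w = 1 := one_div_mul_cancel hw'
  set k := 1 / Complex.normSq w with hkdef
  clear_value k
  simp only [GDisk.val, GDisk.normal, Complex.normSq_apply, Complex.mul_re, Complex.mul_im,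
    Complex.sub_re, Complex.sub_im, Complex.ofReal_re, Complex.ofReal_im, Complex.conj_re,
    Complex.conj_im] at *
  linear_combination (w.re * w.re + w.im * w.im) * hα
    + (D.a * (k * (w.re * w.re + w.im * w.im)) ^ 2) * hn
    + (D.a * (k * (w.re * w.re + w.im * w.im) + 1)
      + 2 * ((D.b.re - D.a * α.re) * (n.re * w.re + n.im * w.im)
        + (D.b.im - D.a * α.im) * (n.im * w.re - n.re * w.im))) * hk

theorem cuspChart_inv {α n z : ℂ} (hz : z ≠ α) (hn : n ≠ 0) :
    -n / (z - α) ≠ 0 ∧ cuspChart α n (-n / (z - α)) = z := by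
  have h := sub_ne_zero.mpr hz
  refine ⟨div_ne_zero (neg_ne_zero.mpr hn) h, ?_⟩
  rw [cuspChart]
  field_simp
  ring

theorem det_toSpanSingleton (c : ℂ) :
    ((ContinuousLinearMap.toSpanSingleton ℂ c : ℂ →L[ℂ] ℂ).restrictScalars ℝ).det =
      Complex.normSq c := by
  rw [ContinuousLinearMap.det]
  have : ((ContinuousLinearMap.toSpanSingleton ℂ c : ℂ →L[ℂ] ℂ).restrictScalars ℝ : ℂ →ₗ[ℝ] ℂ) =
      Algebra.lmul ℝ ℂ c := by
    ext; simp [mul_comm]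
  rw [this, ← Algebra.norm_apply, Algebra.norm_complex_apply]

/-- In the coordinate `w`, the hyperbolic metric of the complement of `D` is that of a half plane. -/
theorem hypArea_image_cuspChart (D : GDisk) {α : ℂ} (hα : D.val α = 0) {W : Set ℂ}
    (hW : MeasurableSet W) (h0 : ∀ w ∈ W, w ≠ 0) :
    D.hypArea (cuspChart α (D.normal α) '' W) =
      ∫⁻ w in W, ENNReal.ofReal (4 / (D.a + 2 * w.re) ^ 2) := by
  set n := D.normal α with hn
  have hn1 : Complex.normSq n = 1 := D.normSq_normal hα
  have hn0 : n ≠ 0 := by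
    intro h; rw [h, map_zero] at hn1; exact zero_ne_one hn1
  have hderiv : ∀ w ∈ W, HasFDerivWithinAt (cuspChart α n)
      ((ContinuousLinearMap.toSpanSingleton ℂ (n / w ^ 2) : ℂ →L[ℂ] ℂ).restrictScalars ℝ) W w := by
    intro w hw
    have h1 : HasDerivAt (cuspChart α n) (n / w ^ 2) w := by
      have h2 := ((hasDerivAt_inv (h0 w hw)).const_mul n).const_sub α
      have h3 : (fun x => α - n * x⁻¹) = cuspChart α n := by
        funext x; rw [cuspChart, div_eq_mul_inv]
      rw [h3] at h2
      exact h2.congr_deriv (by rw [div_eq_mul_inv]; ring)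
    exact (h1.hasFDerivAt.restrictScalars ℝ).hasFDerivWithinAt
  have hinj : InjOn (cuspChart α n) W := by
    intro w hw w' hw' h
    have e1 := h0 w hw
    have e2 := h0 w' hw'
    simp only [cuspChart] at h
    have h1 : n / w = n / w' := by linear_combination -h
    rw [div_eq_div_iff e1 e2] at h1
    exact (mul_left_cancel₀ hn0 h1).symm
  rw [hypArea, lintegral_image_eq_lintegral_abs_det_fderiv_mul volume hW hderiv hinj]
  refine setLIntegral_congr_fun hW fun w hw => ?_
  have hw0 := h0 w hw
  have hw' : Complex.normSq w ≠ 0 := (Complex.normSq_pos.mpr hw0).ne'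
  have hc : (starRingEnd ℂ) n * n = 1 := by
    rw [mul_comm, Complex.mul_conj, hn1, Complex.ofReal_one]
  rw [det_toSpanSingleton, val_cuspChart D hα hn1 hw0, ← hn, hc, one_mul, Complex.conj_re,
    ← ENNReal.ofReal_mul (abs_nonneg _), abs_of_nonneg (Complex.normSq_nonneg _)]
  congr 1
  rw [map_div₀, hn1, map_pow, div_pow, div_div_eq_mul_div, one_div]
  rw [← mul_div_assoc, mul_comm 4, ← mul_assoc, inv_mul_cancel₀ (pow_ne_zero 2 hw'), one_mul]

theorem lintegral_half_strip_lt_top {a x y y' : ℝ} (h : 0 < a + 2 * x) :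
    ∫⁻ w in {w : ℂ | x ≤ w.re ∧ y ≤ w.im ∧ w.im ≤ y'},
      ENNReal.ofReal (4 / (a + 2 * w.re) ^ 2) < ⊤ := by
  have hint : IntegrableOn (fun u : ℝ => 4 / (a + 2 * u) ^ 2) (Ici x) := by
    rw [integrableOn_Ici_iff_integrableOn_Ioi]
    have hpos : ∀ u, x ≤ u → 0 < a + 2 * u := fun u hu => by linarith
    refine integrableOn_Ioi_deriv_of_nonneg' (g := fun u => -2 / (a + 2 * u)) (l := 0) ?_ ?_ ?_
    · intro u hu
      have h1 : HasDerivAt (fun u : ℝ => a + 2 * u) 2 u := by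
        simpa using ((hasDerivAt_id u).const_mul 2).const_add a
      have h2 := (hasDerivAt_const u (-2 : ℝ)).div h1 (hpos u hu).ne'
      exact h2.congr_deriv (by norm_num)
    · intro u hu
      positivity
    · apply Tendsto.const_div_atTop
      exact tendsto_atTop_add_const_left _ _ (tendsto_id.const_mul_atTop two_pos)
  have hmeas : Measurable fun u : ℝ => ENNReal.ofReal (4 / (a + 2 * u) ^ 2) := by fun_prop
  have hset : {w : ℂ | x ≤ w.re ∧ y ≤ w.im ∧ w.im ≤ y'} =
      Complex.measurableEquivRealProd ⁻¹' (Ici x ×ˢ Icc y y') := by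
    ext w; rfl
  have h0 := Complex.volume_preserving_equiv_real_prod.setLIntegral_comp_preimage_emb
    Complex.measurableEquivRealProd.measurableEmbedding
    (fun p : ℝ × ℝ => ENNReal.ofReal (4 / (a + 2 * p.1) ^ 2)) (Ici x ×ˢ Icc y y')
  rw [hset]
  refine lt_of_eq_of_lt h0 ?_
  rw [Measure.volume_eq_prod, ← Measure.prod_restrict]
  have h1 := lintegral_prod_mul (μ := volume.restrict (Ici x)) (ν := volume.restrict (Icc y y'))
    hmeas.aemeasurable (g := fun _ => 1) aemeasurable_const
  simp only [mul_one] at h1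
  rw [h1]
  refine ENNReal.mul_lt_top ?_ ?_
  · exact hint.lintegral_lt_top
  · rw [setLIntegral_one]
    exact measure_Icc_lt_top

section

variable [Fintype ι] {K : ι → GDisk}

theorem IsDualDisk.val_eq_zero (hK : IsInitialConfiguration K) {i₀ i j : ι} {U : GDisk}
    (d : IsDualDisk K i₀ i j U) {α : ℂ} (hα : TangentAt (K i) (K i₀) α) : U.val α = 0 := by
  have h1 : lor U.vec ((K i).vec + (K i₀).vec) = 0 := by
    rw [lor_add_right, d.lor_eq_zero hK, d.rotate.lor_eq_zero hK, add_zero]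
  rw [hα.add_eq, lor_smul_right] at h1
  exact (U.mem_circle_iff_lor α).mpr ((mul_eq_zero.mp h1).resolve_left hα.ne_zero)

/-- The side of the geodesic that bounds `U` which belongs to `U`, seen from its end point `α`: the
sine of the angle between the normal vectors of `U` and of the base circle. -/
def sideSign (U D : GDisk) (α : ℂ) : ℝ := ((starRingEnd ℂ) (U.normal α) * D.normal α).im

theorem IsDualDisk.conj_normal_mul (hK : IsInitialConfiguration K) {i₀ i j : ι} {U : GDisk}
    (d : IsDualDisk K i₀ i j U) {α : ℂ} (hα : TangentAt (K i) (K i₀) α) :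
    (starRingEnd ℂ) (U.normal α) * (K i₀).normal α = (sideSign U (K i₀) α : ℂ) * Complex.I ∧
      (sideSign U (K i₀) α = 1 ∨ sideSign U (K i₀) α = -1) := by
  have h0 : (K i₀).val α = 0 := hα.tangent.2.2
  have hU := d.val_eq_zero hK hα
  have hre := re_conj_normal_mul_normal U (K i₀) hU h0
  rw [← lor_vec, d.lor_eq_zero hK] at hre
  have e : (starRingEnd ℂ) (U.normal α) * (K i₀).normal α =
      (sideSign U (K i₀) α : ℂ) * Complex.I := by
    apply Complex.ext
    · rw [hre]; simp
    · simp [sideSign]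
  refine ⟨e, ?_⟩
  have h1 : Complex.normSq ((starRingEnd ℂ) (U.normal α) * (K i₀).normal α) = 1 := by
    rw [map_mul, Complex.normSq_conj, U.normSq_normal hU, (K i₀).normSq_normal h0, one_mul]
  rw [Complex.normSq_apply, hre] at h1
  have h2 : sideSign U (K i₀) α * sideSign U (K i₀) α = 1 := by
    rw [sideSign]; linarith
  exact mul_self_eq_one_iff.mp h2

theorem IsDualDisk.val_cuspChart (hK : IsInitialConfiguration K) {i₀ i j : ι} {U : GDisk}
    (d : IsDualDisk K i₀ i j U) {α w : ℂ} (hα : TangentAt (K i) (K i₀) α) (hw : w ≠ 0) :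
    U.val (cuspChart α ((K i₀).normal α) w) =
      (U.a + 2 * (sideSign U (K i₀) α * w.im)) / Complex.normSq w := by
  rw [_root_.val_cuspChart U (d.val_eq_zero hK hα) ((K i₀).normSq_normal hα.tangent.2.2) hw,
    (d.conj_normal_mul hK hα).1]
  congr 3
  simp

theorem val_base_cuspChart {D : GDisk} {α w : ℂ} (hα : D.val α = 0) (hw : w ≠ 0) :
    D.val (cuspChart α (D.normal α) w) = (D.a + 2 * w.re) / Complex.normSq w := by
  rw [val_cuspChart D hα (D.normSq_normal hα) hw]
  rw [mul_comm ((starRingEnd ℂ) _), Complex.mul_conj, D.normSq_normal hα, Complex.ofReal_one,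
    one_mul, Complex.conj_re]

theorem TangentAt.val_cuspChart {C D : GDisk} {α w : ℂ} (hα : TangentAt C D α) (hw : w ≠ 0) :
    C.val (cuspChart α (D.normal α) w) = (C.a - 2 * w.re) / Complex.normSq w := by
  have hC : C.val α = 0 := hα.tangent.2.1
  have hD : D.val α = 0 := hα.tangent.2.2
  have hn : C.normal α = -D.normal α := by
    have h := congrArg (fun v : LSpace => v.2.1) hα.add_eq
    rw [null_coe] at h
    simp [vec] at h
    simp only [normal]
    linear_combination h
  rw [_root_.val_cuspChart C hC (D.normSq_normal hD) hw, hn, map_neg, neg_mul,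
    mul_comm ((starRingEnd ℂ) _), Complex.mul_conj, D.normSq_normal hD]
  congr 1
  simp
  ring

/-- On both sides of a point of tangency there is a gap. -/
theorem exists_dual_sideSign (hK : IsInitialConfiguration K) {i₀ i : ι} {α : ℂ} (hi : i ≠ i₀)
    (hα : TangentAt (K i) (K i₀) α) {s : ℝ} (hs : s = 1 ∨ s = -1) :
    ∃ j U, IsDualDisk K i₀ i j U ∧ sideSign U (K i₀) α = s := by
  have h0 : (K i₀).val α = 0 := hα.tangent.2.2
  have hssq : s * s = 1 := by rcases hs with rfl | rfl <;> norm_num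
  by_contra hneg
  push Not at hneg
  -- points of the base circle that approach `α` from the side in question
  set w : ℕ → ℂ := fun x => ⟨-(K i₀).a / 2, -s * (x + 1)⟩ with hw
  have hw0 : ∀ x, w x ≠ 0 := by
    intro x h
    have h1 : -s * ((x : ℝ) + 1) = 0 := congrArg Complex.im h
    have h2 : s ≠ 0 := by rintro rfl; norm_num at hssq
    have h3 : (x : ℝ) + 1 ≠ 0 := by positivity
    exact (mul_ne_zero (neg_ne_zero.mpr h2) h3) h1
  set z : ℕ → ℂ := fun x => cuspChart α ((K i₀).normal α) (w x) with hz
  have hz0 : ∀ x, (z x : OnePoint ℂ) ∈ (K i₀).circle := by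
    intro x
    change (K i₀).val (z x) = 0
    rw [hz]
    simp only
    rw [val_base_cuspChart h0 (hw0 x), hw]
    simp only
    rw [mul_div_cancel₀ _ (two_ne_zero), add_neg_cancel, zero_div]
  have hcast : Tendsto (fun x : ℕ => (x : ℝ) + 1) atTop atTop :=
    tendsto_atTop_add_const_right _ _ tendsto_natCast_atTop_atTop
  have hlim : Tendsto z atTop (𝓝 α) := by
    have h1 : Tendsto (fun x => ‖w x‖) atTop atTop := by
      refine tendsto_atTop_mono (fun x => ?_) hcast
      have h2 := Complex.abs_im_le_norm (w x)
      have h3 : |(w x).im| = (x : ℝ) + 1 := by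
        change |-s * ((x : ℝ) + 1)| = _
        rw [abs_mul, abs_neg, abs_of_nonneg (by positivity : (0 : ℝ) ≤ (x : ℝ) + 1)]
        rcases hs with rfl | rfl <;> simp
      rwa [h3] at h2
    have h4 : Tendsto w atTop (Bornology.cobounded ℂ) := tendsto_norm_atTop_iff_cobounded.mp h1
    have h5 : Tendsto (fun x => α - (K i₀).normal α * (w x)⁻¹) atTop
        (𝓝 (α - (K i₀).normal α * 0)) :=
      ((tendsto_inv₀_cobounded.comp h4).const_mul _).const_sub _
    rw [mul_zero, sub_zero] at h5
    exact h5
  have near : ∀ E : GDisk, 0 < E.val α → ∀ᶠ x in atTop, 0 < E.val (z x) := fun E hE =>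
    ((E.continuous_val.tendsto α).comp hlim).eventually (lt_mem_nhds hE)
  have hdisk : ∀ᶠ x in atTop, ∀ l, l ≠ i₀ → 0 < (K l).val (z x) := by
    rw [eventually_all]
    intro l
    rcases eq_or_ne l i₀ with rfl | hl
    · exact Eventually.of_forall fun _ h => absurd rfl h
    rcases eq_or_ne l i with rfl | hli
    · refine Eventually.of_forall fun x _ => ?_
      rw [hz]
      simp only
      rw [hα.val_cuspChart (hw0 x)]
      obtain ⟨B, -, hB⟩ := exists_one_le_mul hK i₀
      have h1 := (hB _ (mem_packing K l) α hα).1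
      refine div_pos ?_ (Complex.normSq_pos.mpr (hw0 x))
      rw [hw]
      simp only
      linarith
    · have h1 : 0 < (K l).sval (α : OnePoint ℂ) := by
        by_contra hle
        have hmem : (α : OnePoint ℂ) ∈ (K l).closedDisk := not_lt.mp hle
        obtain ⟨-, r, hr, e⟩ := exists_add_eq_of_mem_closedDisk hK hl hα.tangent.2.2 hmem
        have h2 : lor ((K l).vec + (K i₀).vec) ((K i).vec + (K i₀).vec) = 0 := by
          rw [e, hα.add_eq, lor_smul_left, lor_smul_right, lor_null_null]; ring
        rw [lor_add_left, lor_add_right, lor_add_right, lor_vec_self, lor_vec, lor_vec,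
          lor_comm _ (K i).vec, lor_vec, hα.inv_eq] at h2
        linarith [hK.inv_le hli, hK.inv_le hl]
      filter_upwards [near _ h1] with x hx _ using hx
  have hdual : ∀ᶠ x in atTop, ∀ U ∈ baseDuals K i₀, 0 < U.val (z x) := by
    refine (eventually_all_finite ((finite_dualDisks hK).subset (baseDuals_subset K i₀))).mpr ?_
    rintro U ⟨a, b, d⟩
    have adj : ∀ j, IsDualDisk K i₀ i j U → ∀ᶠ x in atTop, 0 < U.val (z x) := by
      intro j d
      have hne := hneg j U d
      have h1 : sideSign U (K i₀) α = -s := by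
        rcases (d.conj_normal_mul hK hα).2 with h | h <;> rcases hs with rfl | rfl
        · exact absurd h hne
        · rw [h, neg_neg]
        · exact h
        · exact absurd h hne
      filter_upwards [hcast.eventually_gt_atTop (-U.a / 2)] with x hx
      rw [hz]
      simp only
      rw [d.val_cuspChart hK hα (hw0 x), h1]
      refine div_pos ?_ (Complex.normSq_pos.mpr (hw0 x))
      rw [hw]
      simp only
      have h2 : -s * (-s * ((x : ℝ) + 1)) = s * s * ((x : ℝ) + 1) := by ring
      rw [h2, hssq]
      linarith
    by_cases ha : i = a
    · subst ha; exact adj b d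
    by_cases hb : i = b
    · subst hb; exact adj a d.swap
    · apply near
      have h1 := d.lor_le hi ha hb
      have h2 : lor U.vec ((K i).vec + (K i₀).vec) ≤ -1 := by
        rw [lor_add_right, d.lor_eq_zero hK, add_zero]; exact h1
      rw [hα.add_eq, lor_smul_right] at h2
      obtain ⟨B, -, hB⟩ := exists_one_le_mul hK i₀
      have h3 := (hB _ (mem_packing K i) α hα).1
      rw [← sval_coe, sval_eq]
      by_contra hle
      push Not at hle
      nlinarith
  obtain ⟨x, hx1, hx2⟩ := (hdisk.and hdual).exists
  obtain ⟨U, hU, hUz⟩ := exists_dual_of_mem_circle hK (hz0 x) fun l hl => not_le.mpr (hx1 l hl)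
  have h1 := hx2 U hU
  rw [← sval_coe, sval_eq] at h1
  linarith

/-- A cusp region lies in a half strip, in the coordinate `w`. -/
theorem hypArea_cuspRegion_lt_top (hK : IsInitialConfiguration K) {i₀ i : ι} {α : ℂ}
    (hi : i ≠ i₀) (hα : TangentAt (K i) (K i₀) α) :
    (K i₀).hypArea (cuspRegion K i₀ i) < ⊤ := by
  have h0 : (K i₀).val α = 0 := hα.tangent.2.2
  set n := (K i₀).normal α with hn
  have hn0 : n ≠ 0 := by
    intro h
    have := (K i₀).normSq_normal h0
    rw [← hn, h, map_zero] at this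
    exact zero_ne_one this
  obtain ⟨j, U, d, hU⟩ := exists_dual_sideSign hK hi hα (Or.inl rfl)
  obtain ⟨j', V, d', hV⟩ := exists_dual_sideSign hK hi hα (Or.inr rfl)
  obtain ⟨B, -, hB⟩ := exists_one_le_mul hK i₀
  have hA := (hB _ (mem_packing K i) α hα).1
  set W : Set ℂ := {w | (K i).a / 2 ≤ w.re ∧ -U.a / 2 ≤ w.im ∧ w.im ≤ V.a / 2} with hW
  have hWm : MeasurableSet W := by
    refine IsClosed.measurableSet ?_
    exact (isClosed_le continuous_const Complex.continuous_re).inter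
      ((isClosed_le continuous_const Complex.continuous_im).inter
        (isClosed_le Complex.continuous_im continuous_const))
  have hsub : cuspRegion K i₀ i ⊆ insert α (cuspChart α n '' (W \ {0})) := by
    rintro z ⟨hz1, hz2⟩
    rcases eq_or_ne z α with rfl | hne
    · exact mem_insert _ _
    refine mem_insert_of_mem _ ?_
    obtain ⟨hw0, hwz⟩ := cuspChart_inv hne hn0
    set w := -n / (z - α)
    have hnw : 0 < Complex.normSq w := Complex.normSq_pos.mpr hw0
    refine ⟨w, ⟨⟨?_, ?_, ?_⟩, hw0⟩, hwz⟩
    · have h1 : (K i).val z ≤ 0 := hz1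
      rw [← hwz, hα.val_cuspChart hw0, div_le_iff₀ hnw, zero_mul] at h1
      linarith
    · have h1 : 0 < U.val z := not_le.mp (hz2 j U d)
      rw [← hwz, d.val_cuspChart hK hα hw0, lt_div_iff₀ hnw, zero_mul, hU] at h1
      linarith
    · have h1 : 0 < V.val z := not_le.mp (hz2 j' V d')
      rw [← hwz, d'.val_cuspChart hK hα hw0, lt_div_iff₀ hnw, zero_mul, hV] at h1
      linarith
  have h1 : (K i₀).hypArea (cuspRegion K i₀ i) ≤
      (K i₀).hypArea (cuspChart α n '' (W \ {0})) := by
    have hae : (insert α (cuspChart α n '' (W \ {0})) : Set ℂ) =ᵐ[volume]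
        cuspChart α n '' (W \ {0}) := insert_ae_eq_self _ _
    rw [hypArea, hypArea, ← setLIntegral_congr hae]
    exact lintegral_mono_set hsub
  refine h1.trans_lt ?_
  rw [hn, hypArea_image_cuspChart _ h0 (hWm.diff (measurableSet_singleton 0)) fun w hw => hw.2]
  refine (lintegral_mono_set sdiff_subset).trans_lt ?_
  exact lintegral_half_strip_lt_top (by linarith)

/-- A cusp region contains the half line above the centre of the fundamental polygon, in the coordinate
`w`, and a neighbourhood of it. -/
theorem hypArea_cuspRegion_pos (hK : IsInitialConfiguration K) {i₀ i : ι} {α : ℂ}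
    (hα : TangentAt (K i) (K i₀) α) :
    0 < (K i₀).hypArea (cuspRegion K i₀ i) := by
  have h0 : (K i₀).val α = 0 := hα.tangent.2.2
  set n := (K i₀).normal α with hn
  set P : Set GDisk := {U | ∃ j, IsDualDisk K i₀ i j U} with hP
  have hPfin : P.Finite := (finite_dualDisks hK).subset fun U ⟨j, d⟩ => ⟨i₀, i, j, d⟩
  set ρ := |(K i₀).a| + |(K i).a| with hρ
  have hρ0 : 0 ≤ ρ := by positivity
  have hρ1 : -(K i₀).a ≤ ρ := by linarith [neg_abs_le (K i₀).a, abs_nonneg (K i).a]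
  have hρ2 : (K i).a ≤ ρ := by linarith [le_abs_self (K i).a, abs_nonneg (K i₀).a]
  set O : Set ℂ := {w | ρ < w.re} ∩
    ⋂ U ∈ P, {w | 0 < U.a + 2 * (sideSign U (K i₀) α * w.im)} with hO
  have hOopen : IsOpen O := by
    refine (isOpen_lt continuous_const Complex.continuous_re).inter ?_
    refine hPfin.isOpen_biInter fun U _ => isOpen_lt continuous_const ?_
    fun_prop
  have hO0 : ∀ w ∈ O, w ≠ 0 := by
    rintro w ⟨hw, -⟩ rfl
    have : ρ < (0 : ℂ).re := hw
    rw [Complex.zero_re] at this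
    linarith
  have hOne : O.Nonempty := by
    set S := centerVec K i₀
    have hγ := lor_centerVec_null hK i₀ (α : OnePoint ℂ)
    set γ := -2 * lor S (null (α : OnePoint ℂ)) with hγdef
    have hγ0 : 0 < γ := by linarith
    refine ⟨⟨ρ + 1, ((starRingEnd ℂ) n * (S.2.1 - S.1 * α)).im / γ⟩, ?_, ?_⟩
    · change ρ < ρ + 1
      linarith
    · refine mem_iInter₂.mpr ?_
      rintro U ⟨j, d⟩
      change 0 < U.a + 2 * (sideSign U (K i₀) α * (((starRingEnd ℂ) n * (S.2.1 - S.1 * α)).im / γ))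
      have h1 := lor_centerVec_dual hK ⟨i, j, d⟩
      obtain ⟨h2, -⟩ := d.conj_normal_mul hK hα
      have hU : U.val α = 0 := d.val_eq_zero hK hα
      have hnn := (K i₀).normSq_normal h0
      rw [← hn] at h2 hnn
      -- the value of the form on `U` in coordinates centred at `α`
      have h3 : lor U.vec S = sideSign U (K i₀) α * (-((starRingEnd ℂ) n * (S.2.1 - S.1 * α)).im)
          - U.a * γ / 2 := by
        have h4 : (starRingEnd ℂ) (U.normal α) * (S.2.1 - S.1 * α) =
            (sideSign U (K i₀) α : ℂ) * Complex.I * ((starRingEnd ℂ) n * (S.2.1 - S.1 * α)) := by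
          rw [← h2]
          have h5 : n * (starRingEnd ℂ) n = 1 := by rw [Complex.mul_conj, hnn, Complex.ofReal_one]
          linear_combination (-(starRingEnd ℂ) (U.normal α) * (S.2.1 - S.1 * α)) * h5
        have h6 : lor U.vec S =
            ((starRingEnd ℂ) (U.normal α) * (S.2.1 - S.1 * α)).re - U.a * γ / 2 := by
          rw [hγdef, null_coe]
          simp only [lor, vec, normal, val, Complex.normSq_apply, Complex.mul_re, Complex.mul_im,
            Complex.sub_re, Complex.sub_im, Complex.ofReal_re, Complex.ofReal_im, Complex.conj_re,
            Complex.conj_im] at hU ⊢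
          linear_combination -S.1 / 2 * hU
        rw [h6, h4]
        simp
        ring
      have h7 : sideSign U (K i₀) α * (((starRingEnd ℂ) n * (S.2.1 - S.1 * α)).im / γ) * γ =
          sideSign U (K i₀) α * ((starRingEnd ℂ) n * (S.2.1 - S.1 * α)).im := by
        field_simp
      by_contra hle
      push Not at hle
      nlinarith
  have hsub : cuspChart α n '' O ⊆ cuspRegion K i₀ i := by
    rintro _ ⟨w, hw, rfl⟩
    have hw0 := hO0 w hw
    have hnw : 0 < Complex.normSq w := Complex.normSq_pos.mpr hw0
    have hre : ρ < w.re := hw.1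
    refine ⟨?_, fun j U d => ?_⟩
    · change (K i).val _ ≤ 0
      rw [hn, hα.val_cuspChart hw0]
      exact div_nonpos_of_nonpos_of_nonneg (by linarith) hnw.le
    · change ¬ U.val _ ≤ 0
      rw [not_le, hn, d.val_cuspChart hK hα hw0]
      exact div_pos (mem_iInter₂.mp hw.2 U ⟨j, d⟩) hnw
  have h1 : (K i₀).hypArea (cuspChart α n '' O) ≤ (K i₀).hypArea (cuspRegion K i₀ i) :=
    lintegral_mono_set hsub
  refine lt_of_lt_of_le ?_ h1
  rw [hn, hypArea_image_cuspChart _ h0 hOopen.measurableSet hO0]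
  rw [setLIntegral_pos_iff (by fun_prop)]
  refine lt_of_lt_of_le (hOopen.measure_pos volume hOne) (measure_mono fun w hw => ⟨?_, hw⟩)
  have hre : ρ < w.re := hw.1
  have h2 : 0 < (K i₀).a + 2 * w.re := by linarith
  rw [Function.mem_support]
  exact (ENNReal.ofReal_pos.mpr (by positivity)).ne'

theorem tangencyDensity_pos (hK : IsInitialConfiguration K) (i₀ : ι) :
    0 < tangencyDensity K i₀ := by
  classical
  obtain ⟨U, i, j, d⟩ := baseDuals_nonempty hK i₀
  have hti : Tangent (K i) (K i₀) := tangent_comm.mp d.tangent_ij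
  have htj : Tangent (K j) (K i₀) := d.tangent_ki
  obtain ⟨l, hli, hlj, htl⟩ := exists_third_tangent hK d
  have hfin : {i | Tangent (K i) (K i₀)}.Finite := Set.toFinite _
  -- two different disks do not both touch at infinity
  obtain ⟨m, hm, α, hα⟩ : ∃ m, Tangent (K m) (K i₀) ∧ ∃ α, TangentAt (K m) (K i₀) α := by
    have main : ∀ m, Tangent (K m) (K i₀) → (∃ α, TangentAt (K m) (K i₀) α) ∨
        ∃ r : ℝ, cuspVec K i₀ m = r • null OnePoint.infty := by
      intro m hm
      obtain ⟨p, r, hr, e⟩ := exists_cuspVec_eq hK hm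
      cases p with
      | infty => exact Or.inr ⟨r, e⟩
      | coe α => exact Or.inl ⟨α, tangentAt_of_add_eq
          (hm.add_eq (hK.inv_le fun h => hm.ne (by rw [h]))).1 hr.ne' e⟩
    rcases main i hti with h | ⟨r, hr⟩
    · exact ⟨i, hti, h⟩
    rcases main j htj with h | ⟨s, hs⟩
    · exact ⟨j, htj, h⟩
    exfalso
    have h1 := lor_cuspVec_cuspVec hK hti htj
    rw [hr, hs, lor_smul_left, lor_smul_right, lor_null_null, lor_vec, d.rotate.inv_eq hK] at h1
    norm_num at h1
  have hm0 : m ≠ i₀ := fun h => hm.ne (by rw [h])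
  have hcard : 3 ≤ {i | Tangent (K i) (K i₀)}.ncard := by
    rw [ncard_eq_toFinset_card _ hfin]
    have h1 : ({i, j, l} : Finset ι).card = 3 :=
      Finset.card_eq_three.mpr ⟨i, j, l, d.rotate.ne, hli.symm, hlj.symm, rfl⟩
    rw [← h1]
    apply Finset.card_le_card
    intro x hx
    rw [Set.Finite.mem_toFinset]
    simp only [Finset.mem_insert, Finset.mem_singleton] at hx
    rcases hx with rfl | rfl | rfl
    exacts [hti, htj, htl]
  have hcard' : (3 : ℝ) ≤ ({i | Tangent (K i) (K i₀)}.ncard : ℝ) := by exact_mod_cast hcard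
  rw [tangencyDensity]
  refine div_pos ?_ (mul_pos (by positivity) (by linarith))
  rw [finsum_mem_eq_finite_toFinset_sum _ hfin]
  refine Finset.sum_pos' (fun _ _ => ENNReal.toReal_nonneg) ⟨m, ?_, ?_⟩
  · rw [Set.Finite.mem_toFinset]; exact hm
  · exact ENNReal.toReal_pos (hypArea_cuspRegion_pos hK hα).ne'
      (hypArea_cuspRegion_lt_top hK hm0 hα).ne

end

/-! ### Change of the initial configuration -/

/-- The bijection of the sphere that is defined by a Lorentz transformation. -/
theorem IsMoebius.exists_perm {L : LSpace ≃ₗ[ℝ] LSpace} (hL : IsMoebius L) :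
    ∃ φ : Equiv.Perm (OnePoint ℂ), ∀ p, ∃ r : ℝ, 0 < r ∧ L (null p) = r • null (φ p) := by
  choose f r hr hf using hL.map_null
  choose f' r' hr' hf' using hL.inv.map_null
  have e1 : ∀ v, L (L⁻¹ v) = v := fun v => LinearEquiv.apply_symm_apply L v
  have e2 : ∀ v, L⁻¹ (L v) = v := fun v => LinearEquiv.symm_apply_apply L v
  refine ⟨⟨f, f', fun p => ?_, fun p => ?_⟩, fun p => ⟨r p, hr p, hf p⟩⟩
  · have h : (1 : ℝ) • null p = (r p * r' (f p)) • null (f' (f p)) := by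
      rw [one_smul, mul_smul, ← hf', ← map_smul, ← hf, e2]
    exact (smul_null_inj one_ne_zero h).1.symm
  · have h : (1 : ℝ) • null p = (r' p * r (f' p)) • null (f (f' p)) := by
      rw [one_smul, mul_smul, ← hf, ← map_smul, ← hf', e1]
    exact (smul_null_inj one_ne_zero h).1.symm

/-- An element of the reflection group moves the disks by a bijection of the sphere. -/
theorem exists_image_eq {K : ι → GDisk} {σ : Equiv.Perm GDisk} (hσ : σ ∈ reflectionGroup K) :
    ∃ φ : Equiv.Perm (OnePoint ℂ), ∀ D : GDisk, (σ D).circle = φ '' D.circle ∧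
      (σ D).openDisk = φ '' D.openDisk ∧ (σ D).closedDisk = φ '' D.closedDisk := by
  obtain ⟨L, hL, h⟩ := exists_linear hσ
  obtain ⟨φ, hφ⟩ := hL.exists_perm
  refine ⟨φ, fun D => ?_⟩
  have key : ∀ p, ∃ r : ℝ, 0 < r ∧ lor D.vec (null p) = r * lor (σ D).vec (null (φ p)) := by
    intro p
    obtain ⟨r, hr, e⟩ := hφ p
    exact ⟨r, hr, by rw [← lor_smul_right, ← e, h, hL.lor_map]⟩
  have himage : ∀ A B : Set (OnePoint ℂ), (∀ p, φ p ∈ A ↔ p ∈ B) → A = φ '' B := by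
    intro A B hAB
    rw [← (Set.ext hAB : φ ⁻¹' A = B), φ.image_preimage]
  refine ⟨himage _ _ fun p => ?_, himage _ _ fun p => ?_, himage _ _ fun p => ?_⟩
  all_goals obtain ⟨r, hr, e⟩ := key p
  · rw [mem_circle_iff_lor, mem_circle_iff_lor, e, mul_eq_zero, or_iff_right hr.ne']
  · rw [mem_openDisk_iff, mem_openDisk_iff, e, mul_pos_iff_of_pos_left hr]
  · rw [mem_closedDisk_iff, mem_closedDisk_iff, e, mul_nonneg_iff_of_pos_left hr]

theorem IsDualDisk.map {K K' : ι → GDisk} {σ : Equiv.Perm GDisk} (hσ : σ ∈ reflectionGroup K')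
    {i j k : ι} {U : GDisk} (d : IsDualDisk K i j k U) :
    IsDualDisk (fun i => σ (K i)) i j k (σ U) := by
  obtain ⟨φ, hφ⟩ := exists_image_eq hσ
  have ht : ∀ C D : GDisk, Tangent C D → Tangent (σ C) (σ D) := by
    rintro C D ⟨p, ⟨h1, h2⟩, huniq⟩
    rw [Tangent, (hφ C).1, (hφ D).1]
    refine ⟨φ p, ⟨mem_image_of_mem _ h1, mem_image_of_mem _ h2⟩, ?_⟩
    rintro _ ⟨⟨q, hq, rfl⟩, hq'⟩
    rw [huniq q ⟨hq, φ.injective.mem_set_image.mp hq'⟩]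
  have hv : ∀ C D : GDisk, C.circle ∩ D.circle ⊆ U.circle →
      (σ C).circle ∩ (σ D).circle ⊆ (σ U).circle := by
    intro C D h
    rw [(hφ C).1, (hφ D).1, (hφ U).1, ← image_inter φ.injective]
    exact image_mono h
  refine ⟨ht _ _ d.tangent_ij, ht _ _ d.tangent_jk, ht _ _ d.tangent_ki, hv _ _ d.vertex_ij,
    hv _ _ d.vertex_jk, hv _ _ d.vertex_ki, fun l h1 h2 h3 => ?_⟩
  rw [(hφ _).2.1, (hφ _).2.1, disjoint_image_iff φ.injective]
  exact d.disjoint l h1 h2 h3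

theorem IsInitialConfiguration.map [Fintype ι] {K : ι → GDisk} (hK : IsInitialConfiguration K)
    {σ : Equiv.Perm GDisk} (hσ : σ ∈ reflectionGroup K) :
    IsInitialConfiguration (fun i => σ (K i)) := by
  obtain ⟨φ, hφ⟩ := exists_image_eq hσ
  refine ⟨hK.four_le_card, fun i j hij => ?_, fun p hp => ?_⟩
  · rw [(hφ _).2.1, (hφ _).2.1, disjoint_image_iff φ.injective]
    exact hK.disjoint i j hij
  · obtain ⟨q, rfl⟩ := φ.surjective p
    obtain ⟨i, j, k, U, d, hU⟩ := hK.triangular q fun l hl => hp l (by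
      rw [(hφ _).2.2]; exact mem_image_of_mem _ hl)
    refine ⟨i, j, k, σ U, d.map hσ, ?_⟩
    rw [(hφ _).2.1]
    exact mem_image_of_mem _ hU

/-- The reflection in the image of a disk is the conjugate reflection. -/
theorem reflection_map {K : ι → GDisk} {σ : Equiv.Perm GDisk} (hσ : σ ∈ reflectionGroup K)
    (U : GDisk) : (σ U).reflection = σ * U.reflection * σ⁻¹ := by
  obtain ⟨L, -, h⟩ := exists_linear hσ
  rw [eq_mul_inv_iff_mul_eq]
  ext1 D
  apply vec_injective
  change ((σ U).reflect (σ D)).vec = (σ (U.reflect D)).vec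
  rw [vec_reflect, lrefl_apply, h (U.reflect D), vec_reflect, lrefl_apply, lor_vec, lor_vec,
    inv_map_map hσ, h, h, map_sub, map_smul]

theorem reflectionGroup_map {K : ι → GDisk} {σ : Equiv.Perm GDisk} (hσ : σ ∈ reflectionGroup K) :
    reflectionGroup (fun i => σ (K i)) = reflectionGroup K := by
  apply le_antisymm
  · refine (Subgroup.closure_le _).mpr ?_
    rintro _ ⟨i, j, k, U, d, rfl⟩
    have h := d.map (inv_mem hσ)
    simp only [show ∀ D, σ⁻¹ (σ D) = D from σ.symm_apply_apply] at h
    have e : U.reflection = σ * (σ⁻¹ U).reflection * σ⁻¹ := by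
      rw [← reflection_map hσ, show σ (σ⁻¹ U) = U from σ.apply_symm_apply U]
    rw [e]
    exact mul_mem (mul_mem hσ (Subgroup.subset_closure ⟨i, j, k, _, h, rfl⟩)) (inv_mem hσ)
  · -- conjugation by `σ` maps the group of `K` to that of the image, and it preserves the former
    have hconj : reflectionGroup K ≤
        (reflectionGroup fun i => σ (K i)).comap (MulAut.conj σ).toMonoidHom := by
      refine (Subgroup.closure_le _).mpr ?_
      rintro _ ⟨i, j, k, U, d, rfl⟩
      change σ * U.reflection * σ⁻¹ ∈ reflectionGroup fun i => σ (K i)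
      rw [← reflection_map hσ]
      exact Subgroup.subset_closure ⟨i, j, k, _, d.map hσ, rfl⟩
    intro τ hτ
    have h : σ * (σ⁻¹ * τ * σ) * σ⁻¹ ∈ reflectionGroup fun i => σ (K i) :=
      hconj (mul_mem (mul_mem (inv_mem hσ) hτ) hσ)
    rwa [show σ * (σ⁻¹ * τ * σ) * σ⁻¹ = τ by group] at h

theorem packing_map {K : ι → GDisk} {σ : Equiv.Perm GDisk} (hσ : σ ∈ reflectionGroup K) :
    packing (fun i => σ (K i)) = packing K := by
  ext C
  simp only [packing, mem_ofPred_eq, reflectionGroup_map hσ]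
  constructor
  · rintro ⟨τ, hτ, i, rfl⟩
    exact ⟨τ * σ, mul_mem hτ hσ, i, rfl⟩
  · rintro ⟨τ, hτ, i, rfl⟩
    refine ⟨τ * σ⁻¹, mul_mem hτ (inv_mem hσ), i, ?_⟩
    rw [Equiv.Perm.mul_apply, show σ⁻¹ (σ (K i)) = K i from σ.symm_apply_apply _]

/-! ### The gap distribution -/

theorem IsArc.measure_pos {C₀ : GDisk} {J : Set ℝ} (hJ : IsArc C₀ J) : 0 < (volume J).toReal := by
  obtain ⟨x, y, hxy, h1, h2⟩ := hJ.exists_bounds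
  refine ENNReal.toReal_pos (ne_of_gt ?_) (ne_top_of_le_ne_top measure_Icc_lt_top.ne (measure_mono h2))
  refine lt_of_lt_of_le ?_ (measure_mono h1)
  rw [Real.volume_Ioo]
  exact ENNReal.ofReal_pos.mpr (sub_pos.mpr hxy)

/-- If the number of tangencies in an arc grows linearly, then all gaps are eventually longer than a fixed
multiple of the mean spacing. -/
theorem eventually_gapDistribution_eq_zero [Fintype ι] {K : ι → GDisk}
    (hK : IsInitialConfiguration K) {C₀ : GDisk} (hC₀ : C₀ ∈ packing K) {J : Set ℝ}
    (hJ : IsArc C₀ J) {ε s : ℝ} (hε : 0 < ε) (hs : s ≤ ε / 2)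
    (h : ∀ᶠ T in atTop, (tangencies (packing K) C₀ T ∩ C₀.param '' J).Finite →
      ε * (volume J).toReal * T ≤ ((tangencies (packing K) C₀ T ∩ C₀.param '' J).ncard : ℝ)) :
    ∀ᶠ T in atTop, gapDistribution (packing K) C₀ J T s = 0 := by
  have hl := hJ.measure_pos
  filter_upwards [h, eventually_ge_atTop |C₀.a|, eventually_gt_atTop 0] with T hT hTa hT0
  by_cases hfin : (tangencies (packing K) C₀ T ∩ C₀.param '' J).Finite
  swap
  · rw [gapDistribution, Set.Infinite.ncard hfin, Nat.cast_zero, div_zero]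
  have hN := hT hfin
  rw [gapDistribution, div_eq_zero_iff]
  left
  rw [Nat.cast_eq_zero, show {x | _} = (∅ : Set ℂ) from ?_, ncard_empty]
  rw [eq_empty_iff_forall_notMem]
  rintro x ⟨-, t, t', -, hgap, -, hle⟩
  set N : ℝ := ((tangencies (packing K) C₀ T ∩ C₀.param '' J).ncard : ℝ) with hNdef
  have hN0 : 0 < N := lt_of_lt_of_le (by positivity) hN
  rw [meanSpacing, ← hNdef, div_le_iff₀ (div_pos hl hN0)] at hle
  have h1 := hgap.two_le hK hC₀ hT0.le
  have hlt := hgap.1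
  -- the gap is at most half of `1 / T`
  have h2 : (t' - t) * T ≤ 1 / 2 := by
    have h3 : (volume J).toReal / N * T ≤ 1 / ε := by
      rw [div_mul_eq_mul_div, div_le_div_iff₀ hN0 hε]
      linarith
    calc (t' - t) * T ≤ s * ((volume J).toReal / N) * T := by gcongr
      _ ≤ ε / 2 * ((volume J).toReal / N) * T := by gcongr
      _ = ε / 2 * ((volume J).toReal / N * T) := by ring
      _ ≤ ε / 2 * (1 / ε) := by gcongr
      _ = 1 / 2 := by field_simp
  nlinarith [mul_le_mul_of_nonneg_left hTa (sub_pos.mpr hlt).le]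

end

theorem mainTheorem5 {ι : Type*} [Fintype ι] (K : ι → GDisk) (hK : IsInitialConfiguration K)
    (g : Equiv.Perm GDisk) (hg : g ∈ reflectionGroup K) (i₀ : ι)
    (C₀ : GDisk) (hC₀ : C₀ = g (K i₀)) :
    ∃ δ : ℝ, 0 < δ ∧
      (∀ T : ℝ, 0 < T → (tangencies (packing K) C₀ 0 = ∅ ∨ 1 ≤ T) →
        ∀ t t' : ℝ, IsGap (packing K) C₀ T t t' →
          δ ≤ (t' - t) * tangencyDensity (fun i => g (K i)) i₀ * T) ∧
      (∀ J : Set ℝ, IsArc C₀ J → ∀ s ∈ Set.Icc 0 δ,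
        Filter.Tendsto (fun T : ℝ => gapDistribution (packing K) C₀ J T s)
          Filter.atTop (nhds 0)) := by
  subst hC₀
  have hK' := hK.map hg
  have hC₀ : g (K i₀) ∈ packing K := ⟨g, hg, i₀, rfl⟩
  have hc := tangencyDensity_pos hK' i₀
  set c := tangencyDensity (fun i => g (K i)) i₀
  obtain ⟨m, hm, hgap⟩ := exists_le_gap hK hC₀
  obtain ⟨ε, hε, hcount⟩ := exists_le_ncard hK' i₀
  rw [packing_map hg] at hcount
  refine ⟨min (m * c) (ε / 2), lt_min (mul_pos hm hc) (half_pos hε), ?_, ?_⟩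
  · intro T hT hT' t t' h
    calc min (m * c) (ε / 2) ≤ m * c := min_le_left _ _
      _ ≤ (t' - t) * T * c := by gcongr; exact hgap T hT hT' t t' h
      _ = (t' - t) * c * T := by ring
  · intro J hJ s hs
    exact tendsto_const_nhds.congr' ((eventually_gapDistribution_eq_zero hK hC₀ hJ hε
      (hs.2.trans (min_le_right _ _)) (hcount J hJ)).mono fun T h => h.symm)
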